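/- Let $G=(V,A)$ be a finite directed graph with $n$ vertices and $m$ arcs, let $s\neq t$ be vertices, let $c\in\mathbb{R}^m_{+}$, and let $Q=(q_{ef})\in\mathbb{R}^{m\times m}_{+}$ be a symmetric matrix with zero diagonal; rows, columns and entries are indexed by the arcs. An $s$-$t$ path is a directed walk from $s$ to $t$ with at least one arc and no repeated vertex; it is identified with its arc set where sums are concerned. The quadratic shortest path problem (QSPP) for $\mathcal{I}=(G,s,t,c,Q)$ asks for an $s$-$t$ path $P$ that minimizes $$C(P,c,Q)=\sum_{e,f\in P}q_{ef}+\sum_{e\in P}c_e .$$ Suppose that $Q+\mathrm{Diag}(c)$ is a nonnegative symmetric product matrix, i.e. it is entrywise nonnegative and equals $aa^{\mathsf T}$ for some $a\in\mathbb{R}^m$. Then: 1. There is a vector $a\in\mathbb{R}^m_{+}$ with $Q+\mathrm{Diag}(c)=aa^{\mathsf T}$. 2. For every $a\in\mathbb{R}^m$ with $Q+\mathrm{Diag}(c)=aa^{\mathsf T}$ and every $s$-$t$ path $P$, $C(P,c,Q)=\big(\sum_{e\in P}a_e\big)^2$. 3. For every $a\in\mathbb{R}^m_{+}$ with $Q+\mathrm{Diag}(c)=aa^{\mathsf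 T}$, an $s$-$t$ path is optimal for the QSPP $\mathcal{I}$ if and only if it is a shortest $s$-$t$ path with respect to the arc weights $a$. Moreover, the QSPP restricted to such instances is solvable in $\mathcal{O}(m+n\log n)$ time: there are one program for the real RAM (unit-cost random access machine with addition, subtraction and comparison of natural numbers, the four arithmetic operations and comparison of real numbers, and random access to $n,m,s,t$, to the list of arcs and to the entries of $c$ and $Q$) and one constant $K$ such that on every such instance the program halts within $K\,(m+n\log n)$ steps and outputs an optimal $s$-$t$ path together with its cost, or reports that there is no $s$-$t$ path. -/

import Mathlib

namespace QSPP

/-- A finite directed graph with vertices `Fin n`, arcs `Fin m`, a source and a target.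
Parallel arcs are allowed; a digraph without parallel arcs is the case in which
`e ↦ (tail e, head e)` is injective. -/
structure STGraph (n m : ℕ) where
  tail : Fin m → Fin n
  head : Fin m → Fin n
  s : Fin n
  t : Fin n
  s_ne_t : s ≠ t

namespace STGraph

variable {n m : ℕ} (G : STGraph n m)

/-- The arcs in the list are traversed consecutively and lead from the first vertex to the last. -/
def IsWalk : Fin n → List (Fin m) → Fin n → Prop
  | u, [], v => u = v
  | u, e :: P, v => G.tail e = u ∧ IsWalk (G.head e) P v

/-- `P` is (the arc sequence of) an `s`-`t` path: a walk with at least one arc and without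
repeated vertices; the visited vertices are `s` and the heads of the arcs. -/
def IsPath (P : List (Fin m)) : Prop :=
  P ≠ [] ∧ G.IsWalk G.s P G.t ∧ (G.s :: P.map G.head).Nodup

end STGraph

/-- `C(P, w) = ∑_{e ∈ P} w e`. -/
noncomputable def linearCost {m : ℕ} (w : Fin m → ℝ) (P : List (Fin m)) : ℝ :=
  ∑ e ∈ P.toFinset, w e

/-- `P` solves the shortest path problem on `G` with arc weights `w`. -/
def IsShortestPath {n m : ℕ} (G : STGraph n m) (w : Fin m → ℝ) (P : List (Fin m)) : Prop :=
  G.IsPath P ∧ ∀ P', G.IsPath P' → linearCost w P ≤ linearCost w P'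

/-- An instance `(G, s, t, c, Q)` of the quadratic shortest path problem. -/
structure Instance (n m : ℕ) extends STGraph n m where
  c : Fin m → ℝ
  Q : Matrix (Fin m) (Fin m) ℝ
  c_nonneg : ∀ e, 0 ≤ c e
  Q_nonneg : ∀ e f, 0 ≤ Q e f
  Q_symm : Q.IsSymm
  Q_diag : ∀ e, Q e e = 0

namespace Instance

variable {n m : ℕ} (I : Instance n m)

/-- `C(P, c, Q) = ∑_{e, f ∈ P} q_{ef} + ∑_{e ∈ P} c_e`. -/
noncomputable def cost (P : List (Fin m)) : ℝ :=
  (∑ e ∈ P.toFinset, ∑ f ∈ P.toFinset, I.Q e f) + ∑ e ∈ P.toFinset, I.c e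

/-- `P` is an `s`-`t` path of minimum quadratic cost. -/
def IsOptimal (P : List (Fin m)) : Prop :=
  I.IsPath P ∧ ∀ P', I.IsPath P' → I.cost P ≤ I.cost P'

/-- `Q + Diag(c)`. -/
def costMatrix : Matrix (Fin m) (Fin m) ℝ :=
  I.Q + Matrix.diagonal I.c

end Instance

/-- `M` is entrywise nonnegative and `M = a aᵀ` for some real vector `a`. -/
def IsNonnegSymmProduct {m : ℕ} (M : Matrix (Fin m) (Fin m) ℝ) : Prop :=
  (∀ e f, 0 ≤ M e f) ∧ ∃ a : Fin m → ℝ, M = Matrix.vecMulVec a a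

/-! ### The real RAM

A random access machine with unit costs. It has natural-number memories and real memories, each an
infinite array that is initially zero (a program names finitely many of them), and read-only random
access to the instance: `n`, `m`, `s`, `t`, the lists of tails and heads of the arcs, and the
entries of `c` and `Q`. Natural numbers can be added, subtracted and compared; reals can be added,
subtracted, multiplied, divided and compared. There is no rounding, and no conversion between the
two sorts. Out-of-range reads of the instance yield zero. Every operation, memory access, input
access and branching costs one step. -/

/-- Natural-number expressions; `load A i` is the content of cell `i` of natural memory `A`. -/
inductive NExp : Type
  | const (k : ℕ)
  | numVerts
  | numArcs
  | source
  | target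
  | tail (e : NExp)
  | head (e : NExp)
  | load (A : ℕ) (i : NExp)
  | add (x y : NExp)
  | sub (x y : NExp)

/-- Real expressions; `load A i` is the content of cell `i` of real memory `A`. -/
inductive RExp : Type
  | const (k : ℕ)
  | linear (e : NExp)
  | quad (e f : NExp)
  | load (A : ℕ) (i : NExp)
  | add (x y : RExp)
  | sub (x y : RExp)
  | mul (x y : RExp)
  | div (x y : RExp)

/-- Tests. -/
inductive BExp : Type
  | natEq (x y : NExp)
  | natLt (x y : NExp)
  | realLt (x y : RExp)
  | not (b : BExp)
  | and (b b' : BExp)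

/-- Programs; `storeN A i x` writes `x` to cell `i` of natural memory `A`, and `storeR` does the
same for real memories. -/
inductive Cmd : Type
  | skip
  | storeN (A : ℕ) (i x : NExp)
  | storeR (A : ℕ) (i : NExp) (x : RExp)
  | seq (p q : Cmd)
  | ite (b : BExp) (p q : Cmd)
  | while (b : BExp) (p : Cmd)

/-- Memory contents: memory name, then cell. -/
structure Mem where
  nat : ℕ → ℕ → ℕ
  real : ℕ → ℕ → ℝ

/-- All cells are zero. -/
def Mem.init : Mem := ⟨fun _ _ => 0, fun _ _ => 0⟩

/-- The number of operations in the evaluation of an expression. -/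
def NExp.time : NExp → ℕ
  | const _ | numVerts | numArcs | source | target => 1
  | tail e => e.time + 1
  | head e => e.time + 1
  | load _ i => i.time + 1
  | add x y => x.time + y.time + 1
  | sub x y => x.time + y.time + 1

/-- The number of operations in the evaluation of an expression. -/
def RExp.time : RExp → ℕ
  | const _ => 1
  | linear e => e.time + 1
  | quad e f => e.time + f.time + 1
  | load _ i => i.time + 1
  | add x y => x.time + y.time + 1
  | sub x y => x.time + y.time + 1
  | mul x y => x.time + y.time + 1
  | div x y => x.time + y.time + 1

/-- The number of operations in the evaluation of a test. -/
def BExp.time : BExp → ℕ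
  | natEq x y => x.time + y.time + 1
  | natLt x y => x.time + y.time + 1
  | realLt x y => x.time + y.time + 1
  | not b => b.time + 1
  | and b b' => b.time + b'.time + 1

section Semantics

variable {n m : ℕ} (I : Instance n m)

/-- Value of a natural-number expression (subtraction is truncated at zero). -/
def NExp.eval (σ : Mem) : NExp → ℕ
  | const k => k
  | numVerts => n
  | numArcs => m
  | source => I.s
  | target => I.t
  | tail e => if h : e.eval σ < m then I.tail ⟨e.eval σ, h⟩ else 0
  | head e => if h : e.eval σ < m then I.head ⟨e.eval σ, h⟩ else 0
  | load A i => σ.nat A (i.eval σ)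
  | add x y => x.eval σ + y.eval σ
  | sub x y => x.eval σ - y.eval σ

/-- Value of a real expression (division by zero yields zero). -/
noncomputable def RExp.eval (σ : Mem) : RExp → ℝ
  | const k => k
  | linear e => if h : e.eval I σ < m then I.c ⟨e.eval I σ, h⟩ else 0
  | quad e f =>
      if h : e.eval I σ < m ∧ f.eval I σ < m then
        I.Q ⟨e.eval I σ, h.1⟩ ⟨f.eval I σ, h.2⟩
      else 0
  | load A i => σ.real A (i.eval I σ)
  | add x y => x.eval σ + y.eval σ
  | sub x y => x.eval σ - y.eval σ
  | mul x y => x.eval σ * y.eval σ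
  | div x y => x.eval σ / y.eval σ

/-- Truth of a test. -/
def BExp.Holds (σ : Mem) : BExp → Prop
  | natEq x y => x.eval I σ = y.eval I σ
  | natLt x y => x.eval I σ < y.eval I σ
  | realLt x y => x.eval I σ < y.eval I σ
  | not b => ¬ b.Holds σ
  | and b b' => b.Holds σ ∧ b'.Holds σ

/-- Write one cell of a natural memory. -/
def Mem.setNat (σ : Mem) (A i x : ℕ) : Mem :=
  { σ with nat := Function.update σ.nat A (Function.update (σ.nat A) i x) }

/-- Write one cell of a real memory. -/
def Mem.setReal (σ : Mem) (A i : ℕ) (x : ℝ) : Mem :=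
  { σ with real := Function.update σ.real A (Function.update (σ.real A) i x) }

/-- `Exec I p σ σ' k`: on the instance `I`, the program `p` started with memory `σ` halts after
exactly `k` steps with memory `σ'`. -/
inductive Exec : Cmd → Mem → Mem → ℕ → Prop
  | skip (σ : Mem) : Exec .skip σ σ 1
  | storeN (A : ℕ) (i x : NExp) (σ : Mem) :
      Exec (.storeN A i x) σ (σ.setNat A (i.eval I σ) (x.eval I σ)) (i.time + x.time + 1)
  | storeR (A : ℕ) (i : NExp) (x : RExp) (σ : Mem) :
      Exec (.storeR A i x) σ (σ.setReal A (i.eval I σ) (x.eval I σ)) (i.time + x.time + 1)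
  | seq {p q : Cmd} {σ σ' σ'' : Mem} {k l : ℕ} :
      Exec p σ σ' k → Exec q σ' σ'' l → Exec (.seq p q) σ σ'' (k + l)
  | ite_true {b : BExp} {p q : Cmd} {σ σ' : Mem} {k : ℕ} :
      b.Holds I σ → Exec p σ σ' k → Exec (.ite b p q) σ σ' (b.time + 1 + k)
  | ite_false {b : BExp} {p q : Cmd} {σ σ' : Mem} {k : ℕ} :
      ¬ b.Holds I σ → Exec q σ σ' k → Exec (.ite b p q) σ σ' (b.time + 1 + k)
  | while_true {b : BExp} {p : Cmd} {σ σ' σ'' : Mem} {k l : ℕ} :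
      b.Holds I σ → Exec p σ σ' k → Exec (.while b p) σ' σ'' l →
        Exec (.while b p) σ σ'' (b.time + 1 + k + l)
  | while_false {b : BExp} {p : Cmd} {σ : Mem} :
      ¬ b.Holds I σ → Exec (.while b p) σ σ (b.time + 1)

/-- The memory holds a solution of the instance: cell `0` of natural memory `1` holds the number of
arcs of an optimal path, natural memory `0` holds its arcs in order from `s` to `t`, and cell `0`
of real memory `0` holds its cost; if there is no `s`-`t` path, the number of arcs is given as
zero. -/
def IsSolution (σ : Mem) : Prop :=
  (∃ P : List (Fin m), I.IsOptimal P ∧ σ.nat 1 0 = P.length ∧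
      (∀ (i : ℕ) (h : i < P.length), σ.nat 0 i = (P[i] : Fin m)) ∧ σ.real 0 0 = I.cost P) ∨
    ((¬ ∃ P, I.IsPath P) ∧ σ.nat 1 0 = 0)

end Semantics

/-- The program `p`, started with empty memory on `I`, halts within `T` steps and outputs a
solution. -/
def SolvesWithin (p : Cmd) {n m : ℕ} (I : Instance n m) (T : ℝ) : Prop :=
  ∃ (σ : Mem) (k : ℕ), Exec I p Mem.init σ k ∧ (k : ℝ) ≤ T ∧ IsSolution I σ

end QSPP

namespace QSPP

/-! ### Product matrices -/

/-! Structure. Let A = Q + Diag(c) = a aᵀ. The entries a_e a_f are nonnegative, so replacing a by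
|a| does not change the product. Since Diag(c) contributes to P × P exactly the costs of the arcs of
P, the quadratic cost of P is the sum of A over P × P, that is, (∑_{e ∈ P} a_e)². Squaring is
monotone on nonnegative numbers, so for a ≥ 0 minimizing the cost and minimizing the weight are the
same.

Avoiding square roots. The machine cannot compute a, but the column of A at an arc f with c_f > 0 is
a_f · a, which has the same shortest paths as |a|; the cost of P is the squared length of P divided
by c_f = a_f² (`Instance.cost_eq_div`). If there is no such arc, then a = 0 and every path costs 0.
The index f = m then serves: reads out of range give zero weights, and division by zero gives the
correct cost 0. Only one column of Q is ever read.

Shortest paths. Dijkstra's algorithm runs in the required time if the priority queue inserts and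
decreases keys in constant amortized time and extracts a minimum in logarithmic amortized time. The
queue here is a forest in the manner of quake heaps. Decreasing a key cuts an item off and leaves an
empty slot in its parent; no rank changes and nothing cascades. Before each extraction the numbers
`cnt j` of items of rank at least j are inspected. While `cnt (i + 1)` exceeds 3/4 of `cnt i` for
some i, all slots above level i are destroyed. By `Heap.Valid.truncate_pays` at least a third of the
destroyed slots are empty, so the potential 4000 · empty − 150 · filled pays for the work; it is at
least −150 n because each filled slot has its own child (`Heap.Valid.filled_le`). Once the counts
decrease geometrically, no rank exceeds log n / log (4/3) (`Heap.pow_mul_cnt_le`), and an extraction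
touches only that many buckets and children. These amortized bounds are `exec_relax` and
`exec_extractMin`.

Correctness. At the end all arcs leaving reached vertices are relaxed, so the recorded distances are
a feasible potential and bound every walk from below (`STGraph.DijkstraInv.le_of_isWalk`); recorded
paths attain them.

The argument has three layers: the abstract `Heap` with its invariants and counts, the relation
`Rep` between heap and memory, and timed executions, in which `exec_while` handles every loop
through an invariant and a potential. -/

theorem IsNonnegSymmProduct.exists_nonneg {m : ℕ} {M : Matrix (Fin m) (Fin m) ℝ}
    (h : IsNonnegSymmProduct M) :
    ∃ a : Fin m → ℝ, (∀ e, 0 ≤ a e) ∧ M = Matrix.vecMulVec a a := by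
  obtain ⟨h0, a, rfl⟩ := h
  refine ⟨fun e => |a e|, fun e => abs_nonneg _, ?_⟩
  ext e f
  have := h0 e f
  simp only [Matrix.vecMulVec_apply] at this ⊢
  rw [← abs_mul, abs_of_nonneg this]

namespace Instance

variable {n m : ℕ} (I : Instance n m)

theorem cost_eq_sum_costMatrix (P : List (Fin m)) :
    I.cost P = ∑ e ∈ P.toFinset, ∑ f ∈ P.toFinset, I.costMatrix e f := by
  simp only [cost, costMatrix, Matrix.add_apply, Finset.sum_add_distrib]
  congr 1
  refine Finset.sum_congr rfl fun e he => ?_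
  simp only [Matrix.diagonal_apply, Finset.sum_ite_eq, he, if_true]

theorem cost_eq_sq {a : Fin m → ℝ} (h : I.costMatrix = Matrix.vecMulVec a a) (P : List (Fin m)) :
    I.cost P = linearCost a P ^ 2 := by
  simp only [cost_eq_sum_costMatrix, h, Matrix.vecMulVec_apply, linearCost, sq, Finset.sum_mul_sum]

theorem isOptimal_iff_isShortestPath {a : Fin m → ℝ} (ha : ∀ e, 0 ≤ a e)
    (h : I.costMatrix = Matrix.vecMulVec a a) (P : List (Fin m)) :
    I.IsOptimal P ↔ IsShortestPath I.toSTGraph a P := by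
  refine and_congr_right fun _ => forall_congr' fun P' => imp_congr_right fun _ => ?_
  rw [I.cost_eq_sq h, I.cost_eq_sq h]
  exact pow_le_pow_iff_left₀ (Finset.sum_nonneg fun e _ => ha e)
    (Finset.sum_nonneg fun e _ => ha e) two_ne_zero

end Instance

/-! ### Reasoning about programs -/

/-- Contains no loop. -/
def Cmd.LoopFree : Cmd → Prop
  | .skip | .storeN .. | .storeR .. => True
  | .seq p q => p.LoopFree ∧ q.LoopFree
  | .ite _ p q => p.LoopFree ∧ q.LoopFree
  | .while _ _ => False

/-- A bound for the running time of a loop-free program. -/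
def Cmd.maxTime : Cmd → ℕ
  | .skip => 1
  | .storeN _ i x => i.time + x.time + 1
  | .storeR _ i x => i.time + x.time + 1
  | .seq p q => p.maxTime + q.maxTime
  | .ite b p q => b.time + 1 + max p.maxTime q.maxTime
  | .while _ _ => 0

section

variable {n m : ℕ} (I : Instance n m)

open Classical in
/-- The memory after the execution of a loop-free program. -/
noncomputable def Cmd.run : Cmd → Mem → Mem
  | .skip, σ => σ
  | .storeN A i x, σ => σ.setNat A (i.eval I σ) (x.eval I σ)
  | .storeR A i x, σ => σ.setReal A (i.eval I σ) (x.eval I σ)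
  | .seq p q, σ => q.run (p.run σ)
  | .ite b p q, σ => if b.Holds I σ then p.run σ else q.run σ
  | .while _ _, σ => σ

theorem Cmd.LoopFree.exec {p : Cmd} (hp : p.LoopFree) (σ : Mem) :
    ∃ k ≤ p.maxTime, Exec I p σ (p.run I σ) k := by
  induction p generalizing σ with
  | skip => exact ⟨_, le_rfl, .skip σ⟩
  | storeN A i x => exact ⟨_, le_rfl, .storeN A i x σ⟩
  | storeR A i x => exact ⟨_, le_rfl, .storeR A i x σ⟩
  | seq p q ihp ihq =>
    obtain ⟨k, hk, h⟩ := ihp hp.1 σ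
    obtain ⟨l, hl, h'⟩ := ihq hp.2 (p.run I σ)
    exact ⟨k + l, add_le_add hk hl, .seq h h'⟩
  | ite b p q ihp ihq =>
    by_cases hb : b.Holds I σ
    · obtain ⟨k, hk, h⟩ := ihp hp.1 σ
      refine ⟨b.time + 1 + k, ?_, ?_⟩
      · simp only [maxTime]; omega
      · simpa [run, hb] using Exec.ite_true (q := q) hb h
    · obtain ⟨k, hk, h⟩ := ihq hp.2 σ
      refine ⟨b.time + 1 + k, ?_, ?_⟩
      · simp only [maxTime]; omega
      · simpa [run, hb] using Exec.ite_false (p := p) hb h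
  | _ => exact hp.elim

/-- Total correctness of a loop, with a ghost state `a` and a potential `Φ` that pays for the
execution time. -/
theorem exec_while {α : Type*} {b : BExp} {p : Cmd} (Inv : α → Mem → Prop) (Φ : α → ℕ)
    (step : ∀ a σ, Inv a σ → b.Holds I σ →
      ∃ a' σ' k, Exec I p σ σ' k ∧ Inv a' σ' ∧ k + (b.time + 1) + Φ a' ≤ Φ a)
    {a : α} {σ : Mem} (h : Inv a σ) :
    ∃ a' σ' k, Exec I (.while b p) σ σ' k ∧ Inv a' σ' ∧ ¬ b.Holds I σ' ∧
      k + Φ a' ≤ Φ a + (b.time + 1) := by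
  -- An iteration costs at least the test, so Φ strictly decreases. Only the final, failing test is
  -- not paid by Φ; it is the extra summand in the conclusion.
  induction hN : Φ a using Nat.strong_induction_on generalizing a σ with
  | _ N ih =>
    subst hN
    by_cases hb : b.Holds I σ
    · obtain ⟨a₁, σ₁, k₁, h₁, hI, hk₁⟩ := step a σ h hb
      obtain ⟨a₂, σ₂, k₂, h₂, hI₂, hb₂, hk₂⟩ := ih (Φ a₁) (by omega) hI rfl
      exact ⟨a₂, σ₂, _, .while_true hb h₁ h₂, hI₂, hb₂, by omega⟩
    · exact ⟨a, σ, _, .while_false hb, h, hb, by omega⟩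

end

@[simp] theorem Mem.setNat_nat_self (σ : Mem) (A i x : ℕ) :
    (σ.setNat A i x).nat A = Function.update (σ.nat A) i x := by simp [setNat]

theorem Mem.setNat_nat_of_ne (σ : Mem) {A B : ℕ} (h : B ≠ A) (i x : ℕ) :
    (σ.setNat A i x).nat B = σ.nat B := by simp [setNat, h]

@[simp] theorem Mem.setNat_real (σ : Mem) (A i x : ℕ) : (σ.setNat A i x).real = σ.real := rfl

@[simp] theorem Mem.setReal_nat (σ : Mem) (A i : ℕ) (x : ℝ) : (σ.setReal A i x).nat = σ.nat := rfl

@[simp] theorem Mem.setReal_real_self (σ : Mem) (A i : ℕ) (x : ℝ) :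
    (σ.setReal A i x).real A = Function.update (σ.real A) i x := by simp [setReal]

theorem Mem.setReal_real_of_ne (σ : Mem) {A B : ℕ} (h : B ≠ A) (i : ℕ) (x : ℝ) :
    (σ.setReal A i x).real B = σ.real B := by simp [setReal, h]

end QSPP

namespace QSPP

/-! ### Heap-ordered forests with ranked slots

A heap of rank-labelled items. An item `x` of rank `r` has the slots `1, …, r`; slot `j` is empty
or holds a child of rank `j - 1`. Roots of distinct ranks are registered in buckets; the remaining
roots are kept in an array of pending roots. In `par`, `bk` and `sl`, the number `0` stands for
`none` and `x + 1` for the item `x`. -/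

/-- State of the heap. -/
structure Heap where
  /-- the items in the heap -/
  live : Finset ℕ
  /-- ranks -/
  rk : ℕ → ℕ
  /-- parents -/
  par : ℕ → ℕ
  /-- the registered root of a given rank -/
  bk : ℕ → ℕ
  /-- the array of pending roots -/
  pend : ℕ → ℕ
  /-- the number of pending roots -/
  np : ℕ
  /-- slots -/
  sl : ℕ → ℕ → ℕ
  /-- keys -/
  key : ℕ → ℝ

namespace Heap

/-- The number of items of rank at least `j`. -/
def cnt (H : Heap) (j : ℕ) : ℕ := {x ∈ H.live | j ≤ H.rk x}.card

/-- The number of filled slots. -/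
def filled (H : Heap) : ℕ := ∑ x ∈ H.live, {j ∈ Finset.Icc 1 (H.rk x) | H.sl x j ≠ 0}.card

/-- The number of empty slots. -/
def empty (H : Heap) : ℕ := ∑ x ∈ H.live, {j ∈ Finset.Icc 1 (H.rk x) | H.sl x j = 0}.card

/-- The structural invariants. -/
structure Valid (H : Heap) : Prop where
  slot : ∀ x ∈ H.live, ∀ j y, 1 ≤ j → j ≤ H.rk x → H.sl x j = y + 1 →
    y ∈ H.live ∧ H.par y = x + 1 ∧ H.rk y + 1 = j ∧ H.key x ≤ H.key y
  par : ∀ y ∈ H.live, ∀ x, H.par y = x + 1 →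
    x ∈ H.live ∧ H.rk y < H.rk x ∧ H.sl x (H.rk y + 1) = y + 1
  bk : ∀ r x, H.bk r = x + 1 → x ∈ H.live ∧ H.par x = 0 ∧ H.rk x = r
  pend : ∀ k < H.np, H.pend k ∈ H.live ∧ H.par (H.pend k) = 0 ∧
    H.bk (H.rk (H.pend k)) ≠ H.pend k + 1
  pend_inj : ∀ k < H.np, ∀ l < H.np, H.pend k = H.pend l → k = l
  root : ∀ x ∈ H.live, H.par x = 0 → H.bk (H.rk x) = x + 1 ∨ ∃ k < H.np, H.pend k = x

/-! #### Counting -/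

theorem card_filter_add_card_filter (H : Heap) (x : ℕ) :
    {j ∈ Finset.Icc 1 (H.rk x) | H.sl x j ≠ 0}.card +
      {j ∈ Finset.Icc 1 (H.rk x) | H.sl x j = 0}.card = H.rk x := by
  rw [add_comm, Finset.card_filter_add_card_filter_not]; simp

theorem filled_add_empty (H : Heap) : H.filled + H.empty = ∑ x ∈ H.live, H.rk x := by
  simp only [filled, empty, ← Finset.sum_add_distrib, card_filter_add_card_filter]

theorem cnt_zero (H : Heap) : H.cnt 0 = H.live.card := by simp [cnt]

theorem cnt_pos_iff {H : Heap} {j : ℕ} : 0 < H.cnt j ↔ ∃ x ∈ H.live, j ≤ H.rk x := by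
  simp [cnt, Finset.card_pos, Finset.Nonempty]

/-- A filled slot can be recovered from its child: the item is the parent, the index is one more
than the rank of the child. Thus filled slots inject into items. This bounds the credit that links
can draw from the number of filled slots. -/
theorem Valid.filled_le {H : Heap} (hH : H.Valid) : H.filled ≤ H.live.card := by
  rw [filled, ← Finset.card_sigma]
  refine Finset.card_le_card_of_injOn (fun p => H.sl p.1 p.2 - 1) ?_ ?_
  · rintro ⟨x, j⟩ hp
    simp only [Finset.coe_sigma, Set.mem_sigma_iff, Finset.mem_coe, Finset.mem_filter,
      Finset.mem_Icc] at hp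
    obtain ⟨y, hy⟩ := Nat.exists_eq_succ_of_ne_zero hp.2.2
    simpa [hy] using (hH.slot x hp.1 j y hp.2.1.1 hp.2.1.2 hy).1
  · rintro ⟨x, j⟩ hp ⟨x', j'⟩ hp' heq
    simp only [Finset.coe_sigma, Set.mem_sigma_iff, Finset.mem_coe, Finset.mem_filter,
      Finset.mem_Icc] at hp hp'
    obtain ⟨y, hy⟩ := Nat.exists_eq_succ_of_ne_zero hp.2.2
    obtain ⟨y', hy'⟩ := Nat.exists_eq_succ_of_ne_zero hp'.2.2
    simp only [hy, hy', Nat.succ_eq_add_one, Nat.add_sub_cancel] at heq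
    subst heq
    have h1 := hH.slot x hp.1 j y hp.2.1.1 hp.2.1.2 hy
    have h2 := hH.slot x' hp'.1 j' y hp'.2.1.1 hp'.2.1.2 hy'
    obtain rfl : x = x' := by omega
    obtain rfl : j = j' := by omega
    rfl

/-- The number of empty slots of index `j`. -/
def emptyAt (H : Heap) (j : ℕ) : ℕ := {x ∈ H.live | j ≤ H.rk x ∧ H.sl x j = 0}.card

/-- The children in the filled slots of index j + 1 are distinct items of rank exactly j. There are
`cnt j - cnt (j + 1)` items of that rank and `cnt (j + 1) - emptyAt (j + 1)` such slots. -/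
theorem Valid.two_mul_cnt_succ_le {H : Heap} (hH : H.Valid) (j : ℕ) :
    2 * H.cnt (j + 1) ≤ H.cnt j + H.emptyAt (j + 1) := by
  have h1 : {x ∈ H.live | j + 1 ≤ H.rk x}.card =
      {x ∈ H.live | j + 1 ≤ H.rk x ∧ H.sl x (j + 1) = 0}.card +
      {x ∈ H.live | j + 1 ≤ H.rk x ∧ H.sl x (j + 1) ≠ 0}.card := by
    rw [← Finset.filter_filter, ← Finset.filter_filter, Finset.card_filter_add_card_filter_not]
  have h2 : {x ∈ H.live | j + 1 ≤ H.rk x ∧ H.sl x (j + 1) ≠ 0}.card ≤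
      {x ∈ H.live | H.rk x = j}.card := by
    refine Finset.card_le_card_of_injOn (fun x => H.sl x (j + 1) - 1) ?_ ?_
    · intro x hx
      simp only [Finset.coe_filter, Set.mem_ofPred_eq] at hx ⊢
      obtain ⟨y, hy⟩ := Nat.exists_eq_succ_of_ne_zero hx.2.2
      have := hH.slot x hx.1 _ y (by omega) hx.2.1 hy
      rw [hy]
      exact ⟨this.1, by simpa using this.2.2.1⟩
    · intro x hx x' hx' heq
      simp only [Finset.coe_filter, Set.mem_ofPred_eq] at hx hx'
      obtain ⟨y, hy⟩ := Nat.exists_eq_succ_of_ne_zero hx.2.2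
      obtain ⟨y', hy'⟩ := Nat.exists_eq_succ_of_ne_zero hx'.2.2
      simp only [hy, hy', Nat.succ_eq_add_one, Nat.add_sub_cancel] at heq
      subst heq
      have h1 := hH.slot x hx.1 _ y (by omega) hx.2.1 hy
      have h2 := hH.slot x' hx'.1 _ y (by omega) hx'.2.1 hy'
      omega
  have h3 : {x ∈ H.live | j ≤ H.rk x}.card =
      {x ∈ H.live | j + 1 ≤ H.rk x}.card + {x ∈ H.live | H.rk x = j}.card := by
    rw [← Finset.card_union_of_disjoint]
    · congr 1
      ext x
      simp only [Finset.mem_filter, Finset.mem_union]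
      rw [← and_or_left]
      exact and_congr_right fun _ => by omega
    · exact Finset.disjoint_filter.2 fun x _ h => by omega
  simp only [cnt, emptyAt]
  omega

/-- Double counting: slots of index at most i are counted item by item, those above i index by
index. Applied to the empty and to the filled slots, it isolates what a truncation at level i
destroys. -/
theorem sum_card_Ioc (s : Finset ℕ) (f : ℕ → ℕ) (p : ℕ → ℕ → Prop) [∀ x, DecidablePred (p x)]
    {i M : ℕ} (hM : ∀ x ∈ s, f x ≤ M) :
    ∑ x ∈ s, {j ∈ Finset.Icc 1 (f x) | p x j}.card =
      ∑ x ∈ s, {j ∈ Finset.Icc 1 (min (f x) i) | p x j}.card +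
        ∑ j ∈ Finset.Ioc i M, {x ∈ s | j ≤ f x ∧ p x j}.card := by
  have : ∑ j ∈ Finset.Ioc i M, {x ∈ s | j ≤ f x ∧ p x j}.card =
      ∑ x ∈ s, {j ∈ Finset.Ioc i M | j ≤ f x ∧ p x j}.card := by
    simp only [Finset.card_filter]
    exact Finset.sum_comm
  rw [this, ← Finset.sum_add_distrib]
  refine Finset.sum_congr rfl fun x hx => ?_
  rw [← Finset.card_union_of_disjoint]
  · congr 1
    ext j
    have := hM x hx
    simp only [Finset.mem_filter, Finset.mem_union, Finset.mem_Icc, Finset.mem_Ioc]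
    by_cases hp : p x j
    · simp only [hp, and_true]; omega
    · simp [hp]
  · refine Finset.disjoint_left.2 fun j => ?_
    simp only [Finset.mem_filter, Finset.mem_Icc, Finset.mem_Ioc]
    omega

/-- If the items of rank more than `i` are too many, then at least a third of the slots above `i`
are empty. -/
theorem Valid.truncate_pays {H H' : Heap} (hH : H.Valid) {i : ℕ}
    (hi : 3 * H.cnt i < 4 * H.cnt (i + 1)) (hl : H'.live = H.live) (hs : H'.sl = H.sl)
    (hr : ∀ x ∈ H.live, H'.rk x = min (H.rk x) i) :
    H'.filled ≤ H.filled ∧ H'.empty < H.empty ∧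
      H.filled + H.empty + 3 * H'.empty ≤ H'.filled + H'.empty + 3 * H.empty := by
  -- The maximum with i + 1 guarantees that the index i + 1 occurs in the sums over (i, M].
  set M := max (i + 1) (H.live.sup H.rk) with hMdef
  have hM : ∀ x ∈ H.live, H.rk x ≤ M := fun x hx => (Finset.le_sup hx).trans (le_max_right _ _)
  have e1 : H.empty = H'.empty + ∑ j ∈ Finset.Ioc i M, H.emptyAt j := by
    have := sum_card_Ioc H.live H.rk (fun x j => H.sl x j = 0) (i := i) hM
    rw [empty, this, empty, hl, hs]
    congr 1
    exact Finset.sum_congr rfl fun x hx => by rw [hr x hx]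
  have f1 : H.filled = H'.filled +
      ∑ j ∈ Finset.Ioc i M, {x ∈ H.live | j ≤ H.rk x ∧ H.sl x j ≠ 0}.card := by
    have := sum_card_Ioc H.live H.rk (fun x j => H.sl x j ≠ 0) (i := i) hM
    rw [filled, this, filled, hl, hs]
    congr 1
    exact Finset.sum_congr rfl fun x hx => by rw [hr x hx]
  have c1 : ∑ j ∈ Finset.Ioc i M, H.cnt j = ∑ j ∈ Finset.Ioc i M, H.emptyAt j +
      ∑ j ∈ Finset.Ioc i M, {x ∈ H.live | j ≤ H.rk x ∧ H.sl x j ≠ 0}.card := by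
    rw [← Finset.sum_add_distrib]
    refine Finset.sum_congr rfl fun j _ => ?_
    rw [cnt, emptyAt, ← Finset.filter_filter, ← Finset.filter_filter,
      Finset.card_filter_add_card_filter_not]
  -- The inequalities `two_mul_cnt_succ_le` telescope: the filled slots of index in (i, i + d],
  -- together with the items of rank at least i + d, are at most `cnt i` in number.
  have key : ∀ d, ∑ j ∈ Finset.Ioc i (i + d), H.cnt j + H.cnt (i + d) ≤
      H.cnt i + ∑ j ∈ Finset.Ioc i (i + d), H.emptyAt j := by
    intro d
    induction d with
    | zero => simp
    | succ d ih =>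
      rw [← add_assoc, ← Finset.insert_Ioc_right_eq_Ioc_add_one (by omega),
        Finset.sum_insert (by simp), Finset.sum_insert (by simp)]
      have := hH.two_mul_cnt_succ_le (i + d)
      omega
  -- Let E be the number of destroyed empty slots. Then 2 E ≥ 2 `emptyAt (i + 1)` ≥ 4 `cnt (i + 1)`
  -- − 2 `cnt i` > `cnt i`, so E > 0. By `key` at most `cnt i` < 2 E filled slots are destroyed,
  -- hence at most 3 E slots in all.
  have h0 := hH.two_mul_cnt_succ_le i
  have h1 : H.emptyAt (i + 1) ≤ ∑ j ∈ Finset.Ioc i M, H.emptyAt j :=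
    Finset.single_le_sum (f := H.emptyAt) (fun _ _ => Nat.zero_le _)
      (by simp only [Finset.mem_Ioc]; omega)
  obtain ⟨d, hd⟩ := Nat.exists_eq_add_of_le (show i ≤ M by omega)
  have h2 := key d
  rw [← hd] at h2
  omega

/-- While the counts decrease geometrically, ranks are logarithmic. -/
theorem pow_mul_cnt_le (H : Heap) {r : ℕ} (h : ∀ j < r, 4 * H.cnt (j + 1) ≤ 3 * H.cnt j) :
    4 ^ r * H.cnt r ≤ 3 ^ r * H.live.card := by
  induction r with
  | zero => simp [cnt_zero]
  | succ r ih =>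
    have h1 := ih fun j hj => h j (by omega)
    have h2 := h r (by omega)
    calc 4 ^ (r + 1) * H.cnt (r + 1) = 4 ^ r * (4 * H.cnt (r + 1)) := by ring
      _ ≤ 4 ^ r * (3 * H.cnt r) := by gcongr
      _ = 3 * (4 ^ r * H.cnt r) := by ring
      _ ≤ 3 * (3 ^ r * H.live.card) := by gcongr
      _ = _ := by ring

/-- Some root has minimum key. -/
theorem Valid.exists_min_root {H : Heap} (hH : H.Valid) {y : ℕ} (hy : y ∈ H.live) :
    ∃ x ∈ H.live, H.par x = 0 ∧ H.rk y ≤ H.rk x ∧ H.key x ≤ H.key y := by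
  obtain ⟨M, hM⟩ : ∃ M, ∀ x ∈ H.live, H.rk x ≤ M := ⟨H.live.sup H.rk, fun x hx => Finset.le_sup hx⟩
  -- Climbing from child to parent raises the rank, which is bounded on the finite set of items, and
  -- does not raise the key.
  induction hd : M - H.rk y using Nat.strong_induction_on generalizing y with
  | _ d ih =>
    rcases Nat.eq_zero_or_eq_succ_pred (H.par y) with h0 | h0
    · exact ⟨y, hy, h0, le_rfl, le_rfl⟩
    · obtain ⟨hp, hlt, hsl⟩ := hH.par y hy _ h0
      have hk := (hH.slot _ hp _ y (by omega) (by omega) hsl).2.2.2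
      have := hM _ hp
      obtain ⟨x, hx, h1, h2, h3⟩ := ih _ (by omega) hp rfl
      exact ⟨x, hx, h1, by omega, h3.trans hk⟩

end Heap

end QSPP

namespace QSPP

namespace Heap

open Function (update update_apply)

/-! #### Operations -/

/-- Register the last pending root. -/
def place (H : Heap) : Heap :=
  { H with
    bk := update H.bk (H.rk (H.pend (H.np - 1))) (H.pend (H.np - 1) + 1)
    np := H.np - 1 }

/-- Make the root `b` a child of the root `a` of the same rank; `a` becomes the last pending root,
and nothing is registered for the old rank. -/
def link (H : Heap) (a b : ℕ) : Heap :=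
  { H with
    rk := update H.rk a (H.rk a + 1)
    par := update H.par b (a + 1)
    bk := update H.bk (H.rk a) 0
    pend := update H.pend (H.np - 1) a
    sl := update H.sl a (update (H.sl a) (H.rk a + 1) (b + 1)) }

/-- Reduce the rank of the root `x` by one; the child in the lost slot becomes a pending root. -/
def pop (H : Heap) (x : ℕ) : Heap :=
  if H.sl x (H.rk x) = 0 then { H with rk := update H.rk x (H.rk x - 1) }
  else
  { H with
    rk := update H.rk x (H.rk x - 1)
    par := update H.par (H.sl x (H.rk x) - 1) 0
    pend := update H.pend H.np (H.sl x (H.rk x) - 1)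
    np := H.np + 1 }

/-- Make the registered root of rank `r` a pending root. -/
def take (H : Heap) (r : ℕ) : Heap :=
  { H with
    bk := update H.bk r 0
    pend := update H.pend H.np (H.bk r - 1)
    np := H.np + 1 }

/-- Detach the child `v` of `p` and give it a new key; it becomes the only pending root. -/
def cut (H : Heap) (v p : ℕ) (d : ℝ) : Heap :=
  { H with
    par := update H.par v 0
    pend := update H.pend 0 v
    np := 1
    sl := update H.sl p (update (H.sl p) (H.rk v + 1) 0)
    key := update H.key v d }

/-- Change the key of `v`. -/
def setKey (H : Heap) (v : ℕ) (d : ℝ) : Heap := { H with key := update H.key v d }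

/-- Insert `v` as the only pending root. -/
def ins (H : Heap) (v : ℕ) (d : ℝ) : Heap :=
  { H with
    live := insert v H.live
    rk := update H.rk v 0
    par := update H.par v 0
    pend := update H.pend 0 v
    np := 1
    key := update H.key v d }

/-- Delete the pending root with index `0`. -/
def remove (H : Heap) : Heap :=
  { H with
    live := H.live.erase (H.pend 0)
    pend := update H.pend 0 (H.pend (H.np - 1))
    np := H.np - 1 }

theorem Valid.place {H : Heap} (hH : H.Valid) (hn : 0 < H.np)
    (hb : H.bk (H.rk (H.pend (H.np - 1))) = 0) : H.place.Valid := by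
  obtain ⟨h1, h2, h3, h4, h5, h6⟩ := hH
  constructor <;> simp only [Heap.place, update_apply]
  · exact h1
  · exact h2
  · grind
  · grind
  · grind
  · grind

theorem Valid.link {H : Heap} (hH : H.Valid) (hn : 0 < H.np) {a b y : ℕ}
    (hb : H.bk (H.rk (H.pend (H.np - 1))) = y + 1)
    (hab : (a = H.pend (H.np - 1) ∧ b = y) ∨ (a = y ∧ b = H.pend (H.np - 1)))
    (hk : H.key a ≤ H.key b) : (H.link a b).Valid := by
  obtain ⟨h1, h2, h3, h4, h5, h6⟩ := hH
  have hx := h4 (H.np - 1) (by omega)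
  have hy := h3 _ _ hb
  have hxy : H.pend (H.np - 1) ≠ y := by rintro rfl; exact hx.2.2 hb
  have ha : a ∈ H.live ∧ b ∈ H.live ∧ H.par a = 0 ∧ H.par b = 0 ∧ H.rk a = H.rk b ∧ a ≠ b ∧
      H.rk a = H.rk (H.pend (H.np - 1)) := by grind
  obtain ⟨ha, hbl, hpa, hpb, hr, hne, hra⟩ := ha
  have hpend : ∀ k < H.np - 1, H.pend k ≠ a ∧ H.pend k ≠ b := by grind
  constructor <;> simp only [Heap.link, update_apply]
  · intro x hx j z hj hjr hs
    by_cases hxa : x = a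
    · subst hxa
      simp only [if_true, update_apply] at hs hjr
      split_ifs at hs with hj'
      · grind
      · have := h1 x hx j z hj (by omega) hs
        grind
    · simp only [hxa, if_false] at hs hjr
      have := h1 x hx j z hj hjr hs
      grind
  · intro z hz x hp
    by_cases hzb : z = b
    · subst hzb
      grind [update_apply]
    · have := h2 z hz x
      grind [update_apply]
  · grind
  · grind
  · grind
  · intro z hz hz0
    have hzb : z ≠ b := by rintro rfl; simp at hz0
    by_cases hza : z = a
    · exact .inr ⟨H.np - 1, by omega, by simp [hza]⟩
    · simp only [hzb, hza, if_false] at hz0 ⊢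
      rcases h6 z hz hz0 with h | ⟨k, hk, rfl⟩
      · left
        rw [if_neg (by grind), h]
      · exact .inr ⟨k, hk, if_neg (by grind)⟩

/-- The entry of the lost slot need not be erased: the invariants speak only of indices up to the
rank, and `link` overwrites the entry before the index is in range again. The buckets stay correct
because the root is pending, hence not registered under its old rank. -/
theorem Valid.pop {H : Heap} (hH : H.Valid) {q : ℕ} (hq : q < H.np) (hr : 0 < H.rk (H.pend q)) :
    (H.pop (H.pend q)).Valid := by
  obtain ⟨h1, h2, h3, h4, h5, h6⟩ := hH
  obtain ⟨hx, hp, hb⟩ := h4 q hq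
  generalize hxx : H.pend q = x at *
  unfold Heap.pop
  split_ifs with h0
  · constructor <;> simp only [update_apply]
    · intro z hz j y hj hjr hs
      have := h1 z hz j y hj (by grind) hs
      grind
    · intro y hy z hyp
      have := h2 y hy z hyp
      grind
    · grind
    · grind
    · grind
    · grind
  · obtain ⟨y, hy⟩ := Nat.exists_eq_succ_of_ne_zero h0
    obtain ⟨hyl, hyp, hyr, -⟩ := h1 x hx _ y hr le_rfl hy
    simp only [hy, Nat.succ_eq_add_one, Nat.add_sub_cancel]
    constructor <;> simp only [update_apply]
    · intro z hz j y' hj hjr hs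
      have := h1 z hz j y' hj (by grind) hs
      grind
    · intro y' hy' z hyp
      have := h2 y' hy' z (by grind)
      grind
    · grind
    · grind
    · grind
    · intro z hz hz0
      by_cases hzy : z = y
      · exact .inr ⟨H.np, by omega, by simp [hzy]⟩
      · simp only [hzy, if_false] at hz0
        rcases h6 z hz hz0 with h | ⟨k, hk, rfl⟩
        · left
          rw [if_neg (by grind), h]
        · exact .inr ⟨k, by omega, if_neg (by omega)⟩

theorem Valid.take {H : Heap} (hH : H.Valid) {r : ℕ} (hr : H.bk r ≠ 0) : (H.take r).Valid := by
  obtain ⟨h1, h2, h3, h4, h5, h6⟩ := hH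
  obtain ⟨x, hx⟩ := Nat.exists_eq_succ_of_ne_zero hr
  have := h3 _ _ hx
  constructor <;> simp only [Heap.take, update_apply, hx, Nat.succ_eq_add_one, Nat.add_sub_cancel]
  · exact h1
  · exact h2
  · grind
  · grind
  · grind
  · intro z hz hz0
    by_cases h : H.rk z = r
    · rcases h6 z hz hz0 with h' | ⟨k, hk, hk'⟩
      · exact .inr ⟨H.np, by omega, by grind⟩
      · exact .inr ⟨k, by omega, by grind⟩
    · grind

/-- The parent keeps its rank and merely gets an empty slot, so no other item is affected. The item
v keeps its rank and its subtree; a smaller key preserves the heap order with respect to its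
children. -/
theorem Valid.cut {H : Heap} (hH : H.Valid) (hn : H.np = 0) {v p : ℕ} {d : ℝ} (hv : v ∈ H.live)
    (hp : H.par v = p + 1) (hd : d ≤ H.key v) : (H.cut v p d).Valid := by
  obtain ⟨h1, h2, h3, h4, h5, h6⟩ := hH
  obtain ⟨hpl, hr, hs⟩ := h2 v hv p hp
  constructor <;> simp only [Heap.cut, update_apply]
  · intro x hx j z hj hjr hsl
    have : H.sl x j = z + 1 ∧ z ≠ v := by
      by_cases hxp : x = p
      · subst hxp
        simp only [if_true, update_apply] at hsl
        split_ifs at hsl with hjv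
        exact ⟨hsl, by rintro rfl; have := h1 x hx j _ hj hjr hsl; omega⟩
      · simp only [hxp, if_false] at hsl
        exact ⟨hsl, by rintro rfl; have := h1 x hx j _ hj hjr hsl; omega⟩
    have h := h1 x hx j z hj hjr this.1
    grind
  · intro z hz x hpz
    split_ifs at hpz with hzv
    have := h2 z hz x hpz
    refine ⟨this.1, this.2.1, ?_⟩
    grind [update_apply]
  · grind
  · grind
  · grind
  · grind

theorem Valid.setKey {H : Heap} (hH : H.Valid) {v : ℕ} {d : ℝ} (hp : H.par v = 0)
    (hd : d ≤ H.key v) : (H.setKey v d).Valid := by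
  obtain ⟨h1, h2, h3, h4, h5, h6⟩ := hH
  constructor <;> simp only [Heap.setKey, update_apply]
  · intro x hx j y hj hjr hs
    have := h1 x hx j y hj hjr hs
    grind
  all_goals assumption

theorem Valid.ins {H : Heap} (hH : H.Valid) (hn : H.np = 0) {v : ℕ} (d : ℝ) (hv : v ∉ H.live) :
    (H.ins v d).Valid := by
  obtain ⟨h1, h2, h3, h4, h5, h6⟩ := hH
  constructor <;> simp only [Heap.ins, update_apply, Finset.mem_insert]
  · intro x hx j y hj hjr hs
    have := h1 x (by grind) j y hj (by grind) hs
    grind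
  · intro y hy x hyp
    have := h2 y (by grind) x (by grind)
    grind
  · grind
  · grind
  · grind
  · grind

theorem Valid.remove {H : Heap} (hH : H.Valid) (hn : 0 < H.np) (hr : H.rk (H.pend 0) = 0) :
    H.remove.Valid := by
  obtain ⟨h1, h2, h3, h4, h5, h6⟩ := hH
  obtain ⟨hx, hp, hb⟩ := h4 0 hn
  generalize hxx : H.pend 0 = x at *
  constructor <;> simp only [Heap.remove, update_apply, Finset.mem_erase, hxx]
  · intro z hz j y hj hjr hs
    have := h1 z hz.2 j y hj hjr hs
    grind
  · intro y hy z hyp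
    have := h2 y hy.2 z hyp
    grind
  · grind
  · grind
  · grind
  · intro z hz hz0
    rcases h6 z hz.2 hz0 with h' | ⟨k, hk, hk'⟩
    · exact .inl h'
    · right
      -- The last pending root has been moved to the index 0.
      by_cases hkl : k = H.np - 1
      · exact ⟨0, by grind, by grind⟩
      · exact ⟨k, by omega, by grind⟩

end Heap

end QSPP

namespace QSPP

namespace Heap

open Function (update update_apply)

/-! #### Effect of the operations on the counts -/

theorem filled_congr {H H' : Heap} (hl : H'.live = H.live) (hr : H'.rk = H.rk)
    (hs : H'.sl = H.sl) : H'.filled = H.filled := by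
  unfold filled; rw [hl, hr, hs]

theorem empty_congr {H H' : Heap} (hl : H'.live = H.live) (hr : H'.rk = H.rk)
    (hs : H'.sl = H.sl) : H'.empty = H.empty := by
  unfold empty; rw [hl, hr, hs]

theorem cnt_link (H : Heap) {a : ℕ} (b : ℕ) (ha : a ∈ H.live) (j : ℕ) :
    (H.link a b).cnt j = if j = H.rk a + 1 then H.cnt j + 1 else H.cnt j := by
  simp only [cnt, link, update_apply]
  split_ifs with h
  · rw [← Finset.card_insert_of_notMem (a := a) (by simp; omega)]
    congr 1
    ext x
    simp only [Finset.mem_filter, Finset.mem_insert]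
    grind
  · congr 1
    ext x
    simp only [Finset.mem_filter]
    grind

theorem filled_link (H : Heap) {a : ℕ} (b : ℕ) (ha : a ∈ H.live) :
    (H.link a b).filled = H.filled + 1 := by
  simp only [filled, link]
  rw [← Finset.add_sum_erase _ _ ha, ← Finset.add_sum_erase (a := a) _ _ ha, add_right_comm]
  congr 1
  · rw [← Finset.card_insert_of_notMem (a := H.rk a + 1) (by simp)]
    congr 1
    ext j
    simp only [Finset.mem_filter, Finset.mem_insert, Finset.mem_Icc, update_apply, if_true]
    grind
  · refine Finset.sum_congr rfl fun x hx => ?_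
    simp [(Finset.mem_erase.1 hx).1]

theorem empty_link (H : Heap) {a : ℕ} (b : ℕ) (ha : a ∈ H.live) :
    (H.link a b).empty = H.empty := by
  simp only [empty, link]
  rw [← Finset.add_sum_erase _ _ ha, ← Finset.add_sum_erase (a := a) _ _ ha]
  congr 1
  · congr 1
    ext j
    simp only [Finset.mem_filter, Finset.mem_Icc, update_apply, if_true]
    grind
  · refine Finset.sum_congr rfl fun x hx => ?_
    simp [(Finset.mem_erase.1 hx).1]

theorem pop_live (H : Heap) (x : ℕ) : (H.pop x).live = H.live := by unfold pop; split_ifs <;> rfl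
theorem pop_sl (H : Heap) (x : ℕ) : (H.pop x).sl = H.sl := by unfold pop; split_ifs <;> rfl
theorem pop_key (H : Heap) (x : ℕ) : (H.pop x).key = H.key := by unfold pop; split_ifs <;> rfl
theorem pop_bk (H : Heap) (x : ℕ) : (H.pop x).bk = H.bk := by unfold pop; split_ifs <;> rfl
theorem pop_rk (H : Heap) (x : ℕ) : (H.pop x).rk = update H.rk x (H.rk x - 1) := by
  unfold pop; split_ifs <;> rfl

theorem pop_pend (H : Heap) (x k : ℕ) (hk : k < H.np) : (H.pop x).pend k = H.pend k := by
  unfold pop; split_ifs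
  · rfl
  · simp [hk.ne]

theorem np_le_pop_np (H : Heap) (x : ℕ) : H.np ≤ (H.pop x).np := by
  unfold pop; split_ifs <;> simp

theorem cnt_pop (H : Heap) {x : ℕ} (hx : x ∈ H.live) (hr : 0 < H.rk x) (j : ℕ) :
    (H.pop x).cnt j = if j = H.rk x then H.cnt j - 1 else H.cnt j := by
  simp only [cnt, pop_live, pop_rk, update_apply]
  split_ifs with h
  · subst h
    rw [← Finset.card_erase_of_mem (a := x) (by simp [hx])]
    congr 1
    ext y
    simp only [Finset.mem_filter, Finset.mem_erase]
    grind
  · congr 1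
    ext y
    simp only [Finset.mem_filter]
    grind

theorem filter_Icc_succ (p : ℕ → Prop) [DecidablePred p] {r : ℕ} (hr : 0 < r) :
    {j ∈ Finset.Icc 1 r | p j}.card =
      {j ∈ Finset.Icc 1 (r - 1) | p j}.card + if p r then 1 else 0 := by
  obtain ⟨r, rfl⟩ := Nat.exists_eq_succ_of_ne_zero hr.ne'
  rw [Nat.succ_eq_add_one, ← Finset.insert_Icc_right_eq_Icc_add_one (by omega), Finset.filter_insert]
  split_ifs
  · rw [Finset.card_insert_of_notMem (by simp)]; simp
  · simp

/-- Each slot that is lost was empty, or its child is a new pending root. -/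
theorem pop_counts (H : Heap) {x : ℕ} (hx : x ∈ H.live) (hr : 0 < H.rk x) :
    ((H.pop x).filled = H.filled ∧ (H.pop x).empty + 1 = H.empty ∧ (H.pop x).np = H.np) ∨
    ((H.pop x).filled + 1 = H.filled ∧ (H.pop x).empty = H.empty ∧ (H.pop x).np = H.np + 1) := by
  have aux : ∀ (p : ℕ → ℕ → Prop) [∀ y, DecidablePred (p y)],
      ∑ y ∈ H.live, {j ∈ Finset.Icc 1 (H.rk y) | p y j}.card =
      ∑ y ∈ H.live, {j ∈ Finset.Icc 1 (update H.rk x (H.rk x - 1) y) | p y j}.card +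
        if p x (H.rk x) then 1 else 0 := by
    intro p _
    rw [← Finset.add_sum_erase _ _ hx, ← Finset.add_sum_erase (a := x) _ _ hx, add_right_comm]
    congr 1
    · rw [filter_Icc_succ (p x) hr]; simp
    · refine Finset.sum_congr rfl fun y hy => ?_
      simp [(Finset.mem_erase.1 hy).1]
  have hf := aux fun y j => H.sl y j ≠ 0
  have he := aux fun y j => H.sl y j = 0
  simp only [filled, empty, pop_live, pop_sl, pop_rk]
  by_cases h : H.sl x (H.rk x) = 0
  · left
    simp only [h, ne_eq, not_true, if_false, if_true] at hf he
    refine ⟨hf.symm, he.symm, ?_⟩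
    simp [pop, h]
  · right
    simp only [h, ne_eq, not_false_eq_true, if_false, if_true] at hf he
    refine ⟨hf.symm, he.symm, ?_⟩
    simp [pop, h]

/-- Cutting is the only operation that creates empty slots; it has to pay in advance for the
truncation that will destroy the slot. -/
theorem cut_counts {H : Heap} (hH : H.Valid) {v p : ℕ} (d : ℝ) (hv : v ∈ H.live)
    (hp : H.par v = p + 1) :
    (H.cut v p d).filled + 1 = H.filled ∧ (H.cut v p d).empty = H.empty + 1 := by
  obtain ⟨hpl, hr, hs⟩ := hH.par v hv p hp
  constructor
  · simp only [filled, cut]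
    rw [← Finset.add_sum_erase _ _ hpl, ← Finset.add_sum_erase (a := p) _ _ hpl, add_right_comm]
    congr 1
    · rw [← Finset.card_insert_of_notMem (a := H.rk v + 1) (by simp)]
      congr 1
      ext j
      simp only [Finset.mem_filter, Finset.mem_insert, Finset.mem_Icc, update_apply, if_true]
      grind
    · refine Finset.sum_congr rfl fun x hx => ?_
      simp [(Finset.mem_erase.1 hx).1]
  · simp only [empty, cut]
    rw [← Finset.add_sum_erase _ _ hpl, ← Finset.add_sum_erase (a := p) _ _ hpl, add_right_comm]
    congr 1
    · rw [← Finset.card_insert_of_notMem (a := H.rk v + 1) (by simp [hs])]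
      congr 1
      ext j
      simp only [Finset.mem_filter, Finset.mem_insert, Finset.mem_Icc, update_apply, if_true]
      grind
    · refine Finset.sum_congr rfl fun x hx => ?_
      simp [(Finset.mem_erase.1 hx).1]

theorem cnt_ins (H : Heap) {v : ℕ} (d : ℝ) (hv : v ∉ H.live) (j : ℕ) :
    (H.ins v d).cnt j = if j = 0 then H.cnt j + 1 else H.cnt j := by
  change {x ∈ insert v H.live | j ≤ update H.rk v 0 x}.card = if j = 0 then
    {x ∈ H.live | j ≤ H.rk x}.card + 1 else {x ∈ H.live | j ≤ H.rk x}.card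
  have : {x ∈ H.live | j ≤ update H.rk v 0 x} = {x ∈ H.live | j ≤ H.rk x} :=
    Finset.filter_congr fun x hx => by
      rw [Function.update_of_ne (by rintro rfl; exact hv hx)]
  rw [Finset.filter_insert, this, Function.update_self]
  split_ifs with h1 h2 h2
  · rw [Finset.card_insert_of_notMem (by simp [hv])]
  · omega
  · omega
  · rfl

theorem ins_counts (H : Heap) {v : ℕ} (d : ℝ) (hv : v ∉ H.live) :
    (H.ins v d).filled = H.filled ∧ (H.ins v d).empty = H.empty := by
  change ∑ x ∈ insert v H.live, {j ∈ Finset.Icc 1 (update H.rk v 0 x) | H.sl x j ≠ 0}.card =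
      H.filled ∧
    ∑ x ∈ insert v H.live, {j ∈ Finset.Icc 1 (update H.rk v 0 x) | H.sl x j = 0}.card = H.empty
  rw [Finset.sum_insert hv, Finset.sum_insert hv, Function.update_self]
  have h : ∀ x ∈ H.live, update H.rk v 0 x = H.rk x := fun x hx =>
    Function.update_of_ne (by rintro rfl; exact hv hx) _ _
  constructor
  · simp only [Finset.Icc_eq_empty_of_lt Nat.one_pos, Finset.filter_empty, Finset.card_empty,
      zero_add]
    exact Finset.sum_congr rfl fun x hx => by rw [h x hx]
  · simp only [Finset.Icc_eq_empty_of_lt Nat.one_pos, Finset.filter_empty, Finset.card_empty,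
      zero_add]
    exact Finset.sum_congr rfl fun x hx => by rw [h x hx]

theorem cnt_remove (H : Heap) (hx : H.pend 0 ∈ H.live) (hr : H.rk (H.pend 0) = 0) (j : ℕ) :
    H.remove.cnt j = if j = 0 then H.cnt j - 1 else H.cnt j := by
  change {x ∈ H.live.erase (H.pend 0) | j ≤ H.rk x}.card = if j = 0 then
    {x ∈ H.live | j ≤ H.rk x}.card - 1 else {x ∈ H.live | j ≤ H.rk x}.card
  rw [Finset.filter_erase]
  split_ifs with h
  · rw [Finset.card_erase_of_mem (by simp [hx, h])]
  · rw [Finset.erase_eq_of_notMem (by simp; omega)]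

theorem remove_counts (H : Heap) (hx : H.pend 0 ∈ H.live) (hr : H.rk (H.pend 0) = 0) :
    H.remove.filled = H.filled ∧ H.remove.empty = H.empty := by
  change ∑ x ∈ H.live.erase (H.pend 0), {j ∈ Finset.Icc 1 (H.rk x) | H.sl x j ≠ 0}.card = _ ∧
    ∑ x ∈ H.live.erase (H.pend 0), {j ∈ Finset.Icc 1 (H.rk x) | H.sl x j = 0}.card = _
  rw [filled, empty, ← Finset.add_sum_erase _ _ hx, ← Finset.add_sum_erase _ _ hx]
  simp [hr]

end Heap

end QSPP

set_option linter.unusedSimpArgs false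

namespace QSPP

/-! ### The heap in memory

The heap uses the natural memories `10` (ranks), `11` (parents), `12` (slot `j` of item `x` is cell
`j * n + x`), `13` (buckets), `14` (pending roots), `15` (numbers of items of at least a given
rank), `16` (cell `j` holds `j * n`) and `17` (registers: `0` number of pending roots, `1` index of
a pending root, `2` level, `3` and `4` items, `5` rank); keys are in the real memory `2`, and natural
memory `4` holds `1` for the items in the heap. -/

namespace Prog

/-- A register of the heap. -/
def reg (k : ℕ) : NExp := .load 17 (.const k)
/-- Assignment to a register of the heap. -/
def setReg (k : ℕ) (x : NExp) : Cmd := .storeN 17 (.const k) x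
/-- The successor. -/
def succ (x : NExp) : NExp := .add x (.const 1)
/-- The predecessor. -/
def pred (x : NExp) : NExp := .sub x (.const 1)
/-- The test for zero. -/
def isZero (x : NExp) : BExp := .natEq x (.const 0)
/-- The test for positivity. -/
def isPos (x : NExp) : BExp := .natLt (.const 0) x
/-- Rank of an item. -/
def rk (x : NExp) : NExp := .load 10 x
/-- Address of the slot of index `j` of `x`. -/
def slotAddr (x j : NExp) : NExp := .add (.load 16 j) x

/-- Make the root in register `4` a child of the root in register `3`, which becomes the last
pending root. -/
def linkRegs : Cmd :=
  .seq (.storeN 16 (succ (rk (reg 3))) (.add (.load 16 (rk (reg 3))) .numVerts)) <|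
  .seq (.storeN 10 (reg 3) (succ (rk (reg 3)))) <|
  .seq (.storeN 12 (slotAddr (reg 3) (rk (reg 3))) (succ (reg 4))) <|
  .seq (.storeN 11 (reg 4) (succ (reg 3))) <|
  .seq (.storeN 15 (rk (reg 3)) (succ (.load 15 (rk (reg 3))))) <|
  .storeN 14 (pred (reg 0)) (reg 3)

/-- Register the last pending root, or link it with the root registered for its rank. -/
def flushBody : Cmd :=
  .seq (setReg 3 (.load 14 (pred (reg 0)))) <|
  .ite (isZero (.load 13 (rk (reg 3))))
    (.seq (.storeN 13 (rk (reg 3)) (succ (reg 3))) (setReg 0 (pred (reg 0))))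
    (.seq (setReg 4 (pred (.load 13 (rk (reg 3))))) <|
     .seq (.storeN 13 (rk (reg 3)) (.const 0)) <|
     .seq (.ite (.realLt (.load 2 (reg 4)) (.load 2 (reg 3)))
        (.seq (setReg 5 (reg 3)) (.seq (setReg 3 (reg 4)) (setReg 4 (reg 5)))) .skip) <|
     linkRegs)

/-- Register or link all pending roots. -/
def flush : Cmd := .while (isPos (reg 0)) flushBody

/-- Remove the topmost slot of the pending root with index in register `1`. -/
def pop : Cmd :=
  .seq (setReg 3 (.load 14 (reg 1))) <|
  .seq (setReg 4 (.load 12 (slotAddr (reg 3) (rk (reg 3))))) <|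
  .seq (.storeN 15 (rk (reg 3)) (pred (.load 15 (rk (reg 3))))) <|
  .seq (.storeN 10 (reg 3) (pred (rk (reg 3)))) <|
  .ite (isZero (reg 4)) .skip <|
    .seq (.storeN 11 (pred (reg 4)) (.const 0)) <|
    .seq (.storeN 14 (reg 0) (pred (reg 4))) <|
    setReg 0 (succ (reg 0))

/-- Turn the root registered for the rank in register `5` into a pending root. -/
def takeBody : Cmd :=
  .seq (.ite (isZero (.load 13 (reg 5))) .skip <|
    .seq (.storeN 14 (reg 0) (pred (.load 13 (reg 5)))) <|
    .seq (setReg 0 (succ (reg 0))) <|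
    .storeN 13 (reg 5) (.const 0)) <|
  setReg 5 (succ (reg 5))

end Prog

open Prog

/-- The memory `σ` represents the heap `H` with items below `n`. -/
structure Rep (n : ℕ) (σ : Mem) (H : Heap) : Prop where
  rk : σ.nat 10 = H.rk
  par : σ.nat 11 = H.par
  sl : ∀ x < n, ∀ j, σ.nat 12 (j * n + x) = H.sl x j
  bk : σ.nat 13 = H.bk
  pend : σ.nat 14 = H.pend
  cnt : ∀ j, σ.nat 15 j = H.cnt j
  off : ∀ x ∈ H.live, ∀ j ≤ H.rk x, σ.nat 16 j = j * n
  np : σ.nat 17 0 = H.np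
  key : σ.real 2 = H.key
  live : ∀ v, v ∈ H.live ↔ v < n ∧ σ.nat 4 v = 1

/-- Only memory of the heap has been changed. -/
def Frame (σ σ' : Mem) : Prop := (∀ A < 10, σ'.nat A = σ.nat A) ∧ σ'.real = σ.real

theorem Frame.refl (σ : Mem) : Frame σ σ := ⟨fun _ _ => rfl, rfl⟩

theorem Frame.trans {σ₁ σ₂ σ₃ : Mem} (h : Frame σ₁ σ₂) (h' : Frame σ₂ σ₃) : Frame σ₁ σ₃ :=
  ⟨fun A hA => (h'.1 A hA).trans (h.1 A hA), h'.2.trans h.2⟩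

theorem Frame.setNat (σ : Mem) {A : ℕ} (hA : 10 ≤ A) (i x : ℕ) : Frame σ (σ.setNat A i x) :=
  ⟨fun B hB => σ.setNat_nat_of_ne (by omega) i x, rfl⟩

theorem Frame.setNat_right {σ σ' : Mem} (h : Frame σ σ') {A : ℕ} (hA : 10 ≤ A) (i x : ℕ) :
    Frame σ (σ'.setNat A i x) := h.trans (Frame.setNat σ' hA i x)

/-- Different slots of items below n occupy different cells of natural memory `12`. -/
theorem mul_add_inj {n x x' j j' : ℕ} (hx : x < n) (hx' : x' < n) :
    j * n + x = j' * n + x' ↔ j = j' ∧ x = x' := by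
  constructor
  · intro h
    have h1 : (j * n + x) / n = (j' * n + x') / n := by rw [h]
    have hn : 0 < n := by omega
    rw [add_comm, add_comm (j' * n), Nat.add_mul_div_right _ _ hn, Nat.add_mul_div_right _ _ hn,
      Nat.div_eq_of_lt hx, Nat.div_eq_of_lt hx', zero_add, zero_add] at h1
    subst h1
    exact ⟨rfl, by omega⟩
  · rintro ⟨rfl, rfl⟩; rfl

/-! ### Programs that implement the operations on the heap -/

section

variable {n m : ℕ} (I : Instance n m)

theorem Rep.place {σ : Mem} {H : Heap} (h : Rep n σ H)
    (hb : H.bk (H.rk (H.pend (H.np - 1))) = 0) :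
    Rep n (flushBody.run I σ) H.place ∧ Frame σ (flushBody.run I σ) ∧
      (flushBody.run I σ).nat 17 2 = σ.nat 17 2 := by
  have e : flushBody.run I σ = ((σ.setNat 17 3 (H.pend (H.np - 1))).setNat 13
      (H.rk (H.pend (H.np - 1))) (H.pend (H.np - 1) + 1)).setNat 17 0 (H.np - 1) := by
    simp [flushBody, Cmd.run, setReg, NExp.eval, reg, Prog.rk, Prog.pred, BExp.Holds, isZero,
      Mem.setNat_nat_of_ne, Prog.succ, h.rk, h.pend, h.np, h.bk, hb]
  rw [e]
  obtain ⟨h1, h2, h3, h4, h5, h6, h7, h8, h9, h10⟩ := h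
  refine ⟨⟨?_, ?_, ?_, ?_, ?_, h6, ?_, ?_, ?_, ?_⟩, ?_, ?_⟩
  · simp [Mem.setNat_nat_of_ne, Heap.place, h1]
  · simp [Mem.setNat_nat_of_ne, Heap.place, h2]
  · simpa [Mem.setNat_nat_of_ne, Heap.place] using h3
  · simp [Mem.setNat_nat_of_ne, Heap.place, h4]
  · simp [Mem.setNat_nat_of_ne, Heap.place, h5]
  · simpa [Mem.setNat_nat_of_ne, Heap.place] using h7
  · simp [Mem.setNat_nat_of_ne, Heap.place]
  · simp [Heap.place, h9]
  · simpa [Mem.setNat_nat_of_ne, Heap.place] using h10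
  · exact (((Frame.refl σ).setNat_right (by norm_num) _ _).setNat_right (by norm_num) _ _).setNat_right
      (by norm_num) _ _
  · simp [Mem.setNat_nat_of_ne]

/-- At the start the bucket of the common rank has already been cleared while everything else still
represents H; therefore the hypothesis concerns H with the bucket contents taken from the memory.
Natural numbers cannot be multiplied, so the offset (r + 1) n is obtained from r n by one addition
when an item reaches rank r + 1. -/
theorem Rep.linkRegs {τ : Mem} {H : Heap} {a b : ℕ} (h : Rep n τ { H with bk := τ.nat 13 })
    (hbk : τ.nat 13 = Function.update H.bk (H.rk a) 0)
    (h3 : τ.nat 17 3 = a) (h4 : τ.nat 17 4 = b) (ha : a ∈ H.live) :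
    Rep n (Prog.linkRegs.run I τ) (H.link a b) ∧ Frame τ (Prog.linkRegs.run I τ) ∧
      (Prog.linkRegs.run I τ).nat 17 2 = τ.nat 17 2 := by
  have hoff : τ.nat 16 (H.rk a) = H.rk a * n := h.off a ha _ le_rfl
  have e : Prog.linkRegs.run I τ = (((((τ.setNat 16 (H.rk a + 1) ((H.rk a + 1) * n)).setNat 10 a
      (H.rk a + 1)).setNat 12 ((H.rk a + 1) * n + a) (b + 1)).setNat 11 b (a + 1)).setNat 15
      (H.rk a + 1) (H.cnt (H.rk a + 1) + 1)).setNat 14 (H.np - 1) a := by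
    have hrk : τ.nat 10 = H.rk := h.rk
    have hnp : τ.nat 17 0 = H.np := h.np
    have hcnt : τ.nat 15 = H.cnt := funext h.cnt
    simp [Prog.linkRegs, Cmd.run, NExp.eval, reg, Prog.rk, Prog.pred, slotAddr,
      Mem.setNat_nat_of_ne, Prog.succ, hrk, hnp, hcnt, h3, h4, hoff, add_mul]
  rw [e]
  have han : a < n := ((h.live a).1 ha).1
  obtain ⟨h1, h2, h3, -, h5, h6, h7, h8, h9, h10⟩ := h
  simp only at h1 h2 h3 h5 h6 h7 h8 h9 h10
  refine ⟨⟨?_, ?_, ?_, ?_, ?_, ?_, ?_, ?_, ?_, ?_⟩, ?_, ?_⟩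
  · simp [Mem.setNat_nat_of_ne, Heap.link, h1]
  · simp [Mem.setNat_nat_of_ne, Heap.link, h2]
  · intro x hx j
    simp (disch := decide) only [Mem.setNat_nat_of_ne, Heap.link, Mem.setNat_nat_self, Function.update_apply, mul_add_inj hx han, h3 x hx j]
    by_cases hxa : x = a
    · subst hxa; simp [Function.update_apply]
    · simp [hxa]
  · simp [Mem.setNat_nat_of_ne, Heap.link, hbk]
  · simp [Mem.setNat_nat_of_ne, Heap.link, h5]
  · intro j
    have h6' : ∀ j, τ.nat 15 j = H.cnt j := h6
    rw [Heap.cnt_link H b ha]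
    simp (disch := decide) only [Mem.setNat_nat_of_ne, Mem.setNat_nat_self, Function.update_apply, h6']
    split_ifs with hj
    · rw [hj]
    · rfl
  · intro x hx j hj
    simp only [Heap.link, Function.update_apply] at hx hj
    simp (disch := decide) only [Mem.setNat_nat_of_ne, Mem.setNat_nat_self, Function.update_apply]
    split_ifs with hj'
    · rw [hj']
    · exact h7 x hx j (by grind)
  · simp [Mem.setNat_nat_of_ne, Heap.link, h8]
  · simp [Heap.link, h9]
  · simpa [Mem.setNat_nat_of_ne, Heap.link] using h10
  · exact ((((((Frame.refl τ).setNat_right (by norm_num) _ _).setNat_right (by norm_num) _ _).setNat_right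
      (by norm_num) _ _).setNat_right (by norm_num) _ _).setNat_right (by norm_num) _ _).setNat_right
      (by norm_num) _ _
  · simp [Mem.setNat_nat_of_ne]

theorem Rep.link {σ : Mem} {H : Heap} (h : Rep n σ H) (hH : H.Valid) (hn : 0 < H.np) {y : ℕ}
    (hb : H.bk (H.rk (H.pend (H.np - 1))) = y + 1) :
    ∃ a b, ((a = H.pend (H.np - 1) ∧ b = y) ∨ (a = y ∧ b = H.pend (H.np - 1))) ∧
      H.key a ≤ H.key b ∧ Rep n (flushBody.run I σ) (H.link a b) ∧
      Frame σ (flushBody.run I σ) ∧ (flushBody.run I σ).nat 17 2 = σ.nat 17 2 := by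
  set x := H.pend (H.np - 1) with hx
  have hxl := (hH.pend _ (show H.np - 1 < H.np by omega)).1
  have hyl := hH.bk _ _ hb
  by_cases hk : H.key y < H.key x
  · refine ⟨y, x, .inr ⟨rfl, rfl⟩, hk.le, ?_⟩
    have e : flushBody.run I σ = Prog.linkRegs.run I ((((((σ.setNat 17 3 x).setNat 17 4 y).setNat 13
        (H.rk x) 0).setNat 17 5 x).setNat 17 3 y).setNat 17 4 x) := by
      simp [flushBody, Cmd.run, setReg, NExp.eval, reg, Prog.rk, Prog.pred, BExp.Holds, isZero,
        Mem.setNat_nat_of_ne, RExp.eval, h.rk, h.pend, h.np, h.bk, hb, h.key, hk, ← hx]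
    rw [e]
    have hF : Frame σ ((((((σ.setNat 17 3 x).setNat 17 4 y).setNat 13
        (H.rk x) 0).setNat 17 5 x).setNat 17 3 y).setNat 17 4 x) :=
      ((((((Frame.refl σ).setNat_right (by norm_num) _ _).setNat_right (by norm_num) _ _).setNat_right
      (by norm_num) _ _).setNat_right (by norm_num) _ _).setNat_right (by norm_num) _ _).setNat_right
      (by norm_num) _ _
    obtain ⟨h1, h2, h3, h4, h5, h6, h7, h8, h9, h10⟩ := h
    have := Rep.linkRegs I (τ := (((((σ.setNat 17 3 x).setNat 17 4 y).setNat 13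
        (H.rk x) 0).setNat 17 5 x).setNat 17 3 y).setNat 17 4 x) (H := H) (a := y) (b := x)
        ⟨by simpa [Mem.setNat_nat_of_ne] using h1, by simpa [Mem.setNat_nat_of_ne] using h2,
          by simpa [Mem.setNat_nat_of_ne] using h3, rfl,
          by simpa [Mem.setNat_nat_of_ne] using h5, h6,
          by simpa [Mem.setNat_nat_of_ne] using h7, by simpa [Mem.setNat_nat_of_ne] using h8,
          h9, by simpa [Mem.setNat_nat_of_ne] using h10⟩
        (by simp [Mem.setNat_nat_of_ne, h4, hyl]) (by simp) (by simp) hyl.1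
    exact ⟨this.1, hF.trans this.2.1, this.2.2.trans (by simp [Mem.setNat_nat_of_ne])⟩
  · refine ⟨x, y, .inl ⟨rfl, rfl⟩, not_lt.1 hk, ?_⟩
    have e : flushBody.run I σ = Prog.linkRegs.run I (((σ.setNat 17 3 x).setNat 17 4 y).setNat 13
        (H.rk x) 0) := by
      simp [flushBody, Cmd.run, setReg, NExp.eval, reg, Prog.rk, Prog.pred, BExp.Holds, isZero,
        Mem.setNat_nat_of_ne, RExp.eval, h.rk, h.pend, h.np, h.bk, hb, h.key, hk, ← hx]
    rw [e]
    have hF : Frame σ (((σ.setNat 17 3 x).setNat 17 4 y).setNat 13 (H.rk x) 0) :=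
      (((Frame.refl σ).setNat_right (by norm_num) _ _).setNat_right (by norm_num) _ _).setNat_right
      (by norm_num) _ _
    obtain ⟨h1, h2, h3, h4, h5, h6, h7, h8, h9, h10⟩ := h
    have := Rep.linkRegs I (τ := ((σ.setNat 17 3 x).setNat 17 4 y).setNat 13
        (H.rk x) 0) (H := H) (a := x) (b := y)
        ⟨by simpa [Mem.setNat_nat_of_ne] using h1, by simpa [Mem.setNat_nat_of_ne] using h2,
          by simpa [Mem.setNat_nat_of_ne] using h3, rfl,
          by simpa [Mem.setNat_nat_of_ne] using h5, h6,
          by simpa [Mem.setNat_nat_of_ne] using h7, by simpa [Mem.setNat_nat_of_ne] using h8,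
          h9, by simpa [Mem.setNat_nat_of_ne] using h10⟩
        (by simp [Mem.setNat_nat_of_ne, h4]) (by simp [Mem.setNat_nat_of_ne])
        (by simp [Mem.setNat_nat_of_ne]) hxl
    exact ⟨this.1, hF.trans this.2.1, this.2.2.trans (by simp [Mem.setNat_nat_of_ne])⟩

theorem Rep.pop {σ : Mem} {H : Heap} (h : Rep n σ H) {q : ℕ} (hq : σ.nat 17 1 = q)
    (hx : H.pend q ∈ H.live) (hr : 0 < H.rk (H.pend q)) :
    Rep n (Prog.pop.run I σ) (H.pop (H.pend q)) ∧ Frame σ (Prog.pop.run I σ) ∧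
      ∀ k, k = 1 ∨ k = 2 → (Prog.pop.run I σ).nat 17 k = σ.nat 17 k := by
  set x := H.pend q with hxdef
  have hxn : x < n := ((h.live x).1 hx).1
  have hoff : σ.nat 16 (H.rk x) = H.rk x * n := h.off x hx _ le_rfl
  have hsl := h.sl x hxn (H.rk x)
  have hcnt : σ.nat 15 = H.cnt := funext h.cnt
  by_cases hs : H.sl x (H.rk x) = 0
  · have e : Prog.pop.run I σ = (((σ.setNat 17 3 x).setNat 17 4 (H.sl x (H.rk x))).setNat 15
        (H.rk x) (H.cnt (H.rk x) - 1)).setNat 10 x (H.rk x - 1) := by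
      simp [Prog.pop, Cmd.run, setReg, NExp.eval, reg, Prog.rk, Prog.pred, BExp.Holds, isZero,
        slotAddr, Mem.setNat_nat_of_ne, h.rk, h.pend, hcnt, hq, ← hxdef, hoff, hsl, hs]
    rw [e]
    obtain ⟨h1, h2, h3, h4, h5, h6, h7, h8, h9, h10⟩ := h
    refine ⟨⟨?_, ?_, ?_, ?_, ?_, ?_, ?_, ?_, ?_, ?_⟩, ?_, ?_⟩
    · simp [Heap.pop, h1, hs, Mem.setNat_nat_of_ne]
    · simp [Mem.setNat_nat_of_ne, Heap.pop, h2, hs]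
    · simpa [Mem.setNat_nat_of_ne, Heap.pop, hs] using h3
    · simp [Mem.setNat_nat_of_ne, Heap.pop, h4, hs]
    · simp [Mem.setNat_nat_of_ne, Heap.pop, h5, hs]
    · intro j
      rw [Heap.cnt_pop H hx hr]
      simp [Mem.setNat_nat_of_ne, Function.update_apply, h6]
      grind
    · rw [Heap.pop_live, Heap.pop_rk]
      intro z hz j hj
      simp (disch := decide) only [Mem.setNat_nat_of_ne]
      exact h7 z hz j (by grind [Function.update_apply])
    · simp [Mem.setNat_nat_of_ne, Heap.pop, h8, hs]
    · simp [Heap.pop, h9, hs]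
    · simpa [Mem.setNat_nat_of_ne, Heap.pop, hs] using h10
    · exact ((((Frame.refl σ).setNat_right (by norm_num) _ _).setNat_right (by norm_num) _ _).setNat_right
        (by norm_num) _ _).setNat_right (by norm_num) _ _
    · rintro k (rfl | rfl) <;> simp [Mem.setNat_nat_of_ne]
  · have e : Prog.pop.run I σ = ((((((σ.setNat 17 3 x).setNat 17 4 (H.sl x (H.rk x))).setNat 15
        (H.rk x) (H.cnt (H.rk x) - 1)).setNat 10 x (H.rk x - 1)).setNat 11
        (H.sl x (H.rk x) - 1) 0).setNat 14 H.np (H.sl x (H.rk x) - 1)).setNat 17 0 (H.np + 1) := by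
      simp [Prog.pop, Cmd.run, setReg, NExp.eval, reg, Prog.rk, Prog.pred, BExp.Holds, isZero,
        slotAddr, Mem.setNat_nat_of_ne, h.rk, h.pend, hcnt, hq, ← hxdef, hoff, hsl, hs, h.np,
        Prog.succ]
    rw [e]
    obtain ⟨h1, h2, h3, h4, h5, h6, h7, h8, h9, h10⟩ := h
    refine ⟨⟨?_, ?_, ?_, ?_, ?_, ?_, ?_, ?_, ?_, ?_⟩, ?_, ?_⟩
    · simp [Heap.pop, h1, hs, Mem.setNat_nat_of_ne]
    · simp [Mem.setNat_nat_of_ne, Heap.pop, h2, hs]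
    · simpa [Mem.setNat_nat_of_ne, Heap.pop, hs] using h3
    · simp [Mem.setNat_nat_of_ne, Heap.pop, h4, hs]
    · simp [Mem.setNat_nat_of_ne, Heap.pop, h5, hs]
    · intro j
      rw [Heap.cnt_pop H hx hr]
      simp [Mem.setNat_nat_of_ne, Function.update_apply, h6]
      grind
    · rw [Heap.pop_live, Heap.pop_rk]
      intro z hz j hj
      simp (disch := decide) only [Mem.setNat_nat_of_ne]
      exact h7 z hz j (by grind [Function.update_apply])
    · simp [Heap.pop, hs]
    · simp [Heap.pop, h9, hs]
    · simpa [Mem.setNat_nat_of_ne, Heap.pop, hs] using h10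
    · exact (((((((Frame.refl σ).setNat_right (by norm_num) _ _).setNat_right (by norm_num) _ _).setNat_right
        (by norm_num) _ _).setNat_right (by norm_num) _ _).setNat_right (by norm_num) _ _).setNat_right
        (by norm_num) _ _).setNat_right (by norm_num) _ _
    · rintro k (rfl | rfl) <;> simp [Mem.setNat_nat_of_ne]

theorem Rep.take {σ : Mem} {H : Heap} (h : Rep n σ H) {r : ℕ} (hr : σ.nat 17 5 = r) :
    Rep n (takeBody.run I σ) (if H.bk r = 0 then H else H.take r) ∧
      Frame σ (takeBody.run I σ) ∧ (takeBody.run I σ).nat 17 5 = r + 1 ∧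
      (takeBody.run I σ).nat 17 2 = σ.nat 17 2 := by
  split_ifs with hb
  · have e : takeBody.run I σ = σ.setNat 17 5 (r + 1) := by
      simp [takeBody, Cmd.run, setReg, NExp.eval, reg, BExp.Holds, isZero, h.bk, hr, hb, Prog.succ]
    rw [e]
    obtain ⟨h1, h2, h3, h4, h5, h6, h7, h8, h9, h10⟩ := h
    refine ⟨⟨?_, ?_, ?_, ?_, ?_, h6, ?_, ?_, h9, ?_⟩, Frame.setNat σ (by norm_num) _ _, ?_, ?_⟩
    · simp [Mem.setNat_nat_of_ne, h1]
    · simp [Mem.setNat_nat_of_ne, h2]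
    · simpa [Mem.setNat_nat_of_ne] using h3
    · simp [Mem.setNat_nat_of_ne, h4]
    · simp [Mem.setNat_nat_of_ne, h5]
    · simpa [Mem.setNat_nat_of_ne] using h7
    · simp [h8]
    · simpa [Mem.setNat_nat_of_ne] using h10
    · simp
    · simp
  · have e : takeBody.run I σ = (((σ.setNat 14 H.np (H.bk r - 1)).setNat 17 0 (H.np + 1)).setNat 13 r
        0).setNat 17 5 (r + 1) := by
      simp [takeBody, Cmd.run, setReg, NExp.eval, reg, BExp.Holds, isZero, h.bk, hr, hb, Prog.succ,
        Mem.setNat_nat_of_ne, h.np, Prog.pred]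
    rw [e]
    obtain ⟨h1, h2, h3, h4, h5, h6, h7, h8, h9, h10⟩ := h
    refine ⟨⟨?_, ?_, ?_, ?_, ?_, h6, ?_, ?_, h9, ?_⟩, ?_, ?_, ?_⟩
    · simp [Mem.setNat_nat_of_ne, Heap.take, h1]
    · simp [Mem.setNat_nat_of_ne, Heap.take, h2]
    · simpa [Mem.setNat_nat_of_ne, Heap.take] using h3
    · simp [Mem.setNat_nat_of_ne, Heap.take, h4]
    · simp [Mem.setNat_nat_of_ne, Heap.take, h5]
    · simpa [Mem.setNat_nat_of_ne, Heap.take] using h7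
    · simp [Mem.setNat_nat_of_ne, Heap.take]
    · simpa [Mem.setNat_nat_of_ne, Heap.take] using h10
    · exact ((((Frame.refl σ).setNat_right (by norm_num) _ _).setNat_right (by norm_num) _ _).setNat_right
        (by norm_num) _ _).setNat_right (by norm_num) _ _
    · simp
    · simp [Mem.setNat_nat_of_ne]

end

end QSPP

/-! ### Amortized analysis of linking and truncation -/

namespace QSPP

namespace Prog

/-- Turn all roots of rank at least the content of register `5` into pending roots. -/
def takeAll : Cmd := .while (isPos (.load 15 (reg 5))) takeBody

/-- Reduce the ranks of all pending roots to the level in register `2`. -/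
def truncate : Cmd :=
  .while (.natLt (reg 1) (reg 0))
    (.ite (.natLt (reg 2) (rk (.load 14 (reg 1)))) pop (setReg 1 (succ (reg 1))))

/-- Remove all slots above the level in register `2`. -/
def quake : Cmd :=
  .seq (setReg 5 (succ (reg 2))) <| .seq takeAll <| .seq (setReg 1 (.const 0)) <|
  .seq truncate flush

/-- Three times the number of items of at least the rank in register `2`. -/
def thriceCnt : NExp :=
  .add (.load 15 (reg 2)) (.add (.load 15 (reg 2)) (.load 15 (reg 2)))

/-- Four times the number of items of more than the rank in register `2`. -/
def fourTimesCntSucc : NExp :=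
  .add (.add (.load 15 (succ (reg 2))) (.load 15 (succ (reg 2))))
    (.add (.load 15 (succ (reg 2))) (.load 15 (succ (reg 2))))

/-- Make all ranks logarithmic. -/
def fix : Cmd :=
  .seq (setReg 2 (.const 0)) <|
  .while (isPos (.load 15 (succ (reg 2))))
    (.ite (.natLt thriceCnt fourTimesCntSucc) quake (setReg 2 (succ (reg 2))))

end Prog

open Prog

section

variable {n m : ℕ} (I : Instance n m)

theorem exec_storeN {A : ℕ} {i x : NExp} {σ : Mem} {a b k : ℕ} (hi : i.eval I σ = a)
    (hx : x.eval I σ = b) (hk : i.time + x.time + 1 = k) :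
    Exec I (.storeN A i x) σ (σ.setNat A a b) k := by
  subst hi hx hk; exact .storeN A i x σ

theorem Rep.card_live_le {σ : Mem} {H : Heap} (h : Rep n σ H) : H.live.card ≤ n := by
  rw [← Finset.card_range n]
  exact Finset.card_le_card fun v hv => Finset.mem_range.2 ((h.live v).1 hv).1

theorem Rep.setReg {σ : Mem} {H : Heap} (h : Rep n σ H) {k : ℕ} (hk : k ≠ 0) (x : ℕ) :
    Rep n (σ.setNat 17 k x) H := by
  obtain ⟨h1, h2, h3, h4, h5, h6, h7, h8, h9, h10⟩ := h
  refine ⟨?_, ?_, ?_, ?_, ?_, h6, ?_, ?_, h9, ?_⟩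
  · simp [Mem.setNat_nat_of_ne, h1]
  · simp [Mem.setNat_nat_of_ne, h2]
  · simpa [Mem.setNat_nat_of_ne] using h3
  · simp [Mem.setNat_nat_of_ne, h4]
  · simp [Mem.setNat_nat_of_ne, h5]
  · simpa [Mem.setNat_nat_of_ne] using h7
  · simp [h8, hk.symm]
  · simpa [Mem.setNat_nat_of_ne] using h10

/-- Registering removes a pending root, and a link fills a slot, of which there are at most n; so
150 (np + n − filled) is a potential. A link of roots of rank at least i changes only a count at a
level above i. This clause ensures that a truncation at level i does not spoil the levels already
inspected. -/
theorem exec_flush {σ : Mem} {H : Heap} (h : Rep n σ H) (hH : H.Valid) :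
    ∃ H' σ' k, Exec I flush σ σ' k ∧ Rep n σ' H' ∧ H'.Valid ∧ H'.np = 0 ∧ H'.live = H.live ∧
      H'.key = H.key ∧ H'.empty = H.empty ∧ Frame σ σ' ∧ σ'.nat 17 2 = σ.nat 17 2 ∧
      (∀ i, (∀ k < H.np, i ≤ H.rk (H.pend k)) → ∀ j ≤ i, H'.cnt j = H.cnt j) ∧
      k + 150 * H.filled ≤ 150 * (H.np + H'.filled) + 10 := by
  have lf : flushBody.LoopFree := by repeat' constructor
  obtain ⟨H', σ', k, hex, ⟨g1, g2, g3, g4, g5, g6, g7, g8⟩, hb, hk⟩ :=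
    exec_while I (b := isPos (reg 0)) (p := flushBody) (α := Heap)
    (fun H₁ τ => Rep n τ H₁ ∧ H₁.Valid ∧ H₁.live = H.live ∧ H₁.key = H.key ∧ H₁.empty = H.empty ∧
      Frame σ τ ∧ τ.nat 17 2 = σ.nat 17 2 ∧ ∀ i, (∀ k < H.np, i ≤ H.rk (H.pend k)) →
        (∀ k < H₁.np, i ≤ H₁.rk (H₁.pend k)) ∧ ∀ j ≤ i, H₁.cnt j = H.cnt j)
    (fun H₁ => 150 * (H₁.np + (n - H₁.filled)))
    (by
      rintro H₁ τ ⟨g1, g2, g3, g4, g5, g6, g7, g8⟩ hb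
      have hn : 0 < H₁.np := by
        simpa [isPos, BExp.Holds, NExp.eval, reg, g1.np] using hb
      obtain ⟨k, hk, hex⟩ := lf.exec I τ
      have hk' : k ≤ 103 := hk.trans (by decide)
      have hbt : (isPos (reg 0)).time = 4 := rfl
      rcases Nat.eq_zero_or_eq_succ_pred (H₁.bk (H₁.rk (H₁.pend (H₁.np - 1)))) with h0 | h0
      · obtain ⟨r1, r2, r3⟩ := g1.place I h0
        refine ⟨H₁.place, _, k, hex, ⟨r1, g2.place hn h0, g3, g4, g5, g6.trans r2, r3.trans g7,
          fun i hi => ⟨fun k hk => (g8 i hi).1 k (hk.trans_le (Nat.sub_le _ _)), (g8 i hi).2⟩⟩, ?_⟩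
        have e1 : H₁.place.np = H₁.np - 1 := rfl
        have e2 : H₁.place.filled = H₁.filled := rfl
        rw [hbt, e1, e2]
        omega
      · obtain ⟨a, b, hab, hle, r1, r2, r3⟩ := g1.link I g2 hn h0
        have hV := g2.link hn h0 hab hle
        have hy := g2.bk _ _ h0
        have hx := g2.pend (H₁.np - 1) (by omega)
        have ha : a ∈ H₁.live ∧ H₁.rk a = H₁.rk (H₁.pend (H₁.np - 1)) := by
          rcases hab with ⟨rfl, -⟩ | ⟨rfl, -⟩
          · exact ⟨hx.1, rfl⟩
          · exact ⟨hy.1, hy.2.2⟩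
        have hf := H₁.filled_link b ha.1
        refine ⟨H₁.link a b, _, k, hex, ⟨r1, hV, g3, g4, (H₁.empty_link b ha.1).trans g5,
          g6.trans r2, r3.trans g7, fun i hi => ⟨?_, ?_⟩⟩, ?_⟩
        · intro k hk
          have hk : k < H₁.np := hk
          have h1 := (g8 i hi).1 k hk
          have h2 := (g8 i hi).1 (H₁.np - 1) (by omega)
          simp only [Heap.link, Function.update_apply]
          split_ifs <;> omega
        · intro j hj
          have h2 := (g8 i hi).1 (H₁.np - 1) (by omega)
          rw [H₁.cnt_link b ha.1, if_neg (by omega)]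
          exact (g8 i hi).2 j hj
        · have e1 : (H₁.link a b).np = H₁.np := rfl
          -- The bound by n after the link is needed for the truncated difference n − filled to drop
          -- by one.
          have := hV.filled_le.trans r1.card_live_le
          rw [hbt, e1, hf]
          omega) (a := H) (σ := σ)
    ⟨h, hH, rfl, rfl, rfl, Frame.refl σ, rfl, fun i hi => ⟨hi, fun _ _ => rfl⟩⟩
  have hn : H'.np = 0 := by
    simpa [isPos, BExp.Holds, NExp.eval, reg, g1.np] using hb
  refine ⟨H', σ', k, hex, g1, g2, hn, g3, g4, g5, g6, g7, fun i hi => (g8 i hi).2, ?_⟩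
  have h1 := g2.filled_le.trans g1.card_live_le
  have h2 := hH.filled_le.trans h.card_live_le
  have hbt : (isPos (reg 0)).time = 4 := rfl
  rw [hbt] at hk
  simp only [hn] at hk
  omega

/-- There is one bucket per rank, so at most M − i roots become pending. The loop may stop at the
first r with `cnt r = 0`: there is no item of rank r or more, so all further buckets are empty. -/
theorem exec_takeAll {σ : Mem} {H : Heap} (h : Rep n σ H) (hH : H.Valid) (hn : H.np = 0) {i M : ℕ}
    (h2 : σ.nat 17 2 = i) (h5 : σ.nat 17 5 = i + 1) (hM : ∀ x ∈ H.live, H.rk x ≤ M) (hi : i ≤ M) :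
    ∃ H' σ' k, Exec I takeAll σ σ' k ∧ Rep n σ' H' ∧ H'.Valid ∧ H'.live = H.live ∧
      H'.key = H.key ∧ H'.sl = H.sl ∧ H'.rk = H.rk ∧ Frame σ σ' ∧ σ'.nat 17 2 = i ∧
      (∀ r > i, H'.bk r = 0) ∧ (∀ k < H'.np, i ≤ H'.rk (H'.pend k)) ∧ H'.np ≤ M - i ∧
      k ≤ 150 * (M - i) + 10 := by
  have lf : takeBody.LoopFree := by repeat' constructor
  have hbt : (isPos (.load 15 (reg 5))).time = 5 := rfl
  obtain ⟨⟨H', r⟩, σ', k, hex, ⟨g1, g2, g3, g4, g5, g6, g7, g8, g9, g10, g11, g12, g13, g14⟩, hb, hk⟩ :=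
    exec_while I (b := isPos (.load 15 (reg 5))) (p := takeBody) (α := Heap × ℕ)
    (fun p τ => Rep n τ p.1 ∧ p.1.Valid ∧ p.1.live = H.live ∧ p.1.key = H.key ∧ p.1.sl = H.sl ∧
      p.1.rk = H.rk ∧ Frame σ τ ∧ τ.nat 17 2 = i ∧ τ.nat 17 5 = p.2 ∧
      (∀ r > i, r < p.2 → p.1.bk r = 0) ∧ (∀ k < p.1.np, i ≤ p.1.rk (p.1.pend k)) ∧
      p.1.np ≤ p.2 - (i + 1) ∧ i + 1 ≤ p.2 ∧ p.2 ≤ M + 1)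
    (fun p => 150 * (M + 1 - p.2))
    (by
      rintro ⟨H₁, r⟩ τ ⟨g1, g2, g3, g4, g5, g6, g7, g8, g9, g10, g11, g12, g13, g14⟩ hb
      simp only at g1 g2 g3 g4 g5 g6 g7 g8 g9 g10 g11 g12 g13 g14
      have hc : 0 < H₁.cnt r := by
        simpa [isPos, BExp.Holds, NExp.eval, reg, g1.cnt, g9] using hb
      obtain ⟨x, hx, hxr⟩ := Heap.cnt_pos_iff.1 hc
      have hrM : r ≤ M := hxr.trans (by rw [g6]; exact hM x (g3 ▸ hx))
      obtain ⟨k, hk, hex⟩ := lf.exec I τ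
      have hk' : k ≤ 30 := hk.trans (by decide)
      obtain ⟨r1, r2, r3, r4⟩ := g1.take I g9
      by_cases h0 : H₁.bk r = 0
      · rw [if_pos h0] at r1
        refine ⟨(H₁, r + 1), _, k, hex, ⟨r1, g2, g3, g4, g5, g6, g7.trans r2, r4.trans g8, r3, ?_,
          g11, ?_, ?_, ?_⟩, ?_⟩
        · intro r' h1 h2
          rcases (Nat.lt_succ_iff_lt_or_eq.1 h2) with h | rfl
          · exact g10 r' h1 h
          · exact h0
        all_goals simp only; omega
      · rw [if_neg h0] at r1
        refine ⟨(H₁.take r, r + 1), _, k, hex, ⟨r1, g2.take h0, g3, g4, g5, g6, g7.trans r2,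
          r4.trans g8, r3, ?_, ?_, ?_, ?_, ?_⟩, ?_⟩
        · intro r' h1 h2
          simp only [Heap.take, Function.update_apply]
          split_ifs with h
          · rfl
          · exact g10 r' h1 (by simp only at h2; omega)
        · obtain ⟨x, hx⟩ := Nat.exists_eq_succ_of_ne_zero h0
          have := g2.bk r x hx
          intro k hk
          simp only [Heap.take, Function.update_apply] at hk ⊢
          split_ifs with h
          · rw [hx, Nat.succ_sub_one]; omega
          · exact g11 k (by omega)
        · simp only [Heap.take]; omega
        all_goals simp only; omega) (a := (H, i + 1)) (σ := σ)
    ⟨h, hH, rfl, rfl, rfl, rfl, Frame.refl σ, h2, h5, by intro r h1 h2; simp only at h2; omega,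
      by simp [hn], by simp [hn], le_rfl, by simpa using hi⟩
  simp only at g1 g2 g3 g4 g5 g6 g7 g8 g9 g10 g11 g12 g13 g14
  have hc : H'.cnt r = 0 := by
    simpa [isPos, BExp.Holds, NExp.eval, reg, g1.cnt, g9] using hb
  refine ⟨H', σ', k, hex, g1, g2, g3, g4, g5, g6, g7, g8, ?_, g11, by omega, ?_⟩
  · intro r' hr'
    by_cases hlt : r' < r
    · exact g10 r' hr' hlt
    · by_contra h0
      obtain ⟨x, hx⟩ := Nat.exists_eq_succ_of_ne_zero h0
      have := g2.bk r' x hx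
      have := Heap.cnt_pos_iff.2 ⟨x, this.1, show r ≤ H'.rk x by omega⟩
      omega
  · rw [hbt] at hk
    simp only at hk
    omega

/-- A slot that is lost pays 300: one iteration for the removal, and 150 for the pending root that
its child may become. Every other iteration advances the index and is paid by the pending root it
passes. -/
theorem exec_truncate {σ : Mem} {H : Heap} (h : Rep n σ H) (hH : H.Valid) {i : ℕ}
    (h1 : σ.nat 17 1 = 0) (h2 : σ.nat 17 2 = i) (hbk : ∀ r > i, H.bk r = 0)
    (hp : ∀ k < H.np, i ≤ H.rk (H.pend k)) :
    ∃ H' σ' k, Exec I truncate σ σ' k ∧ Rep n σ' H' ∧ H'.Valid ∧ H'.live = H.live ∧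
      H'.key = H.key ∧ H'.sl = H.sl ∧ (∀ x ∈ H.live, H'.rk x = min (H.rk x) i) ∧ Frame σ σ' ∧
      σ'.nat 17 2 = i ∧ (∀ k < H'.np, i ≤ H'.rk (H'.pend k)) ∧
      H'.np + H'.filled = H.np + H.filled ∧
      k + 300 * (H'.filled + H'.empty) ≤ 300 * (H.filled + H.empty) + 150 * H.np + 10 := by
  have lf : Prog.pop.LoopFree := by repeat' constructor
  obtain ⟨⟨H', q⟩, σ', k, hex, ⟨g1, g2, g3, g4, g5, g6, g7, g8, g9, g10, g11, g12, g13, g14⟩, hb, hk⟩ :=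
    exec_while I (b := .natLt (reg 1) (reg 0))
    (p := .ite (.natLt (reg 2) (Prog.rk (.load 14 (reg 1)))) Prog.pop
      (Prog.setReg 1 (succ (reg 1)))) (α := Heap × ℕ)
    (fun p τ => Rep n τ p.1 ∧ p.1.Valid ∧ p.1.live = H.live ∧ p.1.key = H.key ∧ p.1.sl = H.sl ∧
      (∀ x ∈ H.live, min (p.1.rk x) i = min (H.rk x) i) ∧ Frame σ τ ∧ τ.nat 17 2 = i ∧
      τ.nat 17 1 = p.2 ∧ (∀ r > i, p.1.bk r = 0) ∧ (∀ k < p.1.np, i ≤ p.1.rk (p.1.pend k)) ∧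
      (∀ k < p.2, p.1.rk (p.1.pend k) ≤ i) ∧ p.2 ≤ p.1.np ∧
      p.1.np + p.1.filled = H.np + H.filled)
    (fun p => 300 * (p.1.filled + p.1.empty) + 150 * (p.1.np - p.2))
    (by
      rintro ⟨H₁, q⟩ τ ⟨g1, g2, g3, g4, g5, g6, g7, g8, g9, g10, g11, g12, g13, g14⟩ hb
      simp only at g1 g2 g3 g4 g5 g6 g7 g8 g9 g10 g11 g12 g13 g14
      have hbt : (BExp.natLt (reg 1) (reg 0)).time = 5 := rfl
      have hbt' : (BExp.natLt (reg 2) (Prog.rk (.load 14 (reg 1)))).time = 7 := rfl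
      have hq : q < H₁.np := by
        simpa [BExp.Holds, NExp.eval, reg, g1.np, g9] using hb
      have hc : (BExp.natLt (reg 2) (Prog.rk (.load 14 (reg 1)))).Holds I τ ↔
          i < H₁.rk (H₁.pend q) := by
        simp [BExp.Holds, NExp.eval, reg, Prog.rk, g8, g9, g1.rk, g1.pend]
      by_cases hr : i < H₁.rk (H₁.pend q)
      · obtain ⟨k, hk, hex⟩ := lf.exec I τ
        have hk' : k ≤ 57 := hk.trans (by decide)
        have hxl := (g2.pend q hq).1
        have hr0 : 0 < H₁.rk (H₁.pend q) := by omega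
        obtain ⟨r1, r2, r3⟩ := g1.pop I g9 hxl hr0
        have hV := g2.pop hq hr0
        have hcount := H₁.pop_counts hxl hr0
        have hnp := H₁.np_le_pop_np (H₁.pend q)
        refine ⟨(H₁.pop (H₁.pend q), q), _, _, .ite_true (hc.2 hr) hex, ⟨r1, hV,
          (H₁.pop_live _).trans g3, (H₁.pop_key _).trans g4, (H₁.pop_sl _).trans g5, ?_,
          g7.trans r2, (r3 2 (.inr rfl)).trans g8, (r3 1 (.inl rfl)).trans g9, ?_, ?_, ?_, ?_, ?_⟩, ?_⟩
        · intro x hx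
          rw [← g6 x hx]
          simp only [H₁.pop_rk, Function.update_apply]
          split_ifs with hxe
          · subst hxe; omega
          · rfl
        · simpa only [H₁.pop_bk] using g10
        · intro k hk
          simp only at hk
          by_cases hkn : k < H₁.np
          · have := g11 k hkn
            simp only [H₁.pop_pend _ k hkn, H₁.pop_rk, Function.update_apply]
            split_ifs <;> omega
          · have hs : H₁.sl (H₁.pend q) (H₁.rk (H₁.pend q)) ≠ 0 := by
              intro hs
              simp [Heap.pop, hs] at hk
              omega
            obtain ⟨y, hy⟩ := Nat.exists_eq_succ_of_ne_zero hs
            have hyy := g2.slot _ hxl _ y hr0 le_rfl hy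
            have hkeq : k = H₁.np := by simp [Heap.pop, hs] at hk; omega
            have : (H₁.pop (H₁.pend q)).pend k = y := by simp [Heap.pop, hs, hkeq, hy]
            simp only [this, H₁.pop_rk, Function.update_apply]
            split_ifs <;> omega
        · intro k hk
          simp only at hk
          have := g12 k hk
          simp only [H₁.pop_pend _ k (by omega), H₁.pop_rk, Function.update_apply]
          split_ifs with hpe
          · rw [hpe] at this; omega
          · exact this
        · simp only; omega
        · simp only; omega
        · simp only [hbt, hbt']; omega
      · refine ⟨(H₁, q + 1), τ.setNat 17 1 (q + 1), _, .ite_false (mt hc.1 hr)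
          (exec_storeN I (k := 6) rfl (by simp [NExp.eval, succ, reg, g9]) rfl),
          ⟨g1.setReg (by norm_num) _, g2, g3, g4, g5, g6, g7.setNat_right (by norm_num) _ _,
            by simpa using g8, by simp, g10, g11, ?_, hq, g14⟩, ?_⟩
        · intro k hk
          rcases (Nat.lt_succ_iff_lt_or_eq.1 hk) with h | rfl
          · exact g12 k h
          · exact not_lt.1 hr
        · simp only [hbt, hbt']; omega) (a := (H, 0)) (σ := σ)
    ⟨h, hH, rfl, rfl, rfl, fun _ _ => rfl, Frame.refl σ, h2, h1, hbk, hp, by simp, Nat.zero_le _, rfl⟩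
  simp only at g1 g2 g3 g4 g5 g6 g7 g8 g9 g10 g11 g12 g13 g14 hk
  have hbt : (BExp.natLt (reg 1) (reg 0)).time = 5 := rfl
  rw [hbt] at hk
  have hq : H'.np ≤ q := by
    simpa [BExp.Holds, NExp.eval, reg, g1.np, g9] using hb
  refine ⟨H', σ', k, hex, g1, g2, g3, g4, g5, ?_, g7, g8, g11, g14, by omega⟩
  intro x hx
  rw [← g6 x hx, eq_comm, min_eq_left_iff]
  -- The rank of x is at most that of some root z. If z is registered, its rank is at most i because
  -- the higher buckets are empty; if z is pending, because the loop has passed it.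
  obtain ⟨z, hz, hz0, hxz, -⟩ := g2.exists_min_root (g3 ▸ hx)
  rcases g2.root z hz hz0 with hz | ⟨k, hk, rfl⟩
  · by_contra hlt
    have := g10 (H'.rk z) (by omega)
    omega
  · exact hxz.trans (g12 k (by omega))

/-- Let S be the number of destroyed slots and E the number of empty ones among them. Scanning the
buckets takes at most M − i ≤ S iterations, since an item of maximum rank M loses M − i slots.
Altogether the time minus 150 times the increase of `filled` is at most 1050 S + 39, and 4000 E
covers this with 200 to spare, since S ≤ 3 E and E ≥ 1. The surplus pays for the tests in `fix`. -/
theorem exec_quake {σ : Mem} {H : Heap} (h : Rep n σ H) (hH : H.Valid) (hn : H.np = 0) {i : ℕ}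
    (h2 : σ.nat 17 2 = i) (hi : 3 * H.cnt i < 4 * H.cnt (i + 1)) :
    ∃ H' σ' k, Exec I quake σ σ' k ∧ Rep n σ' H' ∧ H'.Valid ∧ H'.np = 0 ∧ H'.live = H.live ∧
      H'.key = H.key ∧ Frame σ σ' ∧ σ'.nat 17 2 = i ∧ (∀ j ≤ i, H'.cnt j = H.cnt j) ∧
      k + 200 + 4000 * H'.empty + 150 * H.filled ≤ 4000 * H.empty + 150 * H'.filled := by
  obtain ⟨z, hz, hzi⟩ := Heap.cnt_pos_iff.1 (show 0 < H.cnt (i + 1) by omega)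
  obtain ⟨y, hy, hyM⟩ := Finset.exists_mem_eq_sup H.live ⟨z, hz⟩ H.rk
  have hM : ∀ x ∈ H.live, H.rk x ≤ H.rk y := fun x hx => hyM ▸ Finset.le_sup hx
  have hiM : i ≤ H.rk y := by have := hM z hz; omega
  obtain ⟨H₁, σ₁, k₁, e₁, a1, a2, a3, a4, a5, a6, a7, a8, a9, a10, a11, a12⟩ :=
    exec_takeAll I (h.setReg (k := 5) (by norm_num) (i + 1)) hH hn (i := i) (by simpa using h2)
      (by simp) hM hiM
  obtain ⟨H₂, σ₂, k₂, e₂, b1, b2, b3, b4, b5, b6, b7, b8, b9, b10, b11⟩ :=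
    exec_truncate I (a1.setReg (k := 1) (by norm_num) 0) a2 (i := i) (by simp)
      (by simpa using a8) a9 a10
  obtain ⟨H₃, σ₃, k₃, e₃, c1, c2, c3, c4, c5, c6, c7, c8, c9, c10⟩ := exec_flush I b1 b2
  have hF : Frame σ σ₃ := (((Frame.setNat σ (by norm_num) _ _).trans a7).setNat_right (by norm_num)
    _ _).trans (b7.trans c7)
  have hfil : H₁.filled = H.filled := Heap.filled_congr a3 a6 a5
  have hemp : H₁.empty = H.empty := Heap.empty_congr a3 a6 a5
  have hr2 : ∀ x ∈ H.live, H₂.rk x = min (H.rk x) i := fun x hx => by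
    rw [b6 x (a3 ▸ hx), a6]
  obtain ⟨p1, p2, p3⟩ := hH.truncate_pays (H' := H₂) hi (b3.trans a3) (b5.trans a5) hr2
  have hS : H.rk y - i + (H₂.filled + H₂.empty) ≤ H.filled + H.empty := by
    rw [Heap.filled_add_empty, Heap.filled_add_empty, b3.trans a3, ← Finset.add_sum_erase _ _ hy,
      ← Finset.add_sum_erase (a := y) _ _ hy, hr2 y hy]
    have : ∑ x ∈ H.live.erase y, H₂.rk x ≤ ∑ x ∈ H.live.erase y, H.rk x :=
      Finset.sum_le_sum fun x hx => by
        rw [hr2 x (Finset.mem_of_mem_erase hx)]; exact min_le_left _ _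
    omega
  have hcnt : ∀ j ≤ i, H₂.cnt j = H.cnt j := by
    intro j hj
    unfold Heap.cnt
    rw [b3.trans a3]
    congr 1
    exact Finset.filter_congr fun x hx => by rw [hr2 x hx]; omega
  refine ⟨H₃, σ₃, _, .seq (exec_storeN I (a := 5) (b := i + 1) (k := 6) rfl
    (by simp [NExp.eval, succ, reg, h2]) rfl) (.seq e₁ (.seq (exec_storeN I (a := 1) (b := 0) (k := 3)
    rfl rfl rfl) (.seq e₂ e₃))), c1, c2, c3, c4.trans (b3.trans a3), c5.trans (b4.trans a4), hF,
    c8.trans b8, fun j hj => (c9 i b9 j hj).trans (hcnt j hj), ?_⟩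
  omega

/-- Below the current level the counts decrease geometrically. A truncation at that level preserves
the counts up to it, so the level never has to go back and rises at most L times; truncations pay
for themselves with empty slots. The level stays in place after a truncation, as the subsequent
links may refill the next level. -/
theorem exec_fix {σ : Mem} {H : Heap} (h : Rep n σ H) (hH : H.Valid) (hn : H.np = 0) {L : ℕ}
    (hL : ∀ r, 4 ^ r ≤ 3 ^ r * n → r ≤ L) :
    ∃ H' σ' k, Exec I fix σ σ' k ∧ Rep n σ' H' ∧ H'.Valid ∧ H'.np = 0 ∧ H'.live = H.live ∧
      H'.key = H.key ∧ Frame σ σ' ∧ (∀ x ∈ H'.live, H'.rk x ≤ L) ∧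
      k + 4000 * H'.empty + 150 * H.filled ≤ 4000 * H.empty + 150 * H'.filled + 150 * L + 50 := by
  have hbt : (isPos (.load 15 (succ (reg 2)))).time = 7 := rfl
  have hbt' : (BExp.natLt thriceCnt fourTimesCntSucc).time = 35 := rfl
  obtain ⟨⟨H', r⟩, σ', k, hex, ⟨g1, g2, g3, g4, g5, g6, g7, g8, g9⟩, hb, hk⟩ :=
    exec_while I (b := isPos (.load 15 (succ (reg 2))))
    (p := .ite (.natLt thriceCnt fourTimesCntSucc) quake (Prog.setReg 2 (succ (reg 2))))
    (α := Heap × ℕ)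
    (fun p τ => Rep n τ p.1 ∧ p.1.Valid ∧ p.1.np = 0 ∧ p.1.live = H.live ∧ p.1.key = H.key ∧
      Frame σ τ ∧ τ.nat 17 2 = p.2 ∧ p.2 ≤ L ∧ ∀ j < p.2, 4 * p.1.cnt (j + 1) ≤ 3 * p.1.cnt j)
    (fun p => 150 * (L - p.2) + 4000 * p.1.empty + 150 * (n - p.1.filled))
    (by
      rintro ⟨H₁, r⟩ τ ⟨g1, g2, g3, g4, g5, g6, g7, g8, g9⟩ hb
      simp only at g1 g2 g3 g4 g5 g6 g7 g8 g9
      have hc : 0 < H₁.cnt (r + 1) := by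
        simpa [isPos, BExp.Holds, NExp.eval, reg, succ, g1.cnt, g7] using hb
      have hc' : (BExp.natLt thriceCnt fourTimesCntSucc).Holds I τ ↔
          3 * H₁.cnt r < 4 * H₁.cnt (r + 1) := by
        simp only [thriceCnt, fourTimesCntSucc, BExp.Holds, NExp.eval, reg, succ, g1.cnt, g7]
        omega
      by_cases hv : 3 * H₁.cnt r < 4 * H₁.cnt (r + 1)
      · obtain ⟨H₂, σ₂, k, e, c1, c2, c3, c4, c5, c6, c7, c8, c9⟩ := exec_quake I g1 g2 g3 g7 hv
        refine ⟨(H₂, r), σ₂, _, .ite_true (hc'.2 hv) e, ⟨c1, c2, c3, c4.trans g4, c5.trans g5,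
          g6.trans c6, c7, g8, ?_⟩, ?_⟩
        · intro j hj
          simp only at hj ⊢
          rw [c8 j hj.le, c8 (j + 1) hj]
          exact g9 j hj
        · have h1 := g2.filled_le.trans g1.card_live_le
          have h2 := c2.filled_le.trans c1.card_live_le
          simp only [hbt, hbt']
          omega
      · have h9 : ∀ j < r + 1, 4 * H₁.cnt (j + 1) ≤ 3 * H₁.cnt j := by
          intro j hj
          rcases (Nat.lt_succ_iff_lt_or_eq.1 hj) with h | rfl
          · exact g9 j h
          · exact not_lt.1 hv
        -- Some item has rank at least r + 1, so geometric decrease up to that level forces (4/3)^(r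
        -- + 1) ≤ n.
        have hrL : r + 1 ≤ L := by
          refine hL _ ?_
          calc 4 ^ (r + 1) ≤ 4 ^ (r + 1) * H₁.cnt (r + 1) := Nat.le_mul_of_pos_right _ hc
            _ ≤ 3 ^ (r + 1) * H₁.live.card := H₁.pow_mul_cnt_le h9
            _ ≤ _ := Nat.mul_le_mul_left _ g1.card_live_le
        refine ⟨(H₁, r + 1), τ.setNat 17 2 (r + 1), _, .ite_false (mt hc'.1 hv)
          (exec_storeN I (k := 6) rfl (by simp [NExp.eval, succ, reg, g7]) rfl),
          ⟨g1.setReg (by norm_num) _, g2, g3, g4, g5, g6.setNat_right (by norm_num) _ _, by simp,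
            hrL, h9⟩, ?_⟩
        simp only [hbt, hbt']
        omega) (a := (H, 0)) (σ := σ.setNat 17 2 0)
    ⟨h.setReg (by norm_num) _, hH, hn, rfl, rfl, Frame.setNat _ (by norm_num) _ _, by simp,
      Nat.zero_le _, by simp⟩
  simp only at g1 g2 g3 g4 g5 g6 g7 g8 g9 hk
  have hc : H'.cnt (r + 1) = 0 := by
    simpa [isPos, BExp.Holds, NExp.eval, reg, succ, g1.cnt, g7] using hb
  refine ⟨H', σ', _, .seq (exec_storeN I (k := 3) rfl rfl rfl) hex, g1, g2, g3, g4, g5, g6, ?_, ?_⟩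
  · intro x hx
    by_contra hlt
    have := Heap.cnt_pos_iff.2 ⟨x, hx, show r + 1 ≤ H'.rk x by omega⟩
    omega
  · have h1 := g2.filled_le.trans g1.card_live_le
    have h2 := hH.filled_le.trans h.card_live_le
    omega

end

end QSPP

/-! ### Extraction of a minimum -/

namespace QSPP

namespace Prog

/-- Compare the root registered for the rank in register `5` with the best root so far. -/
def findMinBody : Cmd :=
  .seq (.ite (isZero (.load 13 (reg 5))) .skip <|
    .ite (isZero (reg 3)) (setReg 3 (.load 13 (reg 5))) <|
    .ite (.realLt (.load 2 (pred (.load 13 (reg 5)))) (.load 2 (pred (reg 3))))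
      (setReg 3 (.load 13 (reg 5))) .skip) <|
  setReg 5 (succ (reg 5))

/-- Put one plus a root of minimum key into register `3`. -/
def findMin : Cmd :=
  .seq (setReg 5 (.const 0)) <| .seq (setReg 3 (.const 0)) <|
  .while (isPos (.load 15 (reg 5))) findMinBody

/-- Turn the root given by register `3` into a pending root, and name it in cell `1` of memory
`6`. -/
def detach : Cmd :=
  .seq (.storeN 6 (.const 1) (pred (reg 3))) <|
  .seq (.storeN 14 (.const 0) (pred (reg 3))) <|
  .seq (setReg 0 (.const 1)) <|
  .seq (.storeN 13 (rk (pred (reg 3))) (.const 0)) <|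
  setReg 1 (.const 0)

/-- Remove all slots of the pending root with index in register `1`. -/
def popAll : Cmd := .while (isPos (rk (.load 14 (reg 1)))) pop

/-- Delete the pending root with index `0`, of rank `0`. -/
def removeFirst : Cmd :=
  .seq (.storeN 4 (.load 14 (.const 0)) (.const 2)) <|
  .seq (.storeN 15 (.const 0) (pred (.load 15 (.const 0)))) <|
  .seq (.storeN 14 (.const 0) (.load 14 (pred (reg 0)))) <|
  setReg 0 (pred (reg 0))

/-- Delete an item of minimum key, and put it into cell `1` of memory `6`. -/
def extractMin : Cmd :=
  .seq fix <| .seq findMin <| .seq detach <| .seq popAll <| .seq removeFirst flush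

end Prog

open Prog

section

variable {n m : ℕ} (I : Instance n m)

/-- With no pending roots, every root is registered, and some root has minimum key. So a scan of the
buckets finds a minimum; it ends at the first rank that no item attains or exceeds, hence after at
most L + 1 steps. -/
theorem exec_findMin {σ : Mem} {H : Heap} (h : Rep n σ H) (hH : H.Valid) (hn : H.np = 0)
    (hne : H.live.Nonempty) {L : ℕ} (hL : ∀ x ∈ H.live, H.rk x ≤ L) :
    ∃ u σ' k, Exec I findMin σ σ' k ∧ Rep n σ' H ∧ Frame σ σ' ∧ σ'.nat 17 3 = u + 1 ∧
      H.bk (H.rk u) = u + 1 ∧ (∀ v ∈ H.live, H.key u ≤ H.key v) ∧ k ≤ 150 * L + 200 := by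
  have lf : findMinBody.LoopFree := by repeat' constructor
  have hbt : (isPos (.load 15 (reg 5))).time = 5 := rfl
  obtain ⟨r, σ', k, hex, ⟨g1, g2, g3, g4, g5⟩, hb, hk⟩ :=
    exec_while I (b := isPos (.load 15 (reg 5))) (p := findMinBody) (α := ℕ)
    (fun r τ => Rep n τ H ∧ Frame σ τ ∧ τ.nat 17 5 = r ∧ r ≤ L + 1 ∧
      ((τ.nat 17 3 = 0 ∧ ∀ r' < r, H.bk r' = 0) ∨
        ∃ x, τ.nat 17 3 = x + 1 ∧ H.bk (H.rk x) = x + 1 ∧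
          ∀ r' < r, ∀ y, H.bk r' = y + 1 → H.key x ≤ H.key y))
    (fun r => 150 * (L + 1 - r))
    (by
      rintro r τ ⟨g1, g2, g3, g4, g5⟩ hb
      have hc : 0 < H.cnt r := by
        simpa [isPos, BExp.Holds, NExp.eval, reg, g1.cnt, g3] using hb
      obtain ⟨x, hx, hxr⟩ := Heap.cnt_pos_iff.1 hc
      have hrL : r ≤ L := hxr.trans (hL x hx)
      obtain ⟨k, hk, hex⟩ := lf.exec I τ
      have hk' : k ≤ 60 := hk.trans (by decide)
      -- All cases end with some value z in register `3` and an incremented counter. If the register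
      -- is not changed, z is its own content.
      have done : ∀ z, findMinBody.run I τ = (τ.setNat 17 3 z).setNat 17 5 (r + 1) →
          ((z = 0 ∧ ∀ r' < r + 1, H.bk r' = 0) ∨ ∃ x, z = x + 1 ∧ H.bk (H.rk x) = x + 1 ∧
          ∀ r' < r + 1, ∀ y, H.bk r' = y + 1 → H.key x ≤ H.key y) →
          ∃ a' σ' k, Exec I findMinBody τ σ' k ∧ (Rep n σ' H ∧ Frame σ σ' ∧ σ'.nat 17 5 = a' ∧
            a' ≤ L + 1 ∧ ((σ'.nat 17 3 = 0 ∧ ∀ r' < a', H.bk r' = 0) ∨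
            ∃ x, σ'.nat 17 3 = x + 1 ∧ H.bk (H.rk x) = x + 1 ∧
              ∀ r' < a', ∀ y, H.bk r' = y + 1 → H.key x ≤ H.key y)) ∧
            k + ((isPos (.load 15 (reg 5))).time + 1) + 150 * (L + 1 - a') ≤ 150 * (L + 1 - r) := by
        intro z hz hz'
        rw [hz] at hex
        refine ⟨r + 1, _, k, hex, ⟨(g1.setReg (by norm_num) _).setReg (by norm_num) _,
          (g2.setNat_right (by norm_num) _ _).setNat_right (by norm_num) _ _, by simp, by omega,
          by simpa using hz'⟩, ?_⟩
        rw [hbt]; omega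
      have hself : τ.setNat 17 3 (τ.nat 17 3) = τ := by simp [Mem.setNat]
      by_cases h0 : H.bk r = 0
      · refine done (τ.nat 17 3) ?_ ?_
        · rw [hself]
          simp [findMinBody, Cmd.run, Prog.setReg, NExp.eval, reg, BExp.Holds, isZero, g1.bk, g3, h0,
            succ]
        · rcases g5 with ⟨h1, h2⟩ | ⟨x, h1, h2, h3⟩
          · exact .inl ⟨h1, fun r' hr' => by
              rcases (Nat.lt_succ_iff_lt_or_eq.1 hr') with h | rfl
              · exact h2 r' h
              · exact h0⟩
          · exact .inr ⟨x, h1, h2, fun r' hr' y hy => by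
              rcases (Nat.lt_succ_iff_lt_or_eq.1 hr') with h | rfl
              · exact h3 r' h y hy
              · omega⟩
      · obtain ⟨y, hy⟩ := Nat.exists_eq_succ_of_ne_zero h0
        have hyr := hH.bk r y hy
        have hyb : H.bk (H.rk y) = y + 1 := by rw [hyr.2.2]; exact hy
        rcases g5 with ⟨h1, h2⟩ | ⟨x, h1, h2, h3⟩
        · refine done (y + 1) ?_ (.inr ⟨y, rfl, hyb, fun r' hr' z hz => ?_⟩)
          · simp [findMinBody, Cmd.run, Prog.setReg, NExp.eval, reg, BExp.Holds, isZero, g1.bk, g3,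
              hy, succ, h1]
          · rcases (Nat.lt_succ_iff_lt_or_eq.1 hr') with h | rfl
            · have := h2 r' h; omega
            · obtain rfl : y = z := by omega
              exact le_rfl
        · by_cases hk : H.key y < H.key x
          · refine done (y + 1) ?_ (.inr ⟨y, rfl, hyb, fun r' hr' z hz => ?_⟩)
            · simp [findMinBody, Cmd.run, Prog.setReg, NExp.eval, RExp.eval, reg, BExp.Holds, isZero,
                g1.bk, g3, hy, succ, h1, Prog.pred, g1.key, hk]
            · rcases (Nat.lt_succ_iff_lt_or_eq.1 hr') with h | rfl
              · exact hk.le.trans (h3 r' h z hz)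
              · obtain rfl : y = z := by omega
                exact le_rfl
          · refine done (τ.nat 17 3) ?_ (.inr ⟨x, h1, h2, fun r' hr' z hz => ?_⟩)
            · rw [hself]
              simp [findMinBody, Cmd.run, Prog.setReg, NExp.eval, RExp.eval, reg, BExp.Holds, isZero,
                g1.bk, g3, hy, succ, h1, Prog.pred, g1.key, hk]
            · rcases (Nat.lt_succ_iff_lt_or_eq.1 hr') with h | rfl
              · exact h3 r' h z hz
              · obtain rfl : y = z := by omega
                exact not_lt.1 hk)
    (a := 0) (σ := (σ.setNat 17 5 0).setNat 17 3 0)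
    ⟨(h.setReg (by norm_num) _).setReg (by norm_num) _,
      (Frame.setNat _ (by norm_num) _ _).setNat_right (by norm_num) _ _, by simp, by omega,
      .inl ⟨by simp, by simp⟩⟩
  have hc : H.cnt r = 0 := by
    simpa [isPos, BExp.Holds, NExp.eval, reg, g1.cnt, g3] using hb
  have hroot : ∀ v ∈ H.live, ∃ r' < r, ∃ y, H.bk r' = y + 1 ∧ H.key y ≤ H.key v := by
    intro v hv
    obtain ⟨y, hy, hy0, -, hyk⟩ := hH.exists_min_root hv
    have hby := (hH.root y hy hy0).resolve_right (by simp [hn])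
    refine ⟨H.rk y, ?_, y, hby, hyk⟩
    by_contra hlt
    have := Heap.cnt_pos_iff.2 ⟨y, hy, not_lt.1 hlt⟩
    omega
  obtain ⟨v, hv⟩ := hne
  rcases g5 with ⟨h1, h2⟩ | ⟨x, h1, h2, h3⟩
  · obtain ⟨r', hr', y, hy, -⟩ := hroot v hv
    have := h2 r' hr'
    omega
  · refine ⟨x, σ', _, .seq (exec_storeN I (k := 3) rfl rfl rfl) (.seq (exec_storeN I (k := 3) rfl rfl
      rfl) hex), g1, g2, h1, h2, ?_, ?_⟩
    · intro w hw
      obtain ⟨r', hr', y, hy, hyk⟩ := hroot w hw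
      exact (h3 r' hr' y hy).trans hyk
    · rw [hbt] at hk
      omega

theorem Rep.detach {σ : Mem} {H : Heap} (h : Rep n σ H) (hn : H.np = 0) {u : ℕ}
    (hu : σ.nat 17 3 = u + 1) (hb : H.bk (H.rk u) = u + 1) :
    Rep n (Prog.detach.run I σ) (H.take (H.rk u)) ∧
      Frame (σ.setNat 6 1 u) (Prog.detach.run I σ) ∧ (Prog.detach.run I σ).nat 17 1 = 0 := by
  have e : Prog.detach.run I σ = ((((σ.setNat 6 1 u).setNat 14 0 u).setNat 17 0 1).setNat 13
      (H.rk u) 0).setNat 17 1 0 := by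
    simp [Prog.detach, Cmd.run, Prog.setReg, NExp.eval, reg, Prog.pred, hu, Mem.setNat_nat_of_ne,
      Prog.rk, h.rk]
  rw [e]
  obtain ⟨h1, h2, h3, h4, h5, h6, h7, h8, h9, h10⟩ := h
  refine ⟨⟨?_, ?_, ?_, ?_, ?_, h6, ?_, ?_, h9, ?_⟩, ?_, by simp⟩
  · simp [Mem.setNat_nat_of_ne, Heap.take, h1]
  · simp [Mem.setNat_nat_of_ne, Heap.take, h2]
  · simpa [Mem.setNat_nat_of_ne, Heap.take] using h3
  · simp [Mem.setNat_nat_of_ne, Heap.take, h4]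
  · simp [Mem.setNat_nat_of_ne, Heap.take, h5, hb, hn]
  · simpa [Mem.setNat_nat_of_ne, Heap.take] using h7
  · simp [Mem.setNat_nat_of_ne, Heap.take, hn]
  · simpa [Mem.setNat_nat_of_ne, Heap.take] using h10
  · exact ((((Frame.refl _).setNat_right (by norm_num) _ _).setNat_right (by norm_num) _ _).setNat_right
      (by norm_num) _ _).setNat_right (by norm_num) _ _

/-- Each removal lowers the rank of the root by one and releases at most one child, appended to the
array. The root keeps the index 0, and at most its rank many children become pending. -/
theorem exec_popAll {σ : Mem} {H : Heap} (h : Rep n σ H) (hH : H.Valid) (hn : H.np = 1)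
    (h1 : σ.nat 17 1 = 0) :
    ∃ H' σ' k, Exec I popAll σ σ' k ∧ Rep n σ' H' ∧ H'.Valid ∧ H'.live = H.live ∧
      H'.key = H.key ∧ Frame σ σ' ∧ 0 < H'.np ∧ H'.pend 0 = H.pend 0 ∧ H'.rk (H.pend 0) = 0 ∧
      H'.empty ≤ H.empty ∧ H'.np + H'.filled = 1 + H.filled ∧ H'.np ≤ 1 + H.rk (H.pend 0) ∧
      k ≤ 150 * H.rk (H.pend 0) + 10 := by
  have lf : Prog.pop.LoopFree := by repeat' constructor
  have hbt : (isPos (Prog.rk (.load 14 (reg 1)))).time = 6 := rfl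
  obtain ⟨H', σ', k, hex, ⟨g1, g2, g3, g4, g5, g6, g7, g8, g9, g10, g11⟩, hb, hk⟩ :=
    exec_while I (b := isPos (Prog.rk (.load 14 (reg 1)))) (p := Prog.pop) (α := Heap)
    (fun H₁ τ => Rep n τ H₁ ∧ H₁.Valid ∧ H₁.live = H.live ∧ H₁.key = H.key ∧ Frame σ τ ∧
      0 < H₁.np ∧ H₁.pend 0 = H.pend 0 ∧ τ.nat 17 1 = 0 ∧ H₁.empty ≤ H.empty ∧
      H₁.np + H₁.filled = 1 + H.filled ∧ H₁.np + H₁.rk (H.pend 0) ≤ 1 + H.rk (H.pend 0))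
    (fun H₁ => 150 * H₁.rk (H.pend 0))
    (by
      rintro H₁ τ ⟨g1, g2, g3, g4, g5, g6, g7, g8, g9, g10, g11⟩ hb
      have hr0 : 0 < H₁.rk (H₁.pend 0) := by
        simpa [isPos, BExp.Holds, NExp.eval, reg, Prog.rk, g8, g1.rk, g1.pend] using hb
      obtain ⟨k, hk, hex⟩ := lf.exec I τ
      have hk' : k ≤ 57 := hk.trans (by decide)
      have hxl := (g2.pend 0 g6).1
      obtain ⟨r1, r2, r3⟩ := g1.pop I g8 hxl hr0
      have hcount := H₁.pop_counts hxl hr0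
      have hnp := H₁.np_le_pop_np (H₁.pend 0)
      have hrk : (H₁.pop (H₁.pend 0)).rk (H.pend 0) = H₁.rk (H.pend 0) - 1 := by
        rw [Heap.pop_rk, g7]; simp
      rw [g7] at hr0
      refine ⟨H₁.pop (H₁.pend 0), _, k, hex, ⟨r1, g2.pop g6 (by rwa [g7]), (H₁.pop_live _).trans g3,
        (H₁.pop_key _).trans g4, g5.trans r2, by omega, (H₁.pop_pend _ 0 g6).trans g7,
        (r3 1 (.inl rfl)).trans g8, by omega, by omega, ?_⟩, ?_⟩
      · rw [hrk]; omega
      · rw [hrk, hbt]; omega) (a := H) (σ := σ)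
    ⟨h, hH, rfl, rfl, Frame.refl σ, by omega, rfl, h1, le_rfl, by omega, by omega⟩
  have hr0 : H'.rk (H'.pend 0) = 0 := by
    simpa [isPos, BExp.Holds, NExp.eval, reg, Prog.rk, g8, g1.rk, g1.pend] using hb
  rw [g7] at hr0
  refine ⟨H', σ', k, hex, g1, g2, g3, g4, g5, g6, g7, hr0, g9, g10, by omega, ?_⟩
  rw [hbt] at hk; omega

theorem Rep.removeFirst {σ : Mem} {H : Heap} (h : Rep n σ H)
    (hx : H.pend 0 ∈ H.live) (hr : H.rk (H.pend 0) = 0) :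
    Rep n (Prog.removeFirst.run I σ) H.remove ∧
      Frame (σ.setNat 4 (H.pend 0) 2) (Prog.removeFirst.run I σ) := by
  have e : Prog.removeFirst.run I σ = (((σ.setNat 4 (H.pend 0) 2).setNat 15 0
      (H.cnt 0 - 1)).setNat 14 0 (H.pend (H.np - 1))).setNat 17 0 (H.np - 1) := by
    simp [Prog.removeFirst, Cmd.run, Prog.setReg, NExp.eval, reg, Prog.pred, Mem.setNat_nat_of_ne,
      h.pend, h.cnt, h.np]
  rw [e]
  obtain ⟨h1, h2, h3, h4, h5, h6, h7, h8, h9, h10⟩ := h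
  refine ⟨⟨?_, ?_, ?_, ?_, ?_, ?_, ?_, ?_, h9, ?_⟩, ?_⟩
  · simp [Mem.setNat_nat_of_ne, Heap.remove, h1]
  · simp [Mem.setNat_nat_of_ne, Heap.remove, h2]
  · simpa [Mem.setNat_nat_of_ne, Heap.remove] using h3
  · simp [Mem.setNat_nat_of_ne, Heap.remove, h4]
  · simp [Mem.setNat_nat_of_ne, Heap.remove, h5]
  · intro j
    rw [H.cnt_remove hx hr]
    simp (disch := decide) only [Mem.setNat_nat_of_ne, Mem.setNat_nat_self, Function.update_apply, h6]
    split_ifs with hj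
    · rw [hj]
    · rfl
  · intro x hx j hj
    simp (disch := decide) only [Mem.setNat_nat_of_ne]
    exact h7 x (Finset.mem_of_mem_erase hx) j hj
  · simp [Heap.remove]
  · intro v
    simp (disch := decide) only [Mem.setNat_nat_of_ne, Mem.setNat_nat_self, Function.update_apply,
      Heap.remove, Finset.mem_erase, h10]
    grind
  · exact (((Frame.refl _).setNat_right (by norm_num) _ _).setNat_right (by norm_num) _ _).setNat_right
      (by norm_num) _ _

theorem Frame.congr_setNat {σ σ' : Mem} (h : Frame σ σ') (A i x : ℕ) :
    Frame (σ.setNat A i x) (σ'.setNat A i x) := by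
  refine ⟨fun B hB => ?_, h.2⟩
  by_cases hBA : B = A
  · subst hBA; simp [h.1 B hB]
  · simp [Mem.setNat_nat_of_ne _ hBA, h.1 B hB]

/-- After `fix` all ranks are at most L. Hence the scan for the minimum takes O(L) steps, the
deleted root releases at most L children, and the flush has at most L roots to register or link, up
to the credit for filled slots. -/
theorem exec_extractMin {σ : Mem} {H : Heap} (h : Rep n σ H) (hH : H.Valid) (hn : H.np = 0)
    (hne : H.live.Nonempty) {L : ℕ} (hL : ∀ r, 4 ^ r ≤ 3 ^ r * n → r ≤ L) :
    ∃ u H' σ' k, Exec I extractMin σ σ' k ∧ u ∈ H.live ∧ (∀ v ∈ H.live, H.key u ≤ H.key v) ∧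
      Rep n σ' H' ∧ H'.Valid ∧ H'.np = 0 ∧ Frame ((σ.setNat 6 1 u).setNat 4 u 2) σ' ∧
      k + 4000 * H'.empty + 150 * H.filled ≤
        4000 * H.empty + 150 * H'.filled + 1000 * L + 1000 := by
  obtain ⟨H₁, σ₁, k₁, e₁, a1, a2, a3, a4, a5, a6, a7, a8⟩ := exec_fix I h hH hn hL
  obtain ⟨u, σ₂, k₂, e₂, b1, b2, b3, b4, b5, b6⟩ := exec_findMin I a1 a2 a3 (a4 ▸ hne) a7
  have lf : Prog.detach.LoopFree := by repeat' constructor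
  obtain ⟨k₃, hk₃, e₃⟩ := lf.exec I σ₂
  replace hk₃ : k₃ ≤ 40 := hk₃.trans (by decide)
  obtain ⟨c1, c2, c3⟩ := b1.detach I a3 b3 b4
  have c4 := a2.take (r := H₁.rk u) (by rw [b4]; exact Nat.succ_ne_zero u)
  have hnp : (H₁.take (H₁.rk u)).np = 1 := by simp [Heap.take, a3]
  have hpend : (H₁.take (H₁.rk u)).pend 0 = u := by simp [Heap.take, a3, b4]
  obtain ⟨H₄, σ₄, k₄, e₄, d1, d2, d3, d4, d5, d6, d7, d8, d9, d10, d11, d12⟩ :=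
    exec_popAll I c1 c4 hnp c3
  rw [hpend] at d7 d8 d11 d12
  have hul : u ∈ H₁.live := (a2.bk _ _ b4).1
  have huL := a7 u hul
  have hrk : (H₁.take (H₁.rk u)).rk u = H₁.rk u := rfl
  have hf : (H₁.take (H₁.rk u)).filled = H₁.filled := rfl
  have he : (H₁.take (H₁.rk u)).empty = H₁.empty := rfl
  have hul' : u ∈ H₄.live := d3 ▸ hul
  have lf' : Prog.removeFirst.LoopFree := by repeat' constructor
  obtain ⟨k₅, hk₅, e₅⟩ := lf'.exec I σ₄
  replace hk₅ : k₅ ≤ 40 := hk₅.trans (by decide)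
  obtain ⟨f1, f2⟩ := d1.removeFirst I (by rwa [d7]) (by rwa [d7])
  have f3 := d2.remove d6 (by rwa [d7])
  obtain ⟨f4, f5⟩ := H₄.remove_counts (by rwa [d7]) (by rwa [d7])
  rw [d7] at f2
  obtain ⟨H', σ', k₆, e₆, g1, g2, g3, g4, g5, g6, g7, g8, g9, g10⟩ := exec_flush I f1 f3
  have hnpr : H₄.remove.np = H₄.np - 1 := rfl
  refine ⟨u, H', σ', _, .seq e₁ (.seq e₂ (.seq e₃ (.seq e₄ (.seq e₅ e₆)))), a4 ▸ hul, ?_, g1, g2, g3,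
    ?_, ?_⟩
  · rw [← a4, ← a5]; exact b5
  · refine Frame.trans ?_ (f2.trans g7)
    exact ((((a6.trans b2).congr_setNat 6 1 u).trans c2).trans d5).congr_setNat 4 u 2
  · rw [hrk] at d11 d12
    omega

end

end QSPP

namespace QSPP

/-! ### Relaxation of arcs

Registers of the main program are in natural memory `6`: cell `0` holds one plus the current arc,
cell `1` the current vertex `u`, and cell `2` the head of the arc. Natural memories: `2` first arc
in the list of arcs with a given tail, `3` next arc in that list, `4` status of a vertex (`0` not
reached, `1` in the heap, `2` finished), `5` last arc of the path to a vertex; arcs are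
represented by their successors. Real memories: `1` arc weights, `2` distances. -/

namespace Prog

/-- One plus the current arc. -/
def arc : NExp := .load 6 (.const 0)
/-- The current vertex. -/
def cur : NExp := .load 6 (.const 1)
/-- The head of the current arc. -/
def hd : NExp := .load 6 (.const 2)

/-- Length of the path to the head of the current arc via the current vertex. -/
def newDist : RExp := .add (.load 2 cur) (.load 1 (pred arc))

/-- Record the path via the current vertex. -/
def label : Cmd :=
  .seq (.storeR 2 hd newDist) <| .seq (.storeN 5 hd arc) (.storeN 4 hd (.const 1))

/-- Insert the head of the current arc into the heap. -/
def insertHead : Cmd :=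
  .seq (.storeN 10 hd (.const 0)) <| .seq (.storeN 11 hd (.const 0)) <|
  .seq (.storeN 16 (.const 0) (.const 0)) <| .seq (.storeN 14 (.const 0) hd) <|
  .seq (setReg 0 (.const 1)) <| .seq (.storeN 15 (.const 0) (succ (.load 15 (.const 0)))) label

/-- Detach the head of the current arc from its parent in the heap. -/
def cutHead : Cmd :=
  .seq (.storeN 12 (slotAddr (pred (.load 11 hd)) (succ (rk hd))) (.const 0)) <|
  .seq (.storeN 11 hd (.const 0)) <| .seq (.storeN 14 (.const 0) hd) <|
  .seq (setReg 0 (.const 1)) label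

/-- Relax the current arc. -/
def relax : Cmd :=
  .seq (.storeN 6 (.const 2) (.head (pred arc))) <|
  .ite (isZero (.load 4 hd)) (.seq insertHead flush) <|
  .ite (.and (.natEq (.load 4 hd) (.const 1)) (.realLt newDist (.load 2 hd)))
    (.ite (isZero (.load 11 hd)) label (.seq cutHead flush)) .skip

end Prog

/-- The memory after the path via the current vertex has been recorded. -/
def Mem.label (σ : Mem) (v e : ℕ) (d : ℝ) : Mem := ((σ.setReal 2 v d).setNat 5 v e).setNat 4 v 1

open Prog

section

variable {n m : ℕ} (I : Instance n m)

theorem Rep.setMainReg {σ : Mem} {H : Heap} (h : Rep n σ H) (k x : ℕ) : Rep n (σ.setNat 6 k x) H := by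
  obtain ⟨h1, h2, h3, h4, h5, h6, h7, h8, h9, h10⟩ := h
  refine ⟨?_, ?_, ?_, ?_, ?_, h6, ?_, ?_, h9, ?_⟩
  · simp [Mem.setNat_nat_of_ne, h1]
  · simp [Mem.setNat_nat_of_ne, h2]
  · simpa [Mem.setNat_nat_of_ne] using h3
  · simp [Mem.setNat_nat_of_ne, h4]
  · simp [Mem.setNat_nat_of_ne, h5]
  · simpa [Mem.setNat_nat_of_ne] using h7
  · simp [Mem.setNat_nat_of_ne, h8]
  · simpa [Mem.setNat_nat_of_ne] using h10

variable {σ : Mem} {H : Heap} {u v e : ℕ} {d : ℝ}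

/-- For an empty heap, the clause `off` says nothing, so the offset 0 of level 0 is written anew
with each insertion. -/
theorem Rep.insertHead (h : Rep n σ H) (he : σ.nat 6 0 = e) (hu : σ.nat 6 1 = u)
    (hv : σ.nat 6 2 = v) (hvn : v < n) (hvl : v ∉ H.live)
    (hd : σ.real 2 u + σ.real 1 (e - 1) = d) :
    Rep n (Prog.insertHead.run I σ) (H.ins v d) ∧
      Frame (σ.label v e d) (Prog.insertHead.run I σ) := by
  have e : Prog.insertHead.run I σ = ((((((σ.setNat 10 v 0).setNat 11 v 0).setNat 16 0 0).setNat 14 0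
      v).setNat 17 0 1).setNat 15 0 (H.cnt 0 + 1)).label v e d := by
    simp [Prog.insertHead, Cmd.run, Prog.setReg, NExp.eval, RExp.eval, reg, Prog.pred, Prog.succ,
      Mem.setNat_nat_of_ne, Prog.hd, arc, cur, newDist, Prog.label, h.cnt, hv, he, hu, hd, Mem.label]
  rw [e]
  obtain ⟨h1, h2, h3, h4, h5, h6, h7, h8, h9, h10⟩ := h
  refine ⟨⟨?_, ?_, ?_, ?_, ?_, ?_, ?_, ?_, ?_, ?_⟩, ?_, ?_⟩
  · simp [Mem.label, Mem.setNat_nat_of_ne, Heap.ins, h1]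
  · simp [Mem.label, Mem.setNat_nat_of_ne, Heap.ins, h2]
  · simpa [Mem.label, Mem.setNat_nat_of_ne, Heap.ins] using h3
  · simp [Mem.label, Mem.setNat_nat_of_ne, Heap.ins, h4]
  · simp [Mem.label, Mem.setNat_nat_of_ne, Heap.ins, h5]
  · intro j
    rw [H.cnt_ins d hvl]
    simp only [Mem.label]
    simp (disch := decide) only [Mem.setNat_nat_of_ne, Mem.setReal_nat, Mem.setNat_nat_self,
      Function.update_apply, h6]
    split_ifs with hj
    · rw [hj]
    · rfl
  · intro x hx j hj
    simp only [Mem.label]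
    simp (disch := decide) only [Mem.setNat_nat_of_ne, Mem.setReal_nat, Mem.setNat_nat_self,
      Function.update_apply]
    simp only [Heap.ins, Finset.mem_insert, Function.update_apply] at hx hj
    by_cases h0 : j = 0
    · simp [h0]
    · by_cases hxv : x = v
      · rw [if_pos hxv] at hj; omega
      · rw [if_neg hxv] at hj
        rw [if_neg h0]
        exact h7 x (hx.resolve_left hxv) j hj
  · simp [Mem.label, Mem.setNat_nat_of_ne, Heap.ins]
  · simp [Mem.label, Heap.ins, h9]
  · intro w
    simp only [Mem.label]
    simp (disch := decide) only [Mem.setNat_nat_of_ne, Mem.setReal_nat, Mem.setNat_nat_self,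
      Function.update_apply, Heap.ins, Finset.mem_insert, h10]
    grind
  · intro A hA
    have : A ≠ 10 ∧ A ≠ 11 ∧ A ≠ 16 ∧ A ≠ 14 ∧ A ≠ 17 ∧ A ≠ 15 := by omega
    simp only [Mem.label]
    by_cases h4 : A = 4
    · subst h4; simp [Mem.setNat_nat_of_ne]
    · by_cases h5 : A = 5
      · subst h5; simp [Mem.setNat_nat_of_ne]
      · simp [Mem.setNat_nat_of_ne, h4, h5, this]
  · simp [Mem.label, Mem.setReal]

theorem Rep.cutHead (h : Rep n σ H) (hH : H.Valid) (he : σ.nat 6 0 = e) (hu : σ.nat 6 1 = u)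
    (hv : σ.nat 6 2 = v) (hvl : v ∈ H.live) {p : ℕ} (hp : H.par v = p + 1)
    (hd : σ.real 2 u + σ.real 1 (e - 1) = d) :
    Rep n (Prog.cutHead.run I σ) (H.cut v p d) ∧
      Frame (σ.label v e d) (Prog.cutHead.run I σ) := by
  obtain ⟨hpl, hr, hs⟩ := hH.par v hvl p hp
  have hpn : p < n := ((h.live p).1 hpl).1
  have hoff : σ.nat 16 (H.rk v + 1) = (H.rk v + 1) * n := h.off p hpl _ hr
  have e : Prog.cutHead.run I σ = ((((σ.setNat 12 ((H.rk v + 1) * n + p) 0).setNat 11 v 0).setNat 14 0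
      v).setNat 17 0 1).label v e d := by
    simp [Prog.cutHead, Cmd.run, Prog.setReg, NExp.eval, RExp.eval, reg, Prog.pred, Prog.succ,
      Mem.setNat_nat_of_ne, Prog.hd, arc, cur, newDist, Prog.label, hv, he, hu, hd, Mem.label,
      slotAddr, h.par, hp, Prog.rk, h.rk, hoff]
  rw [e]
  obtain ⟨h1, h2, h3, h4, h5, h6, h7, h8, h9, h10⟩ := h
  refine ⟨⟨?_, ?_, ?_, ?_, ?_, h6, ?_, ?_, ?_, ?_⟩, ?_, ?_⟩
  · simp [Mem.label, Mem.setNat_nat_of_ne, Heap.cut, h1]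
  · simp [Mem.label, Mem.setNat_nat_of_ne, Heap.cut, h2]
  · intro x hx j
    simp only [Mem.label]
    simp (disch := decide) only [Mem.setNat_nat_of_ne, Mem.setReal_nat, Mem.setNat_nat_self,
      Function.update_apply, Heap.cut, mul_add_inj hx hpn, h3 x hx j]
    by_cases hxp : x = p
    · subst hxp; simp [Function.update_apply]
    · simp [hxp]
  · simp [Mem.label, Mem.setNat_nat_of_ne, Heap.cut, h4]
  · simp [Mem.label, Mem.setNat_nat_of_ne, Heap.cut, h5]
  · simpa [Mem.label, Mem.setNat_nat_of_ne, Heap.cut] using h7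
  · simp [Mem.label, Mem.setNat_nat_of_ne, Heap.cut]
  · simp [Mem.label, Heap.cut, h9]
  · intro w
    have := (h10 v).1 hvl
    simp only [Mem.label]
    simp (disch := decide) only [Mem.setNat_nat_of_ne, Mem.setReal_nat, Mem.setNat_nat_self,
      Function.update_apply, Heap.cut, h10]
    grind
  · intro A hA
    have : A ≠ 12 ∧ A ≠ 11 ∧ A ≠ 14 ∧ A ≠ 17 := by omega
    simp only [Mem.label]
    by_cases h4 : A = 4
    · subst h4; simp [Mem.setNat_nat_of_ne]
    · by_cases h5 : A = 5
      · subst h5; simp [Mem.setNat_nat_of_ne]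
      · simp [Mem.setNat_nat_of_ne, h4, h5, this]
  · simp [Mem.label, Mem.setReal]

theorem Rep.label (h : Rep n σ H) (he : σ.nat 6 0 = e) (hu : σ.nat 6 1 = u)
    (hv : σ.nat 6 2 = v) (hvl : v ∈ H.live) (hd : σ.real 2 u + σ.real 1 (e - 1) = d) :
    Prog.label.run I σ = σ.label v e d ∧ Rep n (σ.label v e d) (H.setKey v d) := by
  refine ⟨?_, ?_⟩
  · simp [Cmd.run, NExp.eval, RExp.eval, Prog.pred, Mem.setNat_nat_of_ne, Prog.hd, arc, cur, newDist,
      Prog.label, hv, he, hu, hd, Mem.label]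
  obtain ⟨h1, h2, h3, h4, h5, h6, h7, h8, h9, h10⟩ := h
  refine ⟨?_, ?_, ?_, ?_, ?_, h6, ?_, ?_, ?_, ?_⟩
  · simp [Mem.label, Mem.setNat_nat_of_ne, Heap.setKey, h1]
  · simp [Mem.label, Mem.setNat_nat_of_ne, Heap.setKey, h2]
  · simpa [Mem.label, Mem.setNat_nat_of_ne, Heap.setKey] using h3
  · simp [Mem.label, Mem.setNat_nat_of_ne, Heap.setKey, h4]
  · simp [Mem.label, Mem.setNat_nat_of_ne, Heap.setKey, h5]
  · simpa [Mem.label, Mem.setNat_nat_of_ne, Heap.setKey] using h7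
  · simp [Mem.label, Mem.setNat_nat_of_ne, Heap.setKey, h8]
  · simp [Mem.label, Heap.setKey, h9]
  · intro w
    have := (h10 v).1 hvl
    simp only [Mem.label]
    simp (disch := decide) only [Mem.setNat_nat_of_ne, Mem.setReal_nat, Mem.setNat_nat_self,
      Function.update_apply, Heap.setKey, h10]
    grind

/-- Constant amortized time: an insertion or a cut leaves one pending root to be flushed, and a cut
turns one filled slot into an empty one, which raises the potential by 4150. A root with a lowered
key stays in place. -/
theorem exec_relax (h : Rep n σ H) (hH : H.Valid) (hn : H.np = 0) {e : Fin m}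
    (he : σ.nat 6 0 = e + 1) (hu : σ.nat 6 1 = u)
    (hd : σ.real 2 u + σ.real 1 e = d) :
    ∃ H' σ' k, Exec I relax σ σ' k ∧ Rep n σ' H' ∧ H'.Valid ∧ H'.np = 0 ∧
      ((((σ.nat 4 (I.head e) = 0 ∨ (σ.nat 4 (I.head e) = 1 ∧ d < σ.real 2 (I.head e))) ∧
        Frame ((σ.setNat 6 2 (I.head e)).label (I.head e) (e + 1) d) σ')) ∨
      (¬ (σ.nat 4 (I.head e) = 0 ∨ (σ.nat 4 (I.head e) = 1 ∧ d < σ.real 2 (I.head e))) ∧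
        Frame (σ.setNat 6 2 (I.head e)) σ')) ∧
      k + 4000 * H'.empty + 150 * H.filled ≤ 4000 * H.empty + 150 * H'.filled + 5000 := by
  set v : ℕ := (I.head e : ℕ) with hvdef
  have hvn : v < n := (I.head e).2
  have e₀ : Exec I (.storeN 6 (.const 2) (.head (Prog.pred arc))) σ (σ.setNat 6 2 v) 7 :=
    exec_storeN I rfl (by simp [NExp.eval, Prog.pred, arc, he, hvdef]) rfl
  set τ := σ.setNat 6 2 v with hτ
  have hR : Rep n τ H := h.setMainReg _ _
  have he' : τ.nat 6 0 = e + 1 := by simp [hτ, he]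
  have hu' : τ.nat 6 1 = u := by simp [hτ, hu]
  have hv' : τ.nat 6 2 = v := by simp [hτ]
  have hst : τ.nat 4 = σ.nat 4 := by simp [hτ, Mem.setNat_nat_of_ne]
  have hre : τ.real = σ.real := rfl
  have hd' : τ.real 2 u + τ.real 1 ((e : ℕ) + 1 - 1) = d := hd
  have c1 : (isZero (.load 4 Prog.hd)).Holds I τ ↔ σ.nat 4 v = 0 := by
    simp [isZero, BExp.Holds, NExp.eval, Prog.hd, hv', hst]
  have c2 : (BExp.and (.natEq (.load 4 Prog.hd) (.const 1))
      (.realLt newDist (.load 2 Prog.hd))).Holds I τ ↔ σ.nat 4 v = 1 ∧ d < σ.real 2 v := by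
    simp only [BExp.Holds, NExp.eval, RExp.eval, Prog.hd, hv', hst, newDist, cur, arc, Prog.pred, hu',
      he', hd']
    rfl
  have c3 : (isZero (.load 11 Prog.hd)).Holds I τ ↔ H.par v = 0 := by
    simp [isZero, BExp.Holds, NExp.eval, Prog.hd, hv', hR.par]
  have t1 : (isZero (.load 4 Prog.hd)).time = 5 := rfl
  have t2 : (BExp.and (.natEq (.load 4 Prog.hd) (.const 1))
      (.realLt newDist (.load 2 Prog.hd))).time = 19 := rfl
  have t3 : (isZero (.load 11 Prog.hd)).time = 5 := rfl
  by_cases h1 : σ.nat 4 v = 0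
  · have hvl : v ∉ H.live := by rw [h.live]; omega
    have lf : Prog.insertHead.LoopFree := by repeat' constructor
    obtain ⟨k₁, hk₁, e₁⟩ := lf.exec I τ
    replace hk₁ : k₁ ≤ 100 := hk₁.trans (by decide)
    obtain ⟨a1, a2⟩ := hR.insertHead I he' hu' hv' hvn hvl hd'
    obtain ⟨b1, b2⟩ := H.ins_counts d hvl
    obtain ⟨H', σ', k₂, e₂, g1, g2, g3, g4, g5, g6, g7, g8, g9, g10⟩ :=
      exec_flush I a1 (hH.ins hn d hvl)
    have hnp : (H.ins v d).np = 1 := rfl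
    refine ⟨H', σ', _, .seq e₀ (.ite_true (c1.2 h1) (.seq e₁ e₂)), g1, g2, g3,
      .inl ⟨.inl h1, a2.trans g7⟩, ?_⟩
    omega
  · by_cases h2 : σ.nat 4 v = 1 ∧ d < σ.real 2 v
    · have hvl : v ∈ H.live := (h.live v).2 ⟨hvn, h2.1⟩
      have hdk : d ≤ H.key v := by rw [← h.key]; exact h2.2.le
      rcases Nat.eq_zero_or_eq_succ_pred (H.par v) with h3 | h3
      · have lf : Prog.label.LoopFree := by repeat' constructor
        obtain ⟨k₁, hk₁, e₁⟩ := lf.exec I τ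
        replace hk₁ : k₁ ≤ 100 := hk₁.trans (by decide)
        obtain ⟨a1, a2⟩ := hR.label I he' hu' hv' hvl hd'
        rw [a1] at e₁
        refine ⟨H.setKey v d, _, _, .seq e₀ (.ite_false (mt c1.1 h1) (.ite_true (c2.2 h2)
          (.ite_true (c3.2 h3) e₁))), a2, hH.setKey h3 hdk, hn, .inl ⟨.inr h2, Frame.refl _⟩, ?_⟩
        have f1 : (H.setKey v d).empty = H.empty := rfl
        have f2 : (H.setKey v d).filled = H.filled := rfl
        omega
      · have lf : Prog.cutHead.LoopFree := by repeat' constructor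
        obtain ⟨k₁, hk₁, e₁⟩ := lf.exec I τ
        replace hk₁ : k₁ ≤ 100 := hk₁.trans (by decide)
        obtain ⟨a1, a2⟩ := hR.cutHead I hH he' hu' hv' hvl h3 hd'
        obtain ⟨b1, b2⟩ := Heap.cut_counts hH d hvl h3
        obtain ⟨H', σ', k₂, e₂, g1, g2, g3, g4, g5, g6, g7, g8, g9, g10⟩ :=
          exec_flush I a1 (hH.cut hn hvl h3 hdk)
        have hnp : (H.cut v ((H.par v).pred) d).np = 1 := rfl
        refine ⟨H', σ', _, .seq e₀ (.ite_false (mt c1.1 h1) (.ite_true (c2.2 h2)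
          (.ite_false (by rw [c3]; omega) (.seq e₁ e₂)))), g1, g2, g3,
          .inl ⟨.inr h2, a2.trans g7⟩, ?_⟩
        omega
    · refine ⟨H, τ, _, .seq e₀ (.ite_false (mt c1.1 h1) (.ite_false (mt c2.1 h2) (.skip τ))), hR, hH,
        hn, .inr ⟨by simp only [not_or]; exact ⟨h1, h2⟩, Frame.refl _⟩, ?_⟩
      omega

end

end QSPP

namespace QSPP

/-! ### Correctness of Dijkstra's algorithm -/

namespace STGraph

variable {n m : ℕ} (G : STGraph n m)

/-- Following the arcs `pr` backwards from `v` to `s` yields the path `P`. -/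
inductive PredPath (pr : ℕ → ℕ) : Fin n → List (Fin m) → Prop
  | nil : PredPath pr G.s []
  | snoc {P : List (Fin m)} {e : Fin m} : G.head e ≠ G.s → pr (G.head e) = e + 1 →
      PredPath pr (G.tail e) P → PredPath pr (G.head e) (P ++ [e])

variable {G}

theorem isWalk_append {u v : Fin n} {P : List (Fin m)} {Q : List (Fin m)} :
    G.IsWalk u (P ++ Q) v ↔ ∃ x, G.IsWalk u P x ∧ G.IsWalk x Q v := by
  induction P generalizing u with
  | nil => simp [IsWalk]
  | cons e P ih => simp [IsWalk, ih, and_assoc]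

theorem PredPath.congr {pr pr' : ℕ → ℕ} {v : Fin n} {P : List (Fin m)} (h : G.PredPath pr v P)
    (hp : ∀ x ∈ P.map G.head, pr' x = pr x) : G.PredPath pr' v P := by
  induction h with
  | nil => exact .nil
  | snoc h1 h2 _ ih =>
    exact .snoc h1 ((hp _ (by simp)).trans h2) (ih fun x hx => hp x (by simp_all))

/-- The invariant of Dijkstra's algorithm: `st` holds the states of the vertices (`0` not reached,
`1` reached, `2` finished), `pr` the last arcs (plus one) of the recorded paths and `d` their
lengths; the arcs with `R` have been relaxed. -/
structure DijkstraInv (G : STGraph n m) (w : Fin m → ℝ) (st pr : ℕ → ℕ) (d : ℕ → ℝ)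
    (R : Fin m → Prop) : Prop where
  le_two : ∀ v : Fin n, st v ≤ 2
  source : st G.s ≠ 0 ∧ d G.s = 0
  path : ∀ v : Fin n, st v ≠ 0 → ∃ P, G.PredPath pr v P ∧ G.IsWalk G.s P v ∧
    (G.s :: P.map G.head).Nodup ∧ (P.map w).sum = d v ∧ ∀ x ∈ G.s :: P.map G.head, x ≠ v → st x = 2
  relaxed : ∀ e, R e → st (G.tail e) = 2 ∧ st (G.head e) ≠ 0 ∧
    d (G.head e) ≤ d (G.tail e) + w e
  order : ∀ u v : Fin n, st u = 2 → st v = 1 → d u ≤ d v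

theorem DijkstraInv.congr {w : Fin m → ℝ} {st pr st' pr' : ℕ → ℕ} {d d' : ℕ → ℝ} {R R' : Fin m → Prop}
    (h : G.DijkstraInv w st pr d R) (h1 : st' = st) (h2 : pr' = pr) (h3 : d' = d)
    (h4 : ∀ e, R' e → R e) : G.DijkstraInv w st' pr' d' R' := by
  subst h1 h2 h3
  exact ⟨h.le_two, h.source, h.path, fun e he => h.relaxed e (h4 e he), h.order⟩

/-- Minimality of u among the reached vertices is what `order` demands of a newly finished vertex.
-/
theorem DijkstraInv.extract {w : Fin m → ℝ} {st pr : ℕ → ℕ} {d : ℕ → ℝ} {R : Fin m → Prop}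
    (h : G.DijkstraInv w st pr d R) {u : Fin n} (hu : st u = 1)
    (hmin : ∀ v : Fin n, st v = 1 → d u ≤ d v) :
    G.DijkstraInv w (Function.update st u 2) pr d R := by
  have key : ∀ v : Fin n, Function.update st (u : ℕ) 2 v = if v = u then 2 else st v := by
    intro v; simp [Function.update_apply, Fin.val_inj]
  refine ⟨?_, ?_, ?_, ?_, ?_⟩
  · intro v; rw [key]; have := h.le_two v; split_ifs <;> omega
  · rw [key]; refine ⟨?_, h.source.2⟩; have := h.source.1; split_ifs <;> omega
  · intro v hv
    rw [key] at hv
    obtain ⟨P, h1, h2, h3, h4, h5⟩ := h.path v (by split_ifs at hv with hvu <;> [rw [hvu, hu]; exact hv]; norm_num)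
    refine ⟨P, h1, h2, h3, h4, fun x hx hxv => ?_⟩
    rw [key, h5 x hx hxv, ite_self]
  · intro e he
    obtain ⟨h1, h2, h3⟩ := h.relaxed e he
    refine ⟨by rw [key, h1, ite_self], ?_, h3⟩
    rw [key]; split_ifs <;> omega
  · intro x v hx hv
    rw [key] at hx hv
    have hvu : v ≠ u := by rintro rfl; simp at hv
    rw [if_neg hvu] at hv
    by_cases hxu : x = u
    · subst hxu; exact hmin v hv
    · rw [if_neg hxu] at hx
      exact h.order x v hx hv

/-- If some vertex is finished, then so is the source. -/
theorem DijkstraInv.source_finished {w : Fin m → ℝ} {st pr : ℕ → ℕ} {d : ℕ → ℝ} {R : Fin m → Prop}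
    (h : G.DijkstraInv w st pr d R) {u : Fin n} (hu : st u = 2) : st G.s = 2 := by
  obtain ⟨P, -, -, -, -, h5⟩ := h.path u (by omega)
  by_cases hs : G.s = u
  · rw [hs, hu]
  · exact h5 _ (by simp) hs

/-- The head v is not finished, whereas every vertex of a recorded path other than its end is. So v
is on no recorded path to another vertex: those paths survive the change at v, and the path to the
tail extends by e without repetition. As w ≥ 0 and the tail has the largest finished distance, the
new label respects `order`. -/
theorem DijkstraInv.label {w : Fin m → ℝ} (hw : ∀ e, 0 ≤ w e) {st pr : ℕ → ℕ} {d : ℕ → ℝ}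
    {R R' : Fin m → Prop} (h : G.DijkstraInv w st pr d R) {e : Fin m} (hu : st (G.tail e) = 2)
    (hmax : ∀ x : Fin n, st x = 2 → d x ≤ d (G.tail e))
    (hv : st (G.head e) = 0 ∨ st (G.head e) = 1 ∧ d (G.tail e) + w e < d (G.head e))
    (hR : ∀ e', R' e' → R e' ∨ e' = e) :
    G.DijkstraInv w (Function.update st (G.head e) 1) (Function.update pr (G.head e) (e + 1))
      (Function.update d (G.head e) (d (G.tail e) + w e)) R' := by
  set v := G.head e with hvdef
  have key : ∀ x : Fin n, Function.update st (v : ℕ) 1 x = if x = v then 1 else st x := by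
    intro x; simp [Function.update_apply, Fin.val_inj]
  have keyd : ∀ x : Fin n, Function.update d (v : ℕ) (d (G.tail e) + w e) x =
      if x = v then d (G.tail e) + w e else d x := by
    intro x; simp [Function.update_apply, Fin.val_inj]
  have hv2 : st v ≠ 2 := by omega
  have hsv : G.s ≠ v := by
    intro hs; rw [← hs] at hv2; exact hv2 (h.source_finished hu)
  have htv : G.tail e ≠ v := by intro ht; rw [ht] at hu; exact hv2 hu
  refine ⟨?_, ?_, ?_, ?_, ?_⟩
  · intro x; rw [key]; have := h.le_two x; split_ifs <;> omega
  · rw [key, keyd, if_neg hsv, if_neg hsv]; exact h.source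
  · intro x hx
    rw [key] at hx
    have aux : ∀ y : Fin n, st y ≠ 0 → y ≠ v → ∃ P,
        G.PredPath (Function.update pr v (e + 1)) y P ∧ G.IsWalk G.s P y ∧
        (G.s :: P.map G.head).Nodup ∧ (P.map w).sum = d y ∧
        (∀ x ∈ G.s :: P.map G.head, x ≠ y → st x = 2) ∧ v ∉ G.s :: P.map G.head := by
      intro y hy hyv
      obtain ⟨P, h1, h2, h3, h4, h5⟩ := h.path y hy
      have hvP : v ∉ G.s :: P.map G.head := fun hmem => hv2 (h5 v hmem hyv.symm)
      refine ⟨P, h1.congr fun z hz => ?_, h2, h3, h4, h5, hvP⟩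
      rw [Function.update_of_ne]
      intro hzv
      rw [Fin.val_inj] at hzv
      exact hvP (hzv ▸ List.mem_cons_of_mem _ hz)
    by_cases hxv : x = v
    · subst hxv
      obtain ⟨P, h1, h2, h3, h4, h5, h6⟩ := aux (G.tail e) (by omega) htv
      refine ⟨P ++ [e], .snoc hsv.symm (by simp [hvdef]) h1,
        isWalk_append.2 ⟨_, h2, rfl, rfl⟩, ?_, ?_, ?_⟩
      · rw [List.map_append, ← List.cons_append, List.nodup_append']
        exact ⟨h3, by simp, by simpa [← hvdef] using h6⟩
      · rw [keyd]; simp [h4]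
      · intro z hz hzv
        rw [key, if_neg hzv]
        rw [List.map_append, ← List.cons_append, List.mem_append] at hz
        rcases hz with hz | hz
        · by_cases hzt : z = G.tail e
          · rw [hzt]; exact hu
          · exact h5 z hz hzt
        · simp at hz; exact absurd hz hzv
    · rw [if_neg hxv] at hx
      obtain ⟨P, h1, h2, h3, h4, h5, h6⟩ := aux x hx hxv
      refine ⟨P, h1, h2, h3, by rw [keyd, if_neg hxv, h4], fun z hz hzx => ?_⟩
      rw [key, if_neg (by rintro rfl; exact h6 hz), h5 z hz hzx]
  · intro e' he'
    rcases hR e' he' with he' | rfl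
    · obtain ⟨h1, h2, h3⟩ := h.relaxed e' he'
      have ht : G.tail e' ≠ v := by intro ht; rw [ht] at h1; exact hv2 h1
      simp only [key, keyd, if_neg ht]
      refine ⟨h1, ?_, ?_⟩
      · split_ifs <;> omega
      · split_ifs with hhv
        · rw [hhv] at h2 h3
          rcases hv with hv | hv
          · omega
          · linarith [hv.2]
        · exact h3
    · simp only [key, keyd, if_neg htv, ← hvdef, if_true]
      exact ⟨hu, by norm_num, le_rfl⟩
  · intro x y hx hy
    rw [key] at hx hy
    have h1 : x ≠ v := by rintro rfl; simp at hx
    rw [if_neg h1] at hx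
    rw [keyd, keyd, if_neg h1]
    split_ifs at hy ⊢ with h2
    · linarith [hmax x hx, hw e]
    · exact h.order x y hx hy

/-- The arc already satisfies the relaxation inequality: its head is either reached with a label
that is not larger, or finished and thus no farther than the tail, and weights are nonnegative. -/
theorem DijkstraInv.skip {w : Fin m → ℝ} (hw : ∀ e, 0 ≤ w e) {st pr : ℕ → ℕ} {d : ℕ → ℝ}
    {R R' : Fin m → Prop} (h : G.DijkstraInv w st pr d R) {e : Fin m} (hu : st (G.tail e) = 2)
    (hmax : ∀ x : Fin n, st x = 2 → d x ≤ d (G.tail e))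
    (hv : ¬ (st (G.head e) = 0 ∨ st (G.head e) = 1 ∧ d (G.tail e) + w e < d (G.head e)))
    (hR : ∀ e', R' e' → R e' ∨ e' = e) : G.DijkstraInv w st pr d R' := by
  refine ⟨h.le_two, h.source, h.path, ?_, h.order⟩
  intro e' he'
  rcases hR e' he' with he' | rfl
  · exact h.relaxed e' he'
  · rw [not_or] at hv
    refine ⟨hu, hv.1, ?_⟩
    by_cases h1 : st (G.head e') = 1
    · exact not_lt.1 fun hlt => hv.2 ⟨h1, hlt⟩
    · have := h.le_two (G.head e')
      linarith [hmax (G.head e') (by omega), hw e']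

/-- When all reached vertices are finished and all arcs that leave them are relaxed, every walk
from `s` is at least as long as the recorded path. -/
theorem DijkstraInv.le_of_isWalk {w : Fin m → ℝ} {st pr : ℕ → ℕ} {d : ℕ → ℝ}
    (h : G.DijkstraInv w st pr d fun e => st (G.tail e) = 2) (h1 : ∀ v : Fin n, st v ≠ 1)
    {u v : Fin n} (hu : st u ≠ 0) {P : List (Fin m)} (hP : G.IsWalk u P v) :
    st v ≠ 0 ∧ d v ≤ d u + (P.map w).sum := by
  induction P generalizing u with
  | nil => obtain rfl : u = v := hP; exact ⟨hu, by simp⟩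
  | cons e P ih =>
    obtain ⟨rfl, hP⟩ := hP
    have := h.le_two (G.tail e)
    have := h1 (G.tail e)
    obtain ⟨-, h2, h3⟩ := h.relaxed e (by omega)
    obtain ⟨h4, h5⟩ := ih h2 hP
    refine ⟨h4, ?_⟩
    rw [List.map_cons, List.sum_cons]
    linarith

end STGraph

/-- Distinct heads force distinct arcs, so the sum over the arc set is the sum over the list. -/
theorem linearCost_eq_sum {n m : ℕ} (G : STGraph n m) (w : Fin m → ℝ) {P : List (Fin m)}
    (h : (G.s :: P.map G.head).Nodup) : linearCost w P = (P.map w).sum :=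
  List.sum_toFinset w (List.Nodup.of_map _ (List.nodup_cons.1 h).2)

end QSPP

/-! ### The main loop of Dijkstra's algorithm -/

namespace QSPP

namespace Prog

/-- Relax all arcs of a list. -/
def relaxList : Cmd :=
  .while (isPos arc) (.seq relax (.storeN 6 (.const 0) (.load 3 (pred arc))))

/-- Finish a vertex. -/
def finish : Cmd :=
  .seq extractMin <| .seq (.storeN 6 (.const 0) (.load 2 cur)) relaxList

/-- Finish all vertices that can be reached. -/
def dijkstra : Cmd := .while (isPos (.load 15 (.const 0))) finish

end Prog

open Prog

/-- The linked list with first element `x - 1` and successors given by `next`. -/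
def Linked {m : ℕ} (next : ℕ → ℕ) : ℕ → List (Fin m) → Prop
  | x, [] => x = 0
  | x, e :: l => x = e + 1 ∧ Linked next (next e) l

section

variable {n m : ℕ}

/-- The memory represents the graph with arc weights `w`. -/
structure GraphRep (w : Fin m → ℝ) (adj : Fin n → List (Fin m)) (σ : Mem) : Prop where
  linked : ∀ u : Fin n, Linked (σ.nat 3) (σ.nat 2 u) (adj u)
  weight : ∀ e : Fin m, σ.real 1 e = w e

theorem GraphRep.congr {w : Fin m → ℝ} {adj : Fin n → List (Fin m)} {σ σ' : Mem}
    (h : GraphRep w adj σ) (h2 : σ'.nat 2 = σ.nat 2) (h3 : σ'.nat 3 = σ.nat 3)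
    (h1 : σ'.real 1 = σ.real 1) : GraphRep w adj σ' :=
  ⟨by rw [h2, h3]; exact h.linked, by rw [h1]; exact h.weight⟩

variable (I : Instance n m)

/-- The ghost state carries the part of the list still to be processed; exactly its arcs are exempt
from the relaxation inequality among the arcs with finished tail. Relaxation never changes a
finished vertex, so u keeps the largest finished distance throughout. -/
theorem exec_relaxList {w : Fin m → ℝ} (hw : ∀ e, 0 ≤ w e) {σ : Mem} {H : Heap} (h : Rep n σ H)
    (hH : H.Valid) (hn : H.np = 0) {u : Fin n} (hu : σ.nat 6 1 = u) {l : List (Fin m)}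
    (hl : Linked (σ.nat 3) (σ.nat 6 0) l) (hlt : ∀ e, I.tail e = u → e ∈ l)
    (hlt' : ∀ e ∈ l, I.tail e = u)
    (hwt : ∀ e : Fin m, σ.real 1 e = w e) (hst : σ.nat 4 u = 2)
    (hmax : ∀ x : Fin n, σ.nat 4 x = 2 → σ.real 2 x ≤ σ.real 2 u)
    (hD : I.DijkstraInv w (σ.nat 4) (σ.nat 5) (σ.real 2)
      fun e => σ.nat 4 (I.tail e) = 2 ∧ I.tail e ≠ u) :
    ∃ H' σ' k, Exec I relaxList σ σ' k ∧ Rep n σ' H' ∧ H'.Valid ∧ H'.np = 0 ∧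
      I.DijkstraInv w (σ'.nat 4) (σ'.nat 5) (σ'.real 2) (fun e => σ'.nat 4 (I.tail e) = 2) ∧
      (∀ v : Fin n, σ'.nat 4 v = 2 ↔ σ.nat 4 v = 2) ∧ σ'.nat 2 = σ.nat 2 ∧ σ'.nat 3 = σ.nat 3 ∧
      σ'.real 1 = σ.real 1 ∧ σ'.nat 9 = σ.nat 9 ∧
      k + 4000 * H'.empty + 150 * H.filled ≤
        4000 * H.empty + 150 * H'.filled + 5100 * l.length + 10 := by
  have hbt : (isPos arc).time = 4 := rfl
  obtain ⟨⟨H', l'⟩, σ', k, hex, ⟨g1, g2, g3, g4, g5, g6, g7, g8, g9, g10, g11, g12, g13, g14⟩, hb, hk⟩ :=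
    exec_while I (b := isPos arc) (p := .seq relax (.storeN 6 (.const 0) (.load 3 (Prog.pred arc))))
    (α := Heap × List (Fin m))
    (fun p τ => Rep n τ p.1 ∧ p.1.Valid ∧ p.1.np = 0 ∧ τ.nat 6 1 = u ∧
      Linked (τ.nat 3) (τ.nat 6 0) p.2 ∧ (∀ e ∈ p.2, I.tail e = u) ∧
      (∀ e : Fin m, τ.real 1 e = w e) ∧ (∀ x : Fin n, τ.nat 4 x = 2 ↔ σ.nat 4 x = 2) ∧
      (∀ x : Fin n, τ.nat 4 x = 2 → τ.real 2 x ≤ τ.real 2 u) ∧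
      I.DijkstraInv w (τ.nat 4) (τ.nat 5) (τ.real 2)
        (fun e => τ.nat 4 (I.tail e) = 2 ∧ (I.tail e = u → e ∉ p.2)) ∧
      τ.nat 2 = σ.nat 2 ∧ τ.nat 3 = σ.nat 3 ∧ τ.real 1 = σ.real 1 ∧ τ.nat 9 = σ.nat 9)
    (fun p => 5100 * p.2.length + 4000 * p.1.empty + 150 * (n - p.1.filled))
    (by
      rintro ⟨H₁, l₁⟩ τ ⟨g1, g2, g3, g4, g5, g6, g7, g8, g9, g10, g11, g12, g13, g14⟩ hb
      simp only at g1 g2 g3 g4 g5 g6 g7 g8 g9 g10 g11 g12 g13 g14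
      have hpos : 0 < τ.nat 6 0 := by
        simpa [isPos, BExp.Holds, NExp.eval, arc] using hb
      obtain _ | ⟨e, l₂⟩ := l₁
      · exact absurd g5 hpos.ne'
      obtain ⟨he, hl₂⟩ := g5
      have hte : I.tail e = u := g6 e (by simp)
      have htu : τ.nat 4 u = 2 := (g8 u).2 hst
      obtain ⟨H₂, τ', k, hex, r1, r2, r3, r4, r5⟩ := exec_relax I g1 g2 g3 he g4 rfl
      have hR : ∀ (T : ℕ → ℕ), (∀ x : Fin n, T x = 2 ↔ τ.nat 4 x = 2) → ∀ e',
          (T (I.tail e') = 2 ∧ (I.tail e' = u → e' ∉ l₂)) →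
          (τ.nat 4 (I.tail e') = 2 ∧ (I.tail e' = u → e' ∉ e :: l₂)) ∨ e' = e := by
        intro T hT e' he'
        by_cases hee : e' = e
        · exact .inr hee
        · refine .inl ⟨(hT _).1 he'.1, fun h => ?_⟩
          rw [List.mem_cons, not_or]
          exact ⟨hee, he'.2 h⟩
      have hf1 := g2.filled_le.trans g1.card_live_le
      have hf2 := r2.filled_le.trans r1.card_live_le
      have ht : (NExp.const 0).time + (NExp.load 3 (Prog.pred arc)).time + 1 = 7 := rfl
      rcases r4 with ⟨hc, hF⟩ | ⟨hc, hF⟩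
      · have d4 : τ'.nat 4 = Function.update (τ.nat 4) (I.head e) 1 := by
          rw [hF.1 4 (by norm_num)]; simp [Mem.label, Mem.setNat_nat_of_ne]
        have d5 : τ'.nat 5 = Function.update (τ.nat 5) (I.head e) (e + 1) := by
          rw [hF.1 5 (by norm_num)]; simp [Mem.label, Mem.setNat_nat_of_ne]
        have dr : τ'.real 2 = Function.update (τ.real 2) (I.head e) (τ.real 2 u + τ.real 1 e) := by
          rw [hF.2]; simp [Mem.label]
        have d6 : ∀ j, j ≠ 2 → τ'.nat 6 j = τ.nat 6 j := by
          intro j hj; rw [hF.1 6 (by norm_num)]; simp [Mem.label, Mem.setNat_nat_of_ne, hj]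
        have d2 : τ'.nat 2 = τ.nat 2 := by
          rw [hF.1 2 (by norm_num)]; simp [Mem.label, Mem.setNat_nat_of_ne]
        have d3 : τ'.nat 3 = τ.nat 3 := by
          rw [hF.1 3 (by norm_num)]; simp [Mem.label, Mem.setNat_nat_of_ne]
        have d9 : τ'.nat 9 = τ.nat 9 := by
          rw [hF.1 9 (by norm_num)]; simp [Mem.label, Mem.setNat_nat_of_ne]
        have dr1 : τ'.real 1 = τ.real 1 := by
          rw [hF.2]; simp [Mem.label, Mem.setReal]
        have hv2 : τ.nat 4 (I.head e) ≠ 2 := by rcases hc with hc | hc <;> omega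
        have hTT : ∀ x : Fin n, τ'.nat 4 x = 2 ↔ τ.nat 4 x = 2 := by
          intro x
          rw [d4, Function.update_apply]
          split_ifs with hx
          · rw [hx]; simp [hv2]
          · rfl
        have huh : (u : ℕ) ≠ I.head e := by intro h; rw [← h] at hv2; exact hv2 htu
        have hD' := g10.label hw (e := e) (by rw [hte]; exact htu) (by rw [hte]; exact g9)
          (by rw [hte, ← g7]; exact hc) (hR _ hTT)
        refine ⟨(H₂, l₂), τ'.setNat 6 0 (τ.nat 3 e), _, .seq hex (exec_storeN I (k := 7) rfl
          (by simp [NExp.eval, Prog.pred, arc, d6, he, d3]) rfl), ⟨r1.setMainReg _ _, r2, r3, ?_, ?_,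
          fun e' he' => g6 e' (List.mem_cons_of_mem _ he'), ?_, ?_, ?_, ?_, ?_, ?_, ?_, ?_⟩, ?_⟩
        · simp [d6, g4]
        · simpa [Mem.setNat_nat_of_ne, d3] using hl₂
        · intro e'; rw [Mem.setNat_real, dr1]; exact g7 e'
        · intro x; rw [Mem.setNat_nat_of_ne _ (by norm_num), hTT, g8]
        · intro x hx
          rw [Mem.setNat_nat_of_ne _ (by norm_num), hTT] at hx
          have hxh : (x : ℕ) ≠ I.head e := by intro h; rw [← h] at hv2; exact hv2 hx
          rw [Mem.setNat_real, dr, Function.update_of_ne hxh, Function.update_of_ne huh]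
          exact g9 x hx
        · refine hD'.congr ?_ ?_ ?_ ?_
          · rw [Mem.setNat_nat_of_ne _ (by norm_num), d4]
          · rw [Mem.setNat_nat_of_ne _ (by norm_num), d5]
          · rw [Mem.setNat_real, dr, hte, g7]
          · intro e' he'
            rw [Mem.setNat_nat_of_ne _ (by norm_num)] at he'
            exact he'
        · rw [Mem.setNat_nat_of_ne _ (by norm_num), d2, g11]
        · rw [Mem.setNat_nat_of_ne _ (by norm_num), d3, g12]
        · rw [Mem.setNat_real, dr1, g13]
        · rw [Mem.setNat_nat_of_ne _ (by norm_num), d9, g14]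
        · simp only [hbt, List.length_cons]; omega
      · have d4 : τ'.nat 4 = τ.nat 4 := by
          rw [hF.1 4 (by norm_num)]; simp [Mem.setNat_nat_of_ne]
        have d5 : τ'.nat 5 = τ.nat 5 := by
          rw [hF.1 5 (by norm_num)]; simp [Mem.setNat_nat_of_ne]
        have dr : τ'.real = τ.real := by
          rw [hF.2]; rfl
        have d6 : ∀ j, j ≠ 2 → τ'.nat 6 j = τ.nat 6 j := by
          intro j hj; rw [hF.1 6 (by norm_num)]; simp [hj]
        have d2 : τ'.nat 2 = τ.nat 2 := by
          rw [hF.1 2 (by norm_num)]; simp [Mem.setNat_nat_of_ne]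
        have d3 : τ'.nat 3 = τ.nat 3 := by
          rw [hF.1 3 (by norm_num)]; simp [Mem.setNat_nat_of_ne]
        have d9 : τ'.nat 9 = τ.nat 9 := by
          rw [hF.1 9 (by norm_num)]; simp [Mem.setNat_nat_of_ne]
        have hD' := g10.skip hw (e := e) (by rw [hte]; exact htu) (by rw [hte]; exact g9)
          (by rw [hte, ← g7]; exact hc) (hR _ fun _ => Iff.rfl)
        refine ⟨(H₂, l₂), τ'.setNat 6 0 (τ.nat 3 e), _, .seq hex (exec_storeN I (k := 7) rfl
          (by simp [NExp.eval, Prog.pred, arc, d6, he, d3]) rfl), ⟨r1.setMainReg _ _, r2, r3, ?_, ?_,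
          fun e' he' => g6 e' (List.mem_cons_of_mem _ he'), ?_, ?_, ?_, ?_, ?_, ?_, ?_, ?_⟩, ?_⟩
        · simp [d6, g4]
        · simpa [Mem.setNat_nat_of_ne, d3] using hl₂
        · intro e'; rw [Mem.setNat_real, dr]; exact g7 e'
        · intro x; rw [Mem.setNat_nat_of_ne _ (by norm_num), d4, g8]
        · intro x hx
          rw [Mem.setNat_nat_of_ne _ (by norm_num), d4] at hx
          rw [Mem.setNat_real, dr]
          exact g9 x hx
        · refine hD'.congr ?_ ?_ ?_ ?_
          · rw [Mem.setNat_nat_of_ne _ (by norm_num), d4]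
          · rw [Mem.setNat_nat_of_ne _ (by norm_num), d5]
          · rw [Mem.setNat_real, dr]
          · intro e' he'
            rw [Mem.setNat_nat_of_ne _ (by norm_num), d4] at he'
            exact he'
        · rw [Mem.setNat_nat_of_ne _ (by norm_num), d2, g11]
        · rw [Mem.setNat_nat_of_ne _ (by norm_num), d3, g12]
        · rw [Mem.setNat_real, dr, g13]
        · rw [Mem.setNat_nat_of_ne _ (by norm_num), d9, g14]
        · simp only [hbt, List.length_cons]; omega)
    (a := (H, l)) (σ := σ)
    ⟨h, hH, hn, hu, hl, hlt', hwt, fun _ => Iff.rfl, hmax,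
      hD.congr rfl rfl rfl fun e he => ⟨he.1, fun ht => he.2 ht (hlt e ht)⟩, rfl, rfl, rfl, rfl⟩
  simp only at g1 g2 g3 g4 g5 g6 g7 g8 g9 g10 g11 g12 g13 g14 hk
  have hzero : σ'.nat 6 0 = 0 := by
    simpa [isPos, BExp.Holds, NExp.eval, arc] using hb
  have hnil : l' = [] := by
    obtain _ | ⟨e, l₂⟩ := l'
    · rfl
    · have := g5.1; omega
  subst hnil
  refine ⟨H', σ', k, hex, g1, g2, g3, g10.congr rfl rfl rfl fun e he => ⟨he, by simp⟩, g8, g11, g12,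
    g13, g14, ?_⟩
  have hf1 := g2.filled_le.trans g1.card_live_le
  have hf2 := hH.filled_le.trans h.card_live_le
  rw [hbt] at hk
  simp only [List.length_nil] at hk
  omega

/-- Each vertex is finished at most once, at amortized cost O(L + 1), and each arc is relaxed at
most once, when its tail is finished. The ghost state includes the memory so that the potential can
count unfinished vertices and arcs with unfinished tail. -/
theorem exec_dijkstra {w : Fin m → ℝ} (hw : ∀ e, 0 ≤ w e) {σ : Mem} {H : Heap} (h : Rep n σ H)
    (hH : H.Valid) (hn : H.np = 0) {adj : Fin n → List (Fin m)} (hG : GraphRep w adj σ)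
    (hadj : ∀ u e, e ∈ adj u ↔ I.tail e = u) (hnd : ∀ u, (adj u).Nodup)
    (hD : I.DijkstraInv w (σ.nat 4) (σ.nat 5) (σ.real 2) fun e => σ.nat 4 (I.tail e) = 2)
    {L : ℕ} (hL : ∀ r, 4 ^ r ≤ 3 ^ r * n → r ≤ L) :
    ∃ σ' k, Exec I dijkstra σ σ' k ∧ (∀ v : Fin n, σ'.nat 4 v ≠ 1) ∧
      I.DijkstraInv w (σ'.nat 4) (σ'.nat 5) (σ'.real 2) (fun e => σ'.nat 4 (I.tail e) = 2) ∧
      σ'.nat 9 = σ.nat 9 ∧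
      k ≤ 4000 * H.empty + 150 * n + (1000 * L + 1100) * n + 5100 * m + 10 := by
  have hbt : (isPos (.load 15 (.const 0))).time = 4 := rfl
  obtain ⟨⟨H', τ'⟩, σ', k, hex, ⟨rfl, g1, g2, g3, g4, g5, g6⟩, hb, hk⟩ :=
    exec_while I (b := isPos (.load 15 (.const 0))) (p := finish) (α := Heap × Mem)
    (fun p τ => p.2 = τ ∧ Rep n τ p.1 ∧ p.1.Valid ∧ p.1.np = 0 ∧ GraphRep w adj τ ∧
      I.DijkstraInv w (τ.nat 4) (τ.nat 5) (τ.real 2) (fun e => τ.nat 4 (I.tail e) = 2) ∧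
      τ.nat 9 = σ.nat 9)
    (fun p => 4000 * p.1.empty + 150 * (n - p.1.filled) +
      (1000 * L + 1100) * {v : Fin n | p.2.nat 4 v ≠ 2}.toFinset.card +
      5100 * {e : Fin m | p.2.nat 4 (I.tail e) ≠ 2}.toFinset.card)
    (by
      rintro ⟨H₁, τ'⟩ τ ⟨hττ, g1, g2, g3, g4, g5, g6⟩ hb
      simp only at hττ g1 g2 g3 g4 g5 g6
      subst hττ
      have hpos : 0 < H₁.live.card := by
        rw [← H₁.cnt_zero]
        simpa [isPos, BExp.Holds, NExp.eval, g1.cnt] using hb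
      obtain ⟨u, H₂, σ₂, k₂, e₂, a1, a2, a3, a4, a5, a6, a7⟩ :=
        exec_extractMin I g1 g2 g3 (Finset.card_pos.1 hpos) hL
      obtain ⟨hun, hu1⟩ := (g1.live u).1 a1
      lift u to Fin n using hun
      have d4 : σ₂.nat 4 = Function.update (τ'.nat 4) u 2 := by
        rw [a6.1 4 (by norm_num)]; simp [Mem.setNat_nat_of_ne]
      have d5 : σ₂.nat 5 = τ'.nat 5 := by
        rw [a6.1 5 (by norm_num)]; simp [Mem.setNat_nat_of_ne]
      have d61 : σ₂.nat 6 1 = u := by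
        rw [a6.1 6 (by norm_num)]; simp [Mem.setNat_nat_of_ne]
      have d2 : σ₂.nat 2 = τ'.nat 2 := by
        rw [a6.1 2 (by norm_num)]; simp [Mem.setNat_nat_of_ne]
      have d3 : σ₂.nat 3 = τ'.nat 3 := by
        rw [a6.1 3 (by norm_num)]; simp [Mem.setNat_nat_of_ne]
      have d9 : σ₂.nat 9 = τ'.nat 9 := by
        rw [a6.1 9 (by norm_num)]; simp [Mem.setNat_nat_of_ne]
      have dr : σ₂.real = τ'.real := a6.2
      have hmin : ∀ v : Fin n, τ'.nat 4 v = 1 → τ'.real 2 u ≤ τ'.real 2 v := by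
        intro v hv
        rw [g1.key]
        exact a2 v ((g1.live v).2 ⟨v.2, hv⟩)
      have hD₂ := g5.extract hu1 hmin
      have hup : ∀ x : Fin n, σ₂.nat 4 x = 2 ↔ x = u ∨ τ'.nat 4 x = 2 := by
        intro x
        rw [d4, Function.update_apply]
        simp only [Fin.val_inj]
        split_ifs with hx
        · simp [hx]
        · simp [hx]
      obtain ⟨H₃, σ₃, k₃, e₃, b1, b2, b3, b4, b5, b6, b7, b8, b9, b10⟩ :=
        exec_relaxList I hw (σ := σ₂.setNat 6 0 (σ₂.nat 2 u)) (a3.setMainReg _ _) a4 a5 (u := u)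
          (by simp [d61]) (l := adj u)
          (by
            have := g4.linked u
            simpa [Mem.setNat_nat_of_ne, d2, d3] using this)
          (fun e he => (hadj u e).2 he) (fun e he => (hadj u e).1 he)
          (by intro e; rw [Mem.setNat_real, dr]; exact g4.weight e)
          (by rw [Mem.setNat_nat_of_ne _ (by norm_num), hup]; exact .inl rfl)
          (by
            intro x hx
            rw [Mem.setNat_nat_of_ne _ (by norm_num), hup] at hx
            rw [Mem.setNat_real, dr]
            rcases hx with rfl | hx
            · exact le_rfl
            · exact g5.order x u hx hu1)
          (hD₂.congr (by rw [Mem.setNat_nat_of_ne _ (by norm_num), d4])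
            (by rw [Mem.setNat_nat_of_ne _ (by norm_num), d5]) (by rw [Mem.setNat_real, dr])
            (by
              intro e he
              rw [Mem.setNat_nat_of_ne _ (by norm_num), hup] at he
              exact he.1.resolve_left he.2))
      have hdone : ∀ x : Fin n, σ₃.nat 4 x = 2 ↔ x = u ∨ τ'.nat 4 x = 2 := by
        intro x
        rw [b5, Mem.setNat_nat_of_ne _ (by norm_num), hup]
      have hu2 : τ'.nat 4 u ≠ 2 := by omega
      have c1 : {v : Fin n | τ'.nat 4 v ≠ 2}.toFinset.card =
          {v : Fin n | σ₃.nat 4 v ≠ 2}.toFinset.card + 1 := by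
        rw [← Finset.card_insert_of_notMem (a := u) (by simp [hdone])]
        congr 1
        ext x
        simp only [Set.mem_toFinset, Set.mem_ofPred_eq, Finset.mem_insert, ne_eq, hdone]
        by_cases hx : x = u
        · subst hx; simp [hu2]
        · simp [hx]
      have c2 : {e : Fin m | τ'.nat 4 (I.tail e) ≠ 2}.toFinset.card =
          {e : Fin m | σ₃.nat 4 (I.tail e) ≠ 2}.toFinset.card + (adj u).length := by
        rw [← List.toFinset_card_of_nodup (hnd u), ← Finset.card_union_of_disjoint]
        · congr 1
          ext e
          simp only [Set.mem_toFinset, Set.mem_ofPred_eq, Finset.mem_union, ne_eq, hdone,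
            List.mem_toFinset, hadj]
          by_cases hx : I.tail e = u
          · simp [hx, hu2]
          · simp [hx]
        · rw [Finset.disjoint_left]
          intro e
          simp only [Set.mem_toFinset, Set.mem_ofPred_eq, ne_eq, hdone, List.mem_toFinset, hadj]
          tauto
      have hf1 := g2.filled_le.trans g1.card_live_le
      have hf2 := b2.filled_le.trans b1.card_live_le
      have hf3 := a4.filled_le.trans a3.card_live_le
      refine ⟨(H₃, σ₃), σ₃, _, .seq e₂ (.seq (exec_storeN I (k := 5) rfl
        (by simp [NExp.eval, cur, d61]) rfl) e₃), ⟨rfl, b1, b2, b3, g4.congr ?_ ?_ ?_, b4, ?_⟩, ?_⟩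
      · rw [b6, Mem.setNat_nat_of_ne _ (by norm_num), d2]
      · rw [b7, Mem.setNat_nat_of_ne _ (by norm_num), d3]
      · rw [b8, Mem.setNat_real, dr]
      · rw [b9, Mem.setNat_nat_of_ne _ (by norm_num), d9, g6]
      · simp only [hbt, c1, c2]
        ring_nf at a7 b10 ⊢
        omega)
    (a := (H, σ)) (σ := σ) ⟨rfl, h, hH, hn, hG, hD, rfl⟩
  simp only at g1 g2 g3 g4 g5 g6 hk hex hb
  have hzero : H'.live.card = 0 := by
    rw [← H'.cnt_zero]
    simpa [isPos, BExp.Holds, NExp.eval, g1.cnt] using hb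
  refine ⟨τ', k, hex, ?_, g5, g6, ?_⟩
  · intro v hv
    have := (g1.live v).2 ⟨v.2, hv⟩
    rw [Finset.card_eq_zero.1 hzero] at this
    simp at this
  · have h1 : {v : Fin n | σ.nat 4 v ≠ 2}.toFinset.card ≤ n :=
      (Finset.card_le_univ _).trans (by simp)
    have h2 : {e : Fin m | σ.nat 4 (I.tail e) ≠ 2}.toFinset.card ≤ m :=
      (Finset.card_le_univ _).trans (by simp)
    have h3 := Nat.mul_le_mul_left (1000 * L + 1100) h1
    rw [hbt] at hk
    omega

end

end QSPP

namespace QSPP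

/-! ### Arc weights proportional to the factor of the product matrix -/

namespace Instance

variable {n m : ℕ} (I : Instance n m)

/-- The entry of `Q + Diag(c)` in row `e` and column `f`, or zero if there is no column `f`. -/
noncomputable def pivotWeight (f : ℕ) (e : Fin m) : ℝ :=
  if h : f < m then I.costMatrix e ⟨f, h⟩ else 0

/-- The linear cost of `f`, or zero if there is no arc `f`. -/
noncomputable def pivotCost (f : ℕ) : ℝ := if h : f < m then I.c ⟨f, h⟩ else 0

/-- There is an arc `f` of positive linear cost, or `f = m` and all linear costs vanish. -/
def IsPivot (f : ℕ) : Prop := (f = m ∧ ∀ e, I.c e = 0) ∨ 0 < I.pivotCost f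

theorem pivotCost_nonneg (f : ℕ) : 0 ≤ I.pivotCost f := by
  unfold pivotCost; split_ifs; exacts [I.c_nonneg _, le_rfl]

theorem costMatrix_apply_self (e : Fin m) : I.costMatrix e e = I.c e := by
  simp [costMatrix, I.Q_diag]

theorem pivotWeight_nonneg (h : IsNonnegSymmProduct I.costMatrix) (f : ℕ) (e : Fin m) :
    0 ≤ I.pivotWeight f e := by
  unfold pivotWeight; split_ifs; exacts [h.1 _ _, le_rfl]

/-- For a genuine pivot the factor a_f in the weights cancels against c_f = a_f². If all linear
costs vanish, so does a, and both sides are zero because division by zero yields zero. -/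
theorem cost_eq_div (h : IsNonnegSymmProduct I.costMatrix) {f : ℕ} (hf : I.IsPivot f)
    (P : List (Fin m)) : I.cost P = linearCost (I.pivotWeight f) P ^ 2 / I.pivotCost f := by
  obtain ⟨a, -, ha⟩ := h.exists_nonneg
  have hc : ∀ e, I.c e = a e * a e := fun e => by
    rw [← costMatrix_apply_self, ha, Matrix.vecMulVec_apply]
  rw [I.cost_eq_sq ha]
  rcases hf with ⟨rfl, h0⟩ | hpos
  · have ha0 : ∀ e, a e = 0 := fun e => by
      have := hc e; rw [h0 e] at this; exact mul_self_eq_zero.1 this.symm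
    simp [linearCost, ha0, pivotCost]
  · have hfm : f < m := by
      by_contra hlt; simp [pivotCost, hlt] at hpos
    have hw : linearCost (I.pivotWeight f) P = linearCost a P * a ⟨f, hfm⟩ := by
      simp only [linearCost, pivotWeight, hfm, dif_pos, ha, Matrix.vecMulVec_apply, Finset.sum_mul]
    have hpc : I.pivotCost f = a ⟨f, hfm⟩ * a ⟨f, hfm⟩ := by simp [pivotCost, hfm, hc]
    rw [hpc] at hpos
    rw [hw, hpc, eq_div_iff hpos.ne']
    ring

end Instance

/-! ### Preparation -/

namespace Prog

/-- The loop counter of the preparation. -/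
def ctr : NExp := .load 7 (.const 0)
/-- The pivot arc. -/
def pivot : NExp := .load 9 (.const 0)
/-- Increment the loop counter. -/
def incr : Cmd := .storeN 7 (.const 0) (succ ctr)

/-- Body of the search for an arc of positive linear cost. -/
def findPivotBody : Cmd :=
  .seq (.ite (.realLt (.const 0) (.linear ctr)) (.storeN 9 (.const 0) ctr) .skip) incr

/-- Search for an arc of positive linear cost. -/
def findPivot : Cmd :=
  .seq (.storeN 9 (.const 0) .numArcs) (.while (.natLt ctr .numArcs) findPivotBody)

/-- Compute the weight of an arc and insert it into the list of arcs with the same tail. -/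
def buildBody : Cmd :=
  .seq (.ite (.natEq ctr pivot) (.storeR 1 ctr (.linear ctr)) (.storeR 1 ctr (.quad ctr pivot))) <|
  .seq (.storeN 3 ctr (.load 2 (.tail ctr))) <|
  .seq (.storeN 2 (.tail ctr) (succ ctr)) incr

/-- Compute arc weights and lists of arcs with a given tail. -/
def build : Cmd :=
  .seq (.storeN 7 (.const 0) (.const 0)) (.while (.natLt ctr .numArcs) buildBody)

/-- Make the source the only item of the heap. -/
def start : Cmd :=
  .seq (.storeN 4 .source (.const 1)) <| .seq (.storeN 13 (.const 0) (succ .source)) <|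
  .storeN 15 (.const 0) (.const 1)

end Prog

open Prog

section

variable {n m : ℕ} (I : Instance n m)

/-- The initial value m is no arc; it remains in place precisely when no linear cost is positive. -/
theorem exec_findPivot : ∃ σ' k, Exec I findPivot Mem.init σ' k ∧
    (∀ A, A ≠ 7 → A ≠ 9 → σ'.nat A = fun _ => 0) ∧ (σ'.real = fun _ _ => 0) ∧
    I.IsPivot (σ'.nat 9 0) ∧ k ≤ 30 * m + 10 := by
  have lf : findPivotBody.LoopFree := by repeat' constructor
  have hbt : (BExp.natLt ctr .numArcs).time = 4 := rfl
  obtain ⟨i, σ', k, hex, ⟨g1, g2, g3, g4, g5⟩, hb, hk⟩ :=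
    exec_while I (b := .natLt ctr .numArcs) (p := findPivotBody) (α := ℕ)
    (fun i τ => τ.nat 7 0 = i ∧ i ≤ m ∧ (∀ A, A ≠ 7 → A ≠ 9 → τ.nat A = fun _ => 0) ∧
      (τ.real = fun _ _ => 0) ∧
      ((τ.nat 9 0 = m ∧ ∀ e : Fin m, e < i → I.c e = 0) ∨ 0 < I.pivotCost (τ.nat 9 0)))
    (fun i => 30 * (m - i))
    (by
      rintro i τ ⟨g1, g2, g3, g4, g5⟩ hb
      have hi : i < m := by simpa [BExp.Holds, NExp.eval, ctr, g1] using hb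
      obtain ⟨k, hk, hex⟩ := lf.exec I τ
      have hk' : k ≤ 25 := hk.trans (by decide)
      by_cases hc : 0 < I.c ⟨i, hi⟩
      · have e : findPivotBody.run I τ = (τ.setNat 9 0 i).setNat 7 0 (i + 1) := by
          simp [findPivotBody, Cmd.run, BExp.Holds, NExp.eval, RExp.eval, ctr, g1, hi, hc, incr,
            Prog.succ, Mem.setNat_nat_of_ne]
        rw [e] at hex
        refine ⟨i + 1, _, k, hex, ⟨by simp, hi, ?_, by simpa using g4, .inr ?_⟩, ?_⟩
        · intro A h7 h9
          rw [Mem.setNat_nat_of_ne _ h7, Mem.setNat_nat_of_ne _ h9, g3 A h7 h9]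
        · simpa [Mem.setNat_nat_of_ne, Instance.pivotCost, hi] using hc
        · rw [hbt]; omega
      · have e : findPivotBody.run I τ = τ.setNat 7 0 (i + 1) := by
          simp [findPivotBody, Cmd.run, BExp.Holds, NExp.eval, RExp.eval, ctr, g1, hi, hc, incr,
            Prog.succ]
        rw [e] at hex
        refine ⟨i + 1, _, k, hex, ⟨by simp, hi, ?_, by simpa using g4, ?_⟩, ?_⟩
        · intro A h7 h9
          rw [Mem.setNat_nat_of_ne _ h7, g3 A h7 h9]
        · rw [Mem.setNat_nat_of_ne _ (by norm_num)]
          rcases g5 with ⟨h1, h2⟩ | h1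
          · refine .inl ⟨h1, fun e he => ?_⟩
            rcases Nat.lt_succ_iff_lt_or_eq.1 he with he | he
            · exact h2 e he
            · obtain rfl : e = ⟨i, hi⟩ := Fin.ext he
              exact le_antisymm (not_lt.1 hc) (I.c_nonneg _)
          · exact .inr h1
        · rw [hbt]; omega)
    (a := 0) (σ := Mem.init.setNat 9 0 m)
    ⟨rfl, Nat.zero_le _, fun A h7 h9 => Mem.setNat_nat_of_ne _ h9 _ _, rfl,
      .inl ⟨by simp, by simp⟩⟩
  have hi : m ≤ i := by simpa [BExp.Holds, NExp.eval, ctr, g1] using hb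
  refine ⟨σ', _, .seq (exec_storeN I (k := 3) rfl rfl rfl) hex, g3, g4, ?_, ?_⟩
  · exact g5.imp (fun h => ⟨h.1, fun e => h.2 e (e.2.trans_le hi)⟩) id
  · rw [hbt] at hk; omega

theorem Linked.congr {next next' : ℕ → ℕ} {x : ℕ} {l : List (Fin m)} (h : Linked next x l)
    (hn : ∀ e ∈ l, next' e = next e) : Linked next' x l := by
  induction l generalizing x with
  | nil => exact h
  | cons e l ih =>
    refine ⟨h.1, ?_⟩
    rw [hn e (by simp)]
    exact ih h.2 fun e' he' => hn e' (List.mem_cons_of_mem _ he')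

/-- The diagonal of Q is zero, so the weight of the pivot itself is its linear cost, and all other
weights are entries of Q. For the pivot m these reads are out of range and give 0, as `pivotWeight`
does. Each arc is put in front of the list of its tail. -/
theorem exec_build {σ : Mem} (h0 : ∀ A, A ≠ 7 → A ≠ 9 → σ.nat A = fun _ => 0)
    (hr : σ.real = fun _ _ => 0) {f : ℕ} (hf : σ.nat 9 0 = f) :
    ∃ σ' k adj, Exec I build σ σ' k ∧
      (∀ A, A ≠ 2 → A ≠ 3 → A ≠ 7 → A ≠ 9 → σ'.nat A = fun _ => 0) ∧
      (∀ A, A ≠ 1 → σ'.real A = fun _ => 0) ∧ σ'.nat 9 0 = f ∧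
      GraphRep (I.pivotWeight f) adj σ' ∧ (∀ u e, e ∈ adj u ↔ I.tail e = u) ∧
      (∀ u, (adj u).Nodup) ∧ k ≤ 50 * m + 10 := by
  have lf : buildBody.LoopFree := by repeat' constructor
  have hbt : (BExp.natLt ctr .numArcs).time = 4 := rfl
  obtain ⟨i, σ', k, hex, ⟨g1, g2, g3, g4, g5, g6, adj, g7, g8, g9⟩, hb, hk⟩ :=
    exec_while I (b := .natLt ctr .numArcs) (p := buildBody) (α := ℕ)
    (fun i τ => τ.nat 7 0 = i ∧ i ≤ m ∧
      (∀ A, A ≠ 2 → A ≠ 3 → A ≠ 7 → A ≠ 9 → τ.nat A = fun _ => 0) ∧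
      (∀ A, A ≠ 1 → τ.real A = fun _ => 0) ∧ τ.nat 9 0 = f ∧
      (∀ e : Fin m, e < i → τ.real 1 e = I.pivotWeight f e) ∧
      ∃ adj : Fin n → List (Fin m), (∀ u : Fin n, Linked (τ.nat 3) (τ.nat 2 u) (adj u)) ∧
        (∀ u e, e ∈ adj u ↔ I.tail e = u ∧ e < i) ∧ ∀ u, (adj u).Nodup)
    (fun i => 50 * (m - i))
    (by
      rintro i τ ⟨g1, g2, g3, g4, g5, g6, adj, g7, g8, g9⟩ hb
      have hi : i < m := by simpa [BExp.Holds, NExp.eval, ctr, g1] using hb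
      obtain ⟨k, hk, hex⟩ := lf.exec I τ
      have hk' : k ≤ 45 := hk.trans (by decide)
      set e₀ : Fin m := ⟨i, hi⟩ with he₀
      have e : buildBody.run I τ = (((τ.setReal 1 i (I.pivotWeight f e₀)).setNat 3 i
          (τ.nat 2 (I.tail e₀))).setNat 2 (I.tail e₀) (i + 1)).setNat 7 0 (i + 1) := by
        by_cases hif : i = f
        · have : I.pivotWeight f e₀ = I.c e₀ := by
            rw [← I.costMatrix_apply_self]; simp [Instance.pivotWeight, ← hif, hi, he₀]
          simp [buildBody, Cmd.run, BExp.Holds, NExp.eval, RExp.eval, ctr, pivot, g1, g5, hi, incr,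
            Prog.succ, Mem.setNat_nat_of_ne, hif, this]
          simp [← hif, hi, he₀]
        · have : I.pivotWeight f e₀ = if h : f < m then I.Q e₀ ⟨f, h⟩ else 0 := by
            simp only [Instance.pivotWeight, Instance.costMatrix, Matrix.add_apply,
              Matrix.diagonal_apply, he₀, Fin.mk.injEq, hif, if_false, add_zero]
          rw [this]
          simp [buildBody, Cmd.run, BExp.Holds, NExp.eval, RExp.eval, ctr, pivot, g1, g5, hi, incr,
            Prog.succ, Mem.setNat_nat_of_ne, hif, he₀]
      rw [e] at hex
      refine ⟨i + 1, _, k, hex, ⟨by simp, hi, ?_, ?_, ?_, ?_,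
        fun u => if I.tail e₀ = u then e₀ :: adj u else adj u, ?_, ?_, ?_⟩, ?_⟩
      · intro A h2 h3 h7 h9
        rw [Mem.setNat_nat_of_ne _ h7, Mem.setNat_nat_of_ne _ h2, Mem.setNat_nat_of_ne _ h3]
        exact g3 A h2 h3 h7 h9
      · intro A h1
        simp only [Mem.setNat_real, Mem.setReal_real_of_ne _ h1]
        exact g4 A h1
      · simpa [Mem.setNat_nat_of_ne] using g5
      · intro e he
        simp only [Mem.setNat_real, Mem.setReal_real_self, Function.update_apply]
        split_ifs with hei
        · obtain rfl : e = e₀ := Fin.ext hei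
          rfl
        · exact g6 e (by omega)
      · intro u
        have hl : Linked (Function.update (τ.nat 3) i (τ.nat 2 (I.tail e₀))) (τ.nat 2 u) (adj u) :=
          (g7 u).congr fun e he => Function.update_of_ne (by have := (g8 u e).1 he; omega) _ _
        simp only [Mem.setNat_nat_of_ne _ (show (3 : ℕ) ≠ 7 by norm_num),
          Mem.setNat_nat_of_ne _ (show (3 : ℕ) ≠ 2 by norm_num),
          Mem.setNat_nat_of_ne _ (show (2 : ℕ) ≠ 7 by norm_num),
          Mem.setNat_nat_of_ne _ (show (2 : ℕ) ≠ 3 by norm_num), Mem.setNat_nat_self, Mem.setReal_nat]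
        split_ifs with hu
        · subst hu
          refine ⟨by simp [he₀], ?_⟩
          have : Function.update (τ.nat 3) i (τ.nat 2 (I.tail e₀)) (e₀ : ℕ) = τ.nat 2 (I.tail e₀) := by
            simp [he₀]
          rw [this]
          exact hl
        · rw [Function.update_of_ne (by rw [ne_eq, Fin.val_inj]; exact Ne.symm hu)]
          exact hl
      · intro u e
        have hee : e = e₀ ↔ (e : ℕ) = i := by rw [he₀, Fin.ext_iff]
        beta_reduce
        split_ifs with hu
        · rw [List.mem_cons, g8]
          constructor
          · rintro (h | h)
            · exact ⟨h ▸ hu, by have := hee.1 h; omega⟩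
            · exact ⟨h.1, by omega⟩
          · rintro ⟨h1, h2⟩
            by_cases h : e = e₀
            · exact .inl h
            · exact .inr ⟨h1, by rw [hee] at h; omega⟩
        · rw [g8]
          constructor
          · rintro ⟨h1, h2⟩; exact ⟨h1, by omega⟩
          · rintro ⟨h1, h2⟩
            refine ⟨h1, ?_⟩
            have : e ≠ e₀ := by rintro rfl; exact hu h1
            rw [ne_eq, hee] at this
            omega
      · intro u
        beta_reduce
        split_ifs with hu
        · refine List.nodup_cons.2 ⟨fun hm => ?_, g9 u⟩
          have := ((g8 u e₀).1 hm).2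
          simp [he₀] at this
        · exact g9 u
      · rw [hbt]; omega)
    (a := 0) (σ := σ.setNat 7 0 0)
    ⟨by simp, Nat.zero_le _,
      fun A h2 h3 h7 h9 => by rw [Mem.setNat_nat_of_ne _ h7, h0 A h7 h9],
      fun A hA => by rw [Mem.setNat_real, hr], by simpa [Mem.setNat_nat_of_ne] using hf,
      by simp, fun _ => [], fun u => by
        rw [Mem.setNat_nat_of_ne _ (show (2 : ℕ) ≠ 7 by norm_num),
          h0 2 (by norm_num) (by norm_num)]
        rfl,
      by simp, by simp⟩
  have hi : m ≤ i := by simpa [BExp.Holds, NExp.eval, ctr, g1] using hb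
  refine ⟨σ', _, adj, .seq (exec_storeN I (k := 3) rfl rfl rfl) hex, g3, g4, g5,
    ⟨g7, fun e => g6 e (e.2.trans_le hi)⟩, fun u e => ?_, g9, ?_⟩
  · rw [g8]
    exact ⟨fun h => h.1, fun h => ⟨h, e.2.trans_le hi⟩⟩
  · rw [hbt] at hk; omega

/-- The heap with the single item `s` and all keys zero. -/
def Heap.single (s : ℕ) : Heap where
  live := {s}
  rk _ := 0
  par _ := 0
  bk := Function.update (fun _ => 0) 0 (s + 1)
  pend _ := 0
  np := 0
  sl _ _ := 0
  key _ := 0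

theorem Heap.valid_single (s : ℕ) : (Heap.single s).Valid := by
  constructor <;> simp [Heap.single, Function.update_apply]
  grind

/-- The zero memory already encodes zero ranks, parents, slots, keys and offset; three writes
suffice, and no initialization over all vertices takes place. -/
theorem Rep.single {σ : Mem} (h0 : ∀ A, A ≠ 2 → A ≠ 3 → A ≠ 7 → A ≠ 9 → σ.nat A = fun _ => 0)
    (hr : ∀ A, A ≠ 1 → σ.real A = fun _ => 0) :
    start.run I σ = ((σ.setNat 4 I.s 1).setNat 13 0 (I.s + 1)).setNat 15 0 1 ∧
    Rep n (start.run I σ) (Heap.single I.s) := by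
  have e : start.run I σ = ((σ.setNat 4 I.s 1).setNat 13 0 (I.s + 1)).setNat 15 0 1 := by
    simp [start, Cmd.run, NExp.eval, Prog.succ]
  refine ⟨e, ?_⟩
  rw [e]
  refine ⟨?_, ?_, ?_, ?_, ?_, ?_, ?_, ?_, ?_, ?_⟩
  · simp [Mem.setNat_nat_of_ne, Heap.single, h0]
  · simp [Mem.setNat_nat_of_ne, Heap.single, h0]
  · simp [Mem.setNat_nat_of_ne, Heap.single, h0]
  · simp [Mem.setNat_nat_of_ne, Heap.single, h0]
  · simp [Mem.setNat_nat_of_ne, Heap.single, h0]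
  · intro j
    have : (Heap.single I.s).cnt j = if j = 0 then 1 else 0 := by
      unfold Heap.cnt
      rcases Nat.eq_zero_or_pos j with rfl | hj
      · simp [Heap.single]
      · rw [if_neg hj.ne', Finset.card_eq_zero, Finset.filter_eq_empty_iff]
        intro x _
        simp only [Heap.single]
        omega
    rw [this]
    simp [Function.update_apply, Mem.setNat_nat_of_ne, h0]
  · intro x _ j hj
    have hj : j ≤ 0 := hj
    simp [Mem.setNat_nat_of_ne, h0, Nat.le_zero.1 hj]
  · simp [Mem.setNat_nat_of_ne, Heap.single, h0]
  · simp [Heap.single, hr]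
  · intro v
    simp only [Heap.single, Finset.mem_singleton]
    simp (disch := decide) only [Mem.setNat_nat_of_ne, Mem.setNat_nat_self, Function.update_apply,
      h0 4 (by norm_num) (by norm_num) (by norm_num) (by norm_num)]
    have := I.s.2
    grind

theorem dijkstraInv_start (w : Fin m → ℝ) (pr : ℕ → ℕ) :
    I.DijkstraInv w (Function.update (fun _ => 0) (I.s : ℕ) 1) pr (fun _ => 0)
      fun e => Function.update (fun _ => 0) (I.s : ℕ) 1 (I.tail e : ℕ) = 2 := by
  have key : ∀ v : Fin n, Function.update (fun _ => 0) (I.s : ℕ) 1 (v : ℕ) =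
      if v = I.s then 1 else 0 := by
    intro v; simp [Function.update_apply, Fin.val_inj]
  refine ⟨?_, ?_, ?_, ?_, ?_⟩
  · intro v; rw [key]; split_ifs <;> norm_num
  · simp
  · intro v hv
    rw [key] at hv
    have : v = I.s := by by_contra h; simp [h] at hv
    subst this
    exact ⟨[], .nil, rfl, by simp, by simp, by simp⟩
  · intro e he
    rw [key] at he
    split_ifs at he; omega
  · intro u v hu
    rw [key] at hu
    split_ifs at hu; omega

end

end QSPP

namespace QSPP

/-! ### Output -/

namespace Prog

/-- The current vertex on the way back from the target. -/
def pos : NExp := .load 7 (.const 1)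
/-- The last arc of the recorded path to the current vertex. -/
def lastArc : NExp := pred (.load 5 pos)
/-- The number of arcs of the path. -/
def len : NExp := .load 1 (.const 0)
/-- The number of arcs that have not yet been written. -/
def rest : NExp := .load 7 (.const 2)
/-- Move to the predecessor of the current vertex. -/
def back : Cmd := .storeN 7 (.const 1) (.tail lastArc)

/-- Count the arcs of the recorded path to the target. -/
def countArcs : Cmd :=
  .seq (.storeN 7 (.const 1) .target) <|
  .while (.not (.natEq pos .source)) (.seq (.storeN 1 (.const 0) (succ len)) back)

/-- Write the arcs of the recorded path to the target. -/
def writeArcs : Cmd :=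
  .seq (.storeN 7 (.const 1) .target) <| .seq (.storeN 7 (.const 2) len) <|
  .while (isPos rest)
    (.seq (.storeN 7 (.const 2) (pred rest)) (.seq (.storeN 0 rest lastArc) back))

/-- Write the cost of the path. -/
def writeCost : Cmd :=
  .storeR 0 (.const 0) (.div (.mul (.load 2 .target) (.load 2 .target)) (.linear pivot))

/-- Output the recorded path to the target and its cost. -/
def output : Cmd :=
  .ite (.natEq (.load 4 .target) (.const 0)) .skip (.seq countArcs (.seq writeArcs writeCost))

/-- Solves the quadratic shortest path problem for product matrices. -/
def qspp : Cmd := .seq findPivot (.seq build (.seq start (.seq dijkstra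
  (.seq (.storeN 1 (.const 0) (.const 0)) output))))

end Prog

open Prog

section

variable {n m : ℕ} (I : Instance n m)

theorem STGraph.PredPath.eq_snoc {G : STGraph n m} {pr : ℕ → ℕ} {v : Fin n} {P : List (Fin m)}
    (h : G.PredPath pr v P) (hP : P ≠ []) : ∃ (Q : List (Fin m)) (e : Fin m), P = Q ++ [e] ∧
      pr v = e + 1 ∧ G.PredPath pr (G.tail e) Q := by
  cases h with
  | nil => exact absurd rfl hP
  | snoc h1 h2 h3 => exact ⟨_, _, rfl, h2, h3⟩

theorem STGraph.PredPath.eq_nil_iff {G : STGraph n m} {pr : ℕ → ℕ} {v : Fin n} {P : List (Fin m)}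
    (h : G.PredPath pr v P) : P = [] ↔ v = G.s := by
  cases h with
  | nil => simp
  | snoc h1 h2 h3 => simp [h1]

theorem exec_countArcs {σ : Mem} {P : List (Fin m)} (hP : I.PredPath (σ.nat 5) I.t P)
    (h0 : σ.nat 1 0 = 0) : ∃ σ' k, Exec I countArcs σ σ' k ∧ σ'.nat 1 0 = P.length ∧
      σ'.real = σ.real ∧ (∀ A, A ≠ 1 → A ≠ 7 → σ'.nat A = σ.nat A) ∧ k ≤ 30 * P.length + 10 := by
  have lf : (Cmd.seq (.storeN 1 (.const 0) (Prog.succ len)) back).LoopFree := by repeat' constructor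
  have hbt : (BExp.not (.natEq pos .source)).time = 5 := rfl
  obtain ⟨⟨v, P'⟩, σ', k, hex, ⟨g1, g2, g3, g4, g5⟩, hb, hk⟩ :=
    exec_while I (b := .not (.natEq pos .source))
    (p := .seq (.storeN 1 (.const 0) (Prog.succ len)) back) (α := Fin n × List (Fin m))
    (fun p τ => τ.nat 7 1 = p.1 ∧ I.PredPath (τ.nat 5) p.1 p.2 ∧
      τ.nat 1 0 + p.2.length = P.length ∧ τ.real = σ.real ∧
      ∀ A, A ≠ 1 → A ≠ 7 → τ.nat A = σ.nat A)
    (fun p => 30 * p.2.length)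
    (by
      rintro ⟨v, P'⟩ τ ⟨g1, g2, g3, g4, g5⟩ hb
      simp only at g1 g2 g3 g4 g5
      have hv : v ≠ I.s := by
        simpa [BExp.Holds, NExp.eval, pos, g1, Fin.val_inj] using hb
      obtain ⟨P₂, e, rfl, hpr, h2⟩ := g2.eq_snoc (by rw [ne_eq, g2.eq_nil_iff]; exact hv)
      obtain ⟨k, hk, hex⟩ := lf.exec I τ
      have hk' : k ≤ 24 := hk.trans (by decide)
      have hr : Cmd.run I (.seq (.storeN 1 (.const 0) (Prog.succ len)) back) τ =
          (τ.setNat 1 0 (τ.nat 1 0 + 1)).setNat 7 1 (I.tail e) := by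
        simp [Cmd.run, NExp.eval, Prog.succ, Prog.pred, len, back, lastArc, pos,
          Mem.setNat_nat_of_ne, g1, hpr]
      rw [hr] at hex
      refine ⟨(I.tail e, P₂), _, k, hex, ⟨by simp, ?_, ?_, g4, ?_⟩, ?_⟩
      · simpa [Mem.setNat_nat_of_ne] using h2
      · simp only [List.length_append, List.length_singleton] at g3
        simp [Mem.setNat_nat_of_ne]
        omega
      · intro A h1 h7
        rw [Mem.setNat_nat_of_ne _ h7, Mem.setNat_nat_of_ne _ h1, g5 A h1 h7]
      · simp only [hbt, List.length_append, List.length_singleton]; omega)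
    (a := (I.t, P)) (σ := σ.setNat 7 1 I.t)
    ⟨by simp, by simpa [Mem.setNat_nat_of_ne] using hP, by simp [Mem.setNat_nat_of_ne, h0], rfl,
      fun A _ h7 => Mem.setNat_nat_of_ne _ h7 _ _⟩
  simp only at g1 g2 g3 g4 g5 hk
  have hv : v = I.s := by
    simpa [BExp.Holds, NExp.eval, pos, g1, Fin.val_inj] using hb
  obtain rfl := g2.eq_nil_iff.2 hv
  refine ⟨σ', _, .seq (exec_storeN I (k := 3) rfl rfl rfl) hex, by simpa using g3, g4, g5, ?_⟩
  rw [hbt] at hk; simp only [List.length_nil] at hk; omega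

/-- The path is traversed backwards from t. The ghost list is the prefix still to be written, and
its length determines the cell of the next arc, so the arcs end up in order from s. -/
theorem exec_writeArcs {σ : Mem} {P : List (Fin m)} (hP : I.PredPath (σ.nat 5) I.t P)
    (h0 : σ.nat 1 0 = P.length) : ∃ σ' k, Exec I writeArcs σ σ' k ∧
      (∀ (i : ℕ) (h : i < P.length), σ'.nat 0 i = (P[i] : Fin m)) ∧
      σ'.real = σ.real ∧ (∀ A, A ≠ 0 → A ≠ 7 → σ'.nat A = σ.nat A) ∧ k ≤ 40 * P.length + 20 := by
  have lf : (Cmd.seq (.storeN 7 (.const 2) (Prog.pred rest))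
    (.seq (.storeN 0 rest lastArc) back)).LoopFree := by repeat' constructor
  have hbt : (isPos rest).time = 4 := rfl
  obtain ⟨⟨v, P'⟩, σ', k, hex, ⟨g1, g2, g3, g4, g5, g6, g7⟩, hb, hk⟩ :=
    exec_while I (b := isPos rest) (p := .seq (.storeN 7 (.const 2) (Prog.pred rest))
      (.seq (.storeN 0 rest lastArc) back)) (α := Fin n × List (Fin m))
    (fun p τ => τ.nat 7 1 = p.1 ∧ I.PredPath (τ.nat 5) p.1 p.2 ∧
      τ.nat 7 2 = p.2.length ∧ τ.real = σ.real ∧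
      (∀ A, A ≠ 0 → A ≠ 7 → τ.nat A = σ.nat A) ∧ p.2 <+: P ∧
      ∀ (i : ℕ) (h : i < P.length), p.2.length ≤ i → τ.nat 0 i = (P[i] : Fin m))
    (fun p => 40 * p.2.length)
    (by
      rintro ⟨v, P'⟩ τ ⟨g1, g2, g3, g4, g5, g6, g7⟩ hb
      simp only at g1 g2 g3 g4 g5 g6 g7
      have hv : 0 < P'.length := by
        simpa [isPos, BExp.Holds, NExp.eval, rest, g3] using hb
      obtain ⟨P₂, e, rfl, hpr, h2⟩ := g2.eq_snoc (List.length_pos_iff.1 hv)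
      obtain ⟨k, hk, hex⟩ := lf.exec I τ
      have hk' : k ≤ 34 := hk.trans (by decide)
      simp only [List.length_append, List.length_singleton] at g3
      have hr : Cmd.run I (.seq (.storeN 7 (.const 2) (Prog.pred rest))
          (.seq (.storeN 0 rest lastArc) back)) τ =
          ((τ.setNat 7 2 P₂.length).setNat 0 P₂.length e).setNat 7 1 (I.tail e) := by
        simp [Cmd.run, NExp.eval, Prog.pred, rest, back, lastArc, pos,
          Mem.setNat_nat_of_ne, g1, g3, hpr]
      rw [hr] at hex
      refine ⟨(I.tail e, P₂), _, k, hex, ⟨by simp, ?_, ?_, g4, ?_, ?_, ?_⟩, ?_⟩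
      · simpa [Mem.setNat_nat_of_ne] using h2
      · simp [Mem.setNat_nat_of_ne]
      · intro A h1 h7
        rw [Mem.setNat_nat_of_ne _ h7, Mem.setNat_nat_of_ne _ h1, Mem.setNat_nat_of_ne _ h7,
          g5 A h1 h7]
      · exact (List.prefix_append _ _).trans g6
      · intro i hi hle
        rw [Mem.setNat_nat_of_ne _ (by norm_num), Mem.setNat_nat_self, Function.update_apply,
          Mem.setNat_nat_of_ne _ (by norm_num)]
        split_ifs with hil
        · subst hil
          obtain ⟨P₃, rfl⟩ := g6
          simp
        · exact g7 i hi (by simp at hle ⊢; omega)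
      · simp only [hbt, List.length_append, List.length_singleton]; omega)
    (a := (I.t, P)) (σ := (σ.setNat 7 1 I.t).setNat 7 2 P.length)
    ⟨by simp, by simpa [Mem.setNat_nat_of_ne] using hP, by simp, rfl,
      fun A _ h7 => by rw [Mem.setNat_nat_of_ne _ h7, Mem.setNat_nat_of_ne _ h7], List.prefix_rfl,
      fun i hi hle => by simp only at hle; omega⟩
  simp only at g1 g2 g3 g4 g5 g6 g7 hk
  have hv : P'.length = 0 := by
    simpa [isPos, BExp.Holds, NExp.eval, rest, g3] using hb
  refine ⟨σ', _, .seq (exec_storeN I (k := 3) rfl rfl rfl) (.seq (exec_storeN I (k := 4) rfl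
    (by simp [NExp.eval, len, Mem.setNat_nat_of_ne, h0]) rfl) hex),
    fun i hi => g7 i hi (by omega), g4, g5, ?_⟩
  rw [hbt] at hk; omega

theorem length_le_of_nodup {G : STGraph n m} {P : List (Fin m)}
    (h : (G.s :: P.map G.head).Nodup) : P.length ≤ n := by
  have := h.length_le_card
  simp at this
  omega

/-- If t is not reached, no walk leads to it. Otherwise the recorded path is nonempty because s ≠ t,
it has minimum length for the pivot weights, and squaring and dividing by the nonnegative pivot cost
preserve minimality. -/
theorem exec_output (h : IsNonnegSymmProduct I.costMatrix) {σ : Mem} {f : ℕ} (hf : I.IsPivot f)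
    (h9 : σ.nat 9 0 = f) (h10 : σ.nat 1 0 = 0) (h1 : ∀ v : Fin n, σ.nat 4 v ≠ 1)
    (hD : I.DijkstraInv (I.pivotWeight f) (σ.nat 4) (σ.nat 5) (σ.real 2)
      fun e => σ.nat 4 (I.tail e) = 2) :
    ∃ σ' k, Exec I output σ σ' k ∧ IsSolution I σ' ∧ k ≤ 70 * n + 60 := by
  have hbt : (BExp.natEq (.load 4 .target) (.const 0)).time = 4 := rfl
  by_cases ht : σ.nat 4 I.t = 0
  · refine ⟨σ, _, .ite_true (by simpa [BExp.Holds, NExp.eval] using ht) (.skip σ),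
      .inr ⟨?_, h10⟩, by rw [hbt]; omega⟩
    rintro ⟨P, -, hP, -⟩
    exact (hD.le_of_isWalk h1 hD.source.1 hP).1 ht
  · obtain ⟨P, p1, p2, p3, p4, -⟩ := hD.path I.t ht
    obtain ⟨σ₁, k₁, e₁, a1, a2, a3, a4⟩ := exec_countArcs I p1 h10
    obtain ⟨σ₂, k₂, e₂, b1, b2, b3, b4⟩ := exec_writeArcs I (σ := σ₁)
      (by rwa [a3 5 (by norm_num) (by norm_num)]) a1
    have hlen := length_le_of_nodup p3
    refine ⟨_, _, .ite_false (by simpa [BExp.Holds, NExp.eval] using ht)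
      (.seq e₁ (.seq e₂ (.storeR _ _ _ _))), .inl ⟨P, ⟨⟨?_, p2, p3⟩, ?_⟩, ?_, ?_, ?_⟩, ?_⟩
    · rintro rfl
      exact I.s_ne_t p2
    · rintro P' ⟨-, hP', hnd'⟩
      rw [I.cost_eq_div h hf, I.cost_eq_div h hf]
      refine div_le_div_of_nonneg_right (pow_le_pow_left₀
        (Finset.sum_nonneg fun e _ => I.pivotWeight_nonneg h f e) ?_ 2) (I.pivotCost_nonneg f)
      change linearCost _ P ≤ _
      rw [linearCost_eq_sum _ _ p3, linearCost_eq_sum _ _ hnd', p4]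
      simpa [hD.source.2] using (hD.le_of_isWalk h1 hD.source.1 hP').2
    · rw [Mem.setReal_nat, b3 1 (by norm_num) (by norm_num), a1]
    · exact b1
    · rw [Mem.setReal_real_self, I.cost_eq_div h hf, linearCost_eq_sum _ _ p3, p4]
      have h9' : σ₂.nat 9 0 = f := by
        rw [b3 9 (by norm_num) (by norm_num), a3 9 (by norm_num) (by norm_num), h9]
      simp [RExp.eval, NExp.eval, pivot, h9', b2, a2, Instance.pivotCost, sq]
    · simp only [hbt, NExp.time, RExp.time, pivot]
      omega

/-- The coefficients add up as follows: for n, 1000 L + 1100 and 150 from the main loop and 70 from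
the output; for m, 30 from the pivot search, 50 from the preparation and 5100 from the main loop. -/
theorem exec_qspp (h : IsNonnegSymmProduct I.costMatrix) {L : ℕ}
    (hL : ∀ r, 4 ^ r ≤ 3 ^ r * n → r ≤ L) : ∃ σ k, Exec I qspp Mem.init σ k ∧ IsSolution I σ ∧
      k ≤ (1000 * L + 1320) * n + 5180 * m + 200 := by
  obtain ⟨σ₁, k₁, e₁, a1, a2, a3, a4⟩ := exec_findPivot I
  obtain ⟨σ₂, k₂, adj, e₂, b1, b2, b3, b4, b5, b6, b7⟩ := exec_build I a1 a2 rfl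
  obtain ⟨hrun, hrep⟩ := Rep.single I b1 b2
  have lf : start.LoopFree := by repeat' constructor
  obtain ⟨k₃, c1, e₃⟩ := lf.exec I σ₂
  have hk₃ : k₃ ≤ 20 := c1.trans (by decide)
  rw [hrun] at e₃ hrep
  obtain ⟨σ₄, k₄, e₄, d1, d2, d3, d4⟩ := exec_dijkstra I (I.pivotWeight_nonneg h (σ₁.nat 9 0)) hrep
    (Heap.valid_single _) rfl (b4.congr (by simp [Mem.setNat_nat_of_ne])
      (by simp [Mem.setNat_nat_of_ne]) (by simp)) b5 b6
    ((dijkstraInv_start I _ _).congr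
      (by simp [Mem.setNat_nat_of_ne, b1]) rfl (by simp [b2])
      (by simp [Mem.setNat_nat_of_ne, b1])) hL
  obtain ⟨σ₅, k₅, e₅, f1, f2⟩ := exec_output I h a3 (σ := σ₄.setNat 1 0 0)
    (by rw [Mem.setNat_nat_of_ne _ (by norm_num), d3]; simpa [Mem.setNat_nat_of_ne] using b3)
    (by simp) (by simpa [Mem.setNat_nat_of_ne] using d1)
    (by simpa [Mem.setNat_nat_of_ne] using d2)
  have hempty : (Heap.single I.s).empty = 0 := by simp [Heap.empty, Heap.single]
  refine ⟨σ₅, _, .seq e₁ (.seq e₂ (.seq e₃ (.seq e₄ (.seq (exec_storeN I (k := 3) rfl rfl rfl)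
    e₅)))), f1, ?_⟩
  rw [hempty] at d4
  ring_nf at d4 ⊢
  omega

end

/-! ### The running time in terms of the logarithm -/

theorem le_floor_log_div_log {n : ℕ} {r : ℕ} (h : 4 ^ r ≤ 3 ^ r * n) :
    r ≤ ⌊Real.log n / Real.log (4 / 3)⌋₊ := by
  refine Nat.le_floor ?_
  rw [le_div_iff₀ (Real.log_pos (by norm_num)), ← Real.log_pow]
  refine Real.log_le_log (by positivity) ?_
  rw [div_pow, div_le_iff₀ (by positivity), mul_comm]
  exact_mod_cast h

theorem solvesWithin_qspp {n m : ℕ} (I : Instance n m) (h : IsNonnegSymmProduct I.costMatrix) :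
    SolvesWithin qspp I (8000 * ((m : ℝ) + (n : ℝ) * Real.log (n : ℝ))) := by
  obtain ⟨σ, k, hex, hsol, hk⟩ := exec_qspp I h fun r => le_floor_log_div_log
  refine ⟨σ, k, hex, ?_, hsol⟩
  -- Two distinct vertices exist. Hence n log n ≥ 1, which absorbs the additive constant, and n ≤ 2
  -- n log n, which absorbs the linear term.
  have hn : 2 ≤ n := by
    have h1 := I.s.2
    have h2 := I.t.2
    have h3 := Fin.val_ne_of_ne I.s_ne_t
    omega
  have hn' : (2 : ℝ) ≤ n := by exact_mod_cast hn
  have hlog : 1 / 2 ≤ Real.log n := by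
    have h1 := Real.log_le_log (by norm_num) hn'
    linarith [Real.log_two_gt_d9]
  -- From 1 − 1/x ≤ log x at x = 4/3; it yields L ≤ 4 log n.
  have h43 : 1 / 4 ≤ Real.log (4 / 3) := by
    have := Real.one_sub_inv_le_log_of_pos (show (0 : ℝ) < 4 / 3 by norm_num)
    norm_num at this ⊢
    linarith
  set L := ⌊Real.log n / Real.log (4 / 3)⌋₊
  have hL : (L : ℝ) ≤ 4 * Real.log n := by
    refine (Nat.floor_le (by positivity)).trans ?_
    rw [div_le_iff₀ (by linarith)]
    nlinarith
  have hk' : (k : ℝ) ≤ (1000 * L + 1320) * n + 5180 * m + 200 := by exact_mod_cast hk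
  have h1 : (L : ℝ) * n ≤ 4 * Real.log n * n := by gcongr
  have h2 : 1 / 2 * (n : ℝ) ≤ Real.log n * n := by gcongr
  have h3 : (0 : ℝ) ≤ m := by positivity
  -- The coefficient of n log n is at most 4000 + 2 · 1320 + 200, and that of m is 5180; both are
  -- below 8000.
  linarith

end QSPP

theorem proposition9 :
    (∀ (n m : ℕ) (I : QSPP.Instance n m), QSPP.IsNonnegSymmProduct I.costMatrix →
      (∃ a : Fin m → ℝ, (∀ e, 0 ≤ a e) ∧ I.costMatrix = Matrix.vecMulVec a a) ∧
      (∀ a : Fin m → ℝ, I.costMatrix = Matrix.vecMulVec a a →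
        ∀ P, I.IsPath P → I.cost P = QSPP.linearCost a P ^ 2) ∧
      (∀ a : Fin m → ℝ, (∀ e, 0 ≤ a e) → I.costMatrix = Matrix.vecMulVec a a →
        ∀ P, I.IsOptimal P ↔ QSPP.IsShortestPath I.toSTGraph a P)) ∧
    (∃ (p : QSPP.Cmd) (C : ℝ), ∀ (n m : ℕ) (I : QSPP.Instance n m),
      QSPP.IsNonnegSymmProduct I.costMatrix →
        QSPP.SolvesWithin p I (C * ((m : ℝ) + (n : ℝ) * Real.log (n : ℝ)))) :=
  ⟨fun _ _ I h => ⟨h.exists_nonneg, fun _ ha P _ => I.cost_eq_sq ha P,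
    fun _ h0 ha P => I.isOptimal_iff_isShortestPath h0 ha P⟩,
    QSPP.Prog.qspp, 8000, fun _ _ I h => QSPP.solvesWithin_qspp I h⟩
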